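/- Let $I_0=[0,1)$, let $\mathcal D$ be the set of dyadic intervals $I\subseteq I_0$, let $I_-$ and $I_+$ be the left and right halves of $I$, and let $h_I=|I|^{-1/2}(\chi_{I_+}-\chi_{I_-})$ be the Haar functions. For $d\ge 1$ and $1\le j\le d$ let $\mathcal S_j$ be the linear operator, defined on finite sums $a\,\chi_{I_0}+\sum_I c_I h_I$ with coefficients in a Banach space $X$, such that $\mathcal S_j(a\,\chi_{I_0})=0$, $\mathcal S_j(c\,h_{I_0})=0$ and, for every $I\in\mathcal D$ and $c\in X$, $$\mathcal S_j(c\,h_{I_\pm})=\pm c\,h_{I_\mp}\ \text{ if } |I_\pm|=2^{-n} \text{ with } n\equiv j-1 \ (\mathrm{mod}\ d),\qquad \mathcal S_j(c\,h_{I_\pm})=0\ \text{ otherwise}.$$ Let $\vec{\mathcal S}=(\mathcal S_1,\dots,\mathcal S_d)$ be the dyadic Riesz vector. Let $\vec R=(R_1,\dots,R_d)$ be the Riesz vector on $\mathbb R^d$, where $R_j$ is the Fourier multiplier operator with symbol $-i\xi_j/|\xi|$, acting on finite sums $\sum_i f_i x_i$ with $f_i$ a Schwartz function and $x_i\in X$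 by $R_j\bigl(\sum_i f_ix_i\bigr)=\sum_i (R_jf_i)x_i$. Let $\|\vec{\mathcal S}\|_{L^p_X\to L^p_X(\ell^2)}$ and $\|\vec R\|_{L^p_X\to L^p_X(\ell^2)}$ be the (possibly infinite) norms of these densely defined operators from $L^p(I_0;X)$ to $L^p(I_0;\ell^2_d(X))$ and from $L^p(\mathbb R^d;X)$ to $L^p(\mathbb R^d;\ell^2_d(X))$, where $\ell^2_d(X)=X^d$ carries the norm $\bigl(\sum_{j=1}^d\|x_j\|_X^2\bigr)^{1/2}$. There is an absolute constant $c_0$ such that for all $d\ge 1$, all $1<p<\infty$ and all UMD Banach spaces $X$, $$\|\vec{\mathcal S}\|_{L^p_X\to L^p_X(\ell^2)}\le c_0\,\|\vec R\|_{L^p_X\to L^p_X(\ell^2)}.$$ -/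

import Mathlib

open MeasureTheory ProbabilityTheory
open scoped ENNReal NNReal FourierTransform SchwartzMap

namespace DyadicRiesz

noncomputable section

/-! ### UMD spaces -/

/-- The difference sequence of `f`: `d₀ = f₀` and `dₙ₊₁ = fₙ₊₁ - fₙ`. -/
def martingaleDiff {Ω X : Type*} [AddCommGroup X] (f : ℕ → Ω → X) : ℕ → Ω → X
  | 0 => f 0
  | n + 1 => f (n + 1) - f n

/-- `X` is a UMD space: for every `1 < q < ∞` there is a constant `C`, depending only on `q`
and `X`, such that for all `X`-valued `L^q` martingales on all filtered probability spaces and all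
deterministic signs `ε`, one has `‖∑ εₖ dₖ‖_q ≤ C ‖∑ dₖ‖_q` (note `∑_{k ≤ N} dₖ = f_N`). -/
def IsUMD (X : Type*) [NormedAddCommGroup X] [NormedSpace ℝ X] [CompleteSpace X] : Prop :=
  ∀ q : ℝ≥0∞, 1 < q → q < ⊤ → ∃ C : ℝ≥0,
    ∀ (Ω : Type) (m : MeasurableSpace Ω) (μ : Measure Ω), IsProbabilityMeasure μ →
    ∀ (ℱ : Filtration ℕ m) (f : ℕ → Ω → X), Martingale f ℱ μ → (∀ n, MemLp (f n) q μ) →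
    ∀ ε : ℕ → ℝ, (∀ n, ε n = 1 ∨ ε n = -1) → ∀ N : ℕ,
      eLpNorm (fun ω => ∑ k ∈ Finset.range (N + 1), ε k • martingaleDiff f k ω) q μ
        ≤ C * eLpNorm (f N) q μ

/-! ### The dyadic Riesz vector on `I₀ = [0, 1)` -/

/-- The dyadic interval `[k / 2ⁿ, (k + 1) / 2ⁿ)`. It lies in `[0, 1)` when `k < 2ⁿ`. Its children
`I₋` and `I₊`, the left and right halves, have the indices `(n + 1, 2k)` and `(n + 1, 2k + 1)`. -/
def dyadicInterval (n k : ℕ) : Set ℝ := Set.Ico ((k : ℝ) / 2 ^ n) (((k : ℝ) + 1) / 2 ^ n)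

/-- The `L²`-normalized Haar function `h_I = |I|^{-1/2} (χ_{I₊} - χ_{I₋})` of
`I = dyadicInterval n k`; here `|I|^{-1/2} = √(2ⁿ)`. -/
def haar (n k : ℕ) (t : ℝ) : ℝ :=
  √(2 ^ n) * ((dyadicInterval (n + 1) (2 * k + 1)).indicator 1 t
    - (dyadicInterval (n + 1) (2 * k)).indicator 1 t)

/-- The image of `haar n k`, `n ≥ 1`, under `h_{I₊} ↦ h_{I₋}`, `h_{I₋} ↦ -h_{I₊}`:
for even `k` the interval is the left child of its parent, with the sibling `k + 1`;
for odd `k` it is the right child, with the sibling `k - 1`. -/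
def shiftedHaar (n k : ℕ) : ℝ → ℝ :=
  if Even k then -haar n (k + 1) else haar n (k - 1)

section

variable {X : Type*} [NormedAddCommGroup X] [NormedSpace ℝ X]

/-- The `X`-valued finite Haar sum `a χ_{I₀} + ∑_{n < N} ∑_{k < 2ⁿ} c(n, k) h_{n, k}`. -/
def haarSum (N : ℕ) (a : X) (c : ℕ → ℕ → X) (t : ℝ) : X :=
  (Set.Ico (0 : ℝ) 1).indicator (fun _ => a) t
    + ∑ n ∈ Finset.range N, ∑ k ∈ Finset.range (2 ^ n), haar n k t • c n k

/-- The `j`-th dyadic Riesz transform (`j = 0, …, d - 1`) of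
`a χ_{I₀} + ∑_{n < N} ∑_{k < 2ⁿ} c(n, k) h_{n, k}`. It annihilates `χ_{I₀}`, `h_{I₀}` and all Haar
functions of intervals of length `2⁻ⁿ` with `n ≢ j mod d`, and acts by
`h_{I₊} ↦ h_{I₋}`, `h_{I₋} ↦ -h_{I₊}` on the other ones. -/
def dyadicRiesz {d : ℕ} (j : Fin d) (N : ℕ) (c : ℕ → ℕ → X) (t : ℝ) : X :=
  ∑ n ∈ (Finset.range N).filter (fun n => n ≠ 0 ∧ n % d = j),
    ∑ k ∈ Finset.range (2 ^ n), shiftedHaar n k t • c n k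

end

/-- The norm of the dyadic Riesz vector from `L^p([0,1); X)` to `L^p([0,1); ℓ²_d(X))`, as a number
in `[0, ∞]`: the least bound on the dense subspace of finite Haar sums, on which the vector is
defined. -/
def dyadicRieszNorm (d : ℕ) (p : ℝ≥0∞) (X : Type*) [NormedAddCommGroup X] [NormedSpace ℝ X] :
    ℝ≥0∞ :=
  ⨅ (C : ℝ≥0) (_ : ∀ (N : ℕ) (a : X) (c : ℕ → ℕ → X),
    eLpNorm (fun t => (WithLp.toLp 2 (fun j : Fin d => dyadicRiesz j N c t) :
        PiLp 2 (fun _ : Fin d => X))) p (volume.restrict (Set.Ico (0 : ℝ) 1))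
      ≤ C * eLpNorm (haarSum N a c) p (volume.restrict (Set.Ico (0 : ℝ) 1))), (C : ℝ≥0∞)

/-! ### The Riesz vector on `ℝᵈ` -/

/-- The `j`-th Riesz transform of a real Schwartz function, with Fourier multiplier
`-i ξⱼ / |ξ|`. The inverse Fourier transform is real-valued because the multiplier is odd and purely
imaginary, so that taking the real part only changes the type. -/
def riesz {d : ℕ} (j : Fin d) (f : 𝓢(EuclideanSpace ℝ (Fin d), ℝ))
    (y : EuclideanSpace ℝ (Fin d)) : ℝ :=
  (𝓕⁻ (fun ξ : EuclideanSpace ℝ (Fin d) =>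
    (-Complex.I * ((ξ j / ‖ξ‖ : ℝ) : ℂ)) *
      𝓕 (fun z : EuclideanSpace ℝ (Fin d) => (f z : ℂ)) ξ) y).re

/-- The norm of the Riesz vector from `L^p(ℝᵈ; X)` to `L^p(ℝᵈ; ℓ²_d(X))`, as a number in `[0, ∞]`:
the least bound on the dense subspace of finite sums `∑ fᵢ xᵢ` with `fᵢ` a real Schwartz function
and `xᵢ ∈ X`, where `Rⱼ (∑ fᵢ xᵢ) = ∑ (Rⱼ fᵢ) xᵢ`. -/
def rieszNorm (d : ℕ) (p : ℝ≥0∞) (X : Type*) [NormedAddCommGroup X] [NormedSpace ℝ X] : ℝ≥0∞ :=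
  ⨅ (C : ℝ≥0) (_ : ∀ (M : ℕ) (f : Fin M → 𝓢(EuclideanSpace ℝ (Fin d), ℝ)) (x : Fin M → X),
    eLpNorm (fun y => (WithLp.toLp 2 (fun j : Fin d => ∑ i, riesz j (f i) y • x i) :
        PiLp 2 (fun _ : Fin d => X))) p volume
      ≤ C * eLpNorm (fun y => ∑ i, f i y • x i) p volume), (C : ℝ≥0∞)

end

end DyadicRiesz

/-! The proof is a transference argument. The Riesz symbol is homogeneous of degree zero, so at a
lacunary frequency ∑ k_m L^(m+1) e_{dir m} only the top component counts: as L → ∞ the j-th symbol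
tends to the sign of the last nonzero k_m if dir m = j, and to 0 otherwise (`tendsto_symbol_freq`).
On functions of the asymptotically independent angles L^(m+1) x_{dir m}, the operator R_j thus
becomes a martingale-like operator: it applies the conjugate function in the m-th angle to the part
of the function whose last active angle is the m-th, for all m with dir m = j. Since `dir` is
arbitrary, finitely many coordinates carry any number of levels, and the residues mod d can be
prescribed.

To reach dyadic operators, each angle is reduced to the quadrant of the circle that contains it,
that is, to a base 4 digit. Compressed to functions of the quadrant, the conjugate function is a
positive multiple κ of the rotation sgn cos ↦ sgn sin ↦ -sgn cos; it kills constants and the product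
sgn cos · sgn sin. Let sgn sin be the sign of the second binary digit and sgn cos the product of the
signs of both. For an interval I of even level these two signs are multiples of h_{I₊} + h_{I₋} and
h_{I₊} - h_{I₋}, and the rotation is precisely h_{I₊} ↦ h_{I₋} ↦ -h_{I₊} (`rieszLevel_odd`).

The quadrant indicators are replaced by nonnegative trigonometric polynomials `quadrant n i` which
sum to one, so that only finitely many frequencies occur. Their being a partition of unity gives
both norm estimates: Jensen's inequality bounds the test function and Hölder's inequality recovers
the finite model from its image, with cancelling normalisations (`sum_limitKernel_le`). Letting
first L → ∞ and then n → ∞ gives the exact base 4 model (`sum_modelKernel_le`).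

A lower bound κ ≥ 17/64, uniform in n, follows from the first Fourier coefficient (`le_conjConst`).
This handles the odd levels with constant 64/17; the two halves of [0, 1) reduce the even levels to
odd ones; the triangle inequality gives 128/17. -/

namespace DyadicRiesz

open Filter Topology
open scoped RealInnerProductSpace

/-! ### The Riesz symbol along lacunary frequencies -/

section Symbol

variable {d K : ℕ}

/-- The homogeneous symbol `v_j / |v|`. -/
noncomputable def symbol (j : Fin d) (v : EuclideanSpace ℝ (Fin d)) : ℝ := v j / ‖v‖

lemma abs_symbol_le_one (j : Fin d) (v : EuclideanSpace ℝ (Fin d)) : |symbol j v| ≤ 1 := by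
  rw [symbol, abs_div, abs_norm]
  exact div_le_one_of_le₀ (by simpa using PiLp.norm_apply_le v j) (norm_nonneg _)

lemma measurable_symbol (j : Fin d) : Measurable (symbol j) := by
  unfold symbol
  fun_prop

lemma symbol_smul (j : Fin d) {c : ℝ} (hc : 0 < c) (v : EuclideanSpace ℝ (Fin d)) :
    symbol j (c • v) = symbol j v := by
  rw [symbol, symbol, norm_smul, Real.norm_of_nonneg hc.le, PiLp.smul_apply, smul_eq_mul,
    mul_div_mul_left _ _ hc.ne']

lemma symbol_neg (j : Fin d) (v : EuclideanSpace ℝ (Fin d)) :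
    symbol j (-v) = -symbol j v := by
  simp [symbol, neg_div]

lemma symbol_smul_single (j i : Fin d) {c : ℝ} (hc : c ≠ 0) :
    symbol j (c • EuclideanSpace.single i (1 : ℝ)) =
      if i = j then ((SignType.sign c : SignType) : ℝ) else 0 := by
  rw [symbol, norm_smul]
  by_cases h : i = j
  · subst h
    simp only [PiLp.smul_apply, PiLp.single_apply, PiLp.norm_single]
    rcases lt_or_gt_of_ne hc with h | h
    · simp [sign_neg h, abs_of_neg h, div_neg, div_self hc]
    · simp [sign_pos h, abs_of_pos h, div_self hc]
  · simp [h, Ne.symm h]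

lemma continuousAt_symbol (j : Fin d) {v : EuclideanSpace ℝ (Fin d)} (hv : v ≠ 0) :
    ContinuousAt (symbol j) v := by
  unfold symbol
  exact ContinuousAt.div (by fun_prop) (by fun_prop) (norm_ne_zero_iff.2 hv)

/-- The frequency `∑ k_m L^(m+1) e_{dir m}`. -/
noncomputable def freq (dir : Fin K → Fin d) (L : ℝ) (k : Fin K → ℤ) :
    EuclideanSpace ℝ (Fin d) :=
  ∑ m, ((k m : ℝ) * L ^ ((m : ℕ) + 1)) • EuclideanSpace.single (dir m) (1 : ℝ)

lemma inner_freq (dir : Fin K → Fin d) (L : ℝ) (k : Fin K → ℤ) (x : EuclideanSpace ℝ (Fin d)) :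
    ⟪freq dir L k, x⟫ = ∑ m, (k m : ℝ) * (L ^ ((m : ℕ) + 1) * x (dir m)) := by
  simp only [freq, sum_inner, real_inner_smul_left, EuclideanSpace.inner_single_left, mul_assoc]
  simp

lemma freq_zero (dir : Fin K → Fin d) (L : ℝ) : freq dir L 0 = 0 := by simp [freq]

lemma freq_add (dir : Fin K → Fin d) (L : ℝ) (k k' : Fin K → ℤ) :
    freq dir L (k + k') = freq dir L k + freq dir L k' := by
  simp [freq, add_mul, add_smul, Finset.sum_add_distrib]

/-- The limit of the symbol along the frequencies `freq dir L k` as `L → ∞`. -/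
noncomputable def limitSymbol (dir : Fin K → Fin d) (j : Fin d) (k : Fin K → ℤ) : ℝ :=
  ∑ m, if dir m = j ∧ ∀ l, m < l → k l = 0 then ((SignType.sign (k m) : SignType) : ℝ) else 0

lemma limitSymbol_zero (dir : Fin K → Fin d) (j : Fin d) : limitSymbol dir j 0 = 0 := by
  simp [limitSymbol]

lemma exists_top {k : Fin K → ℤ} (hk : k ≠ 0) : ∃ m, k m ≠ 0 ∧ ∀ l, m < l → k l = 0 := by
  obtain ⟨i, hi⟩ := Function.ne_iff.1 hk
  let s := Finset.univ.filter fun m => k m ≠ 0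
  have hs : s.Nonempty := ⟨i, by simpa [s] using hi⟩
  refine ⟨s.max' hs, by simpa [s] using s.max'_mem hs, fun l hl => ?_⟩
  by_contra h
  exact absurd (s.le_max' l (by simpa [s] using h)) (not_le.2 hl)

/-- Indices below `m` fail the vanishing condition, and those above contribute the sign of 0. The
sum form of `limitSymbol` is kept because each of its summands is a product over coordinates, which
`sum_limitSymbol` exploits. -/
lemma limitSymbol_eq (dir : Fin K → Fin d) (j : Fin d) {k : Fin K → ℤ} {m : Fin K}
    (hm : k m ≠ 0) (hl : ∀ l, m < l → k l = 0) :
    limitSymbol dir j k = if dir m = j then ((SignType.sign (k m) : SignType) : ℝ) else 0 := by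
  rw [limitSymbol, Finset.sum_eq_single m]
  · simp only [and_iff_left_of_imp (fun _ => hl)]
  · intro b _ hb
    rcases lt_or_gt_of_ne hb with h | h
    · rw [if_neg]
      exact fun hh => hm (hh.2 m h)
    · simp [hl b h]
  · simp

/-- Division by the top power of L makes the lower components and the fixed shift `η` vanish; by
homogeneity this does not change the symbol. -/
lemma tendsto_scaled_freq (dir : Fin K → Fin d) {k : Fin K → ℤ} {m : Fin K}
    (hl : ∀ l, m < l → k l = 0) (η : EuclideanSpace ℝ (Fin d)) :
    Tendsto (fun L : ℝ => (L ^ ((m : ℕ) + 1))⁻¹ • (η + freq dir L k)) atTop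
      (𝓝 ((k m : ℝ) • EuclideanSpace.single (dir m) (1 : ℝ))) := by
  have hinv : ∀ n : ℕ, Tendsto (fun L : ℝ => (L ^ (n + 1))⁻¹) atTop (𝓝 0) := fun n =>
    (tendsto_pow_atTop n.succ_ne_zero).inv_tendsto_atTop
  have hterm : ∀ l : Fin K, Tendsto (fun L : ℝ => (L ^ ((m : ℕ) + 1))⁻¹ •
      (((k l : ℝ) * L ^ ((l : ℕ) + 1)) • EuclideanSpace.single (dir l) (1 : ℝ))) atTop
      (𝓝 (if l = m then (k m : ℝ) • EuclideanSpace.single (dir m) (1 : ℝ) else 0)) := by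
    intro l
    rcases lt_trichotomy l m with h | h | h
    · rw [if_neg h.ne]
      obtain ⟨n, hn⟩ := Nat.exists_eq_add_of_lt (Fin.lt_def.1 h)
      have h1 : Tendsto (fun L : ℝ => ((k l : ℝ) * (L ^ (n + 1))⁻¹) •
          EuclideanSpace.single (dir l) (1 : ℝ)) atTop
          (𝓝 (((k l : ℝ) * 0) • EuclideanSpace.single (dir l) (1 : ℝ))) :=
        ((hinv n).const_mul _).smul_const _
      rw [mul_zero, zero_smul] at h1
      refine h1.congr' ?_
      filter_upwards [eventually_gt_atTop 0] with L hL
      rw [smul_smul, hn]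
      congr 1
      field_simp
      ring
    · subst h
      rw [if_pos rfl]
      refine tendsto_const_nhds.congr' ?_
      filter_upwards [eventually_gt_atTop 0] with L hL
      rw [smul_smul]
      congr 1
      field_simp
    · rw [if_neg h.ne', hl l h]
      simp
  have h0 : Tendsto (fun L : ℝ => (L ^ ((m : ℕ) + 1))⁻¹ • η) atTop (𝓝 0) := by
    simpa using (hinv m).smul_const η
  have := h0.add (tendsto_finsetSum Finset.univ fun l _ => hterm l)
  simpa [smul_add, freq, Finset.smul_sum] using this

lemma smul_single_ne_zero {c : ℝ} (hc : c ≠ 0) (i : Fin d) :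
    c • EuclideanSpace.single i (1 : ℝ) ≠ 0 := by
  simp [hc]

lemma tendsto_symbol_freq (dir : Fin K → Fin d) (j : Fin d) {k : Fin K → ℤ} (hk : k ≠ 0)
    (η : EuclideanSpace ℝ (Fin d)) :
    Tendsto (fun L : ℝ => symbol j (η + freq dir L k)) atTop (𝓝 (limitSymbol dir j k)) := by
  obtain ⟨m, hm, hl⟩ := exists_top hk
  have hm' : (k m : ℝ) ≠ 0 := by exact_mod_cast hm
  have h1 := (continuousAt_symbol j (smul_single_ne_zero hm' (dir m))).tendsto.comp
    (tendsto_scaled_freq dir hl η)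
  rw [symbol_smul_single j _ hm'] at h1
  rw [limitSymbol_eq dir j hm hl]
  have h2 : SignType.sign (k m : ℝ) = SignType.sign (k m) := by
    rcases lt_or_gt_of_ne hm with h | h
    · rw [sign_neg h, sign_neg (by exact_mod_cast h)]
    · rw [sign_pos h, sign_pos (by exact_mod_cast h)]
  rw [h2] at h1
  refine h1.congr' ?_
  filter_upwards [eventually_gt_atTop 0] with L hL
  exact symbol_smul j (by positivity) _

lemma tendsto_freq_cocompact (dir : Fin K → Fin d) {k : Fin K → ℤ} (hk : k ≠ 0) :
    Tendsto (fun L : ℝ => freq dir L k) atTop (cocompact (EuclideanSpace ℝ (Fin d))) := by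
  obtain ⟨m, hm, hl⟩ := exists_top hk
  have hm' : (k m : ℝ) ≠ 0 := by exact_mod_cast hm
  rw [← Metric.cobounded_eq_cocompact, ← tendsto_norm_atTop_iff_cobounded]
  have h1 := (tendsto_scaled_freq dir hl 0).norm
  have h2 := (tendsto_pow_atTop (α := ℝ) (m : ℕ).succ_ne_zero).atTop_mul_pos
    (norm_pos_iff.2 (smul_single_ne_zero hm' (dir m))) h1
  refine h2.congr' ?_
  filter_upwards [eventually_gt_atTop 0] with L hL
  rw [norm_smul, norm_inv, norm_pow, Real.norm_of_nonneg hL.le, zero_add]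
  have := pow_pos hL ((m : ℕ) + 1)
  field_simp

end Symbol

end DyadicRiesz

namespace DyadicRiesz

open Filter Topology
open scoped RealInnerProductSpace

/-! ### Riesz transforms of modulated amplitudes -/

section Modulation

variable {d K : ℕ}

local notation "𝔼" => EuclideanSpace ℝ (Fin d)

lemma continuous_fourierChar_inner (ξ : 𝔼) : Continuous fun x : 𝔼 => (𝐞 ⟪ξ, x⟫ : ℂ) := by
  have := Real.continuous_fourierChar
  fun_prop

lemma continuous_fourierChar_inner' (ξ : 𝔼) : Continuous fun x : 𝔼 => (𝐞 ⟪x, ξ⟫ : ℂ) := by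
  have := Real.continuous_fourierChar
  fun_prop

/-- The demodulated Riesz transform of a Schwartz function multiplied with a character. -/
noncomputable def modRiesz (Φ : 𝓢(𝔼, ℂ)) (j : Fin d) (ξ y : 𝔼) : ℂ :=
  ∫ η, (𝐞 ⟪η, y⟫ : ℂ) * ((-Complex.I * (symbol j (η + ξ) : ℂ)) * 𝓕 (Φ : 𝔼 → ℂ) η)

lemma integrable_fourier (Φ : 𝓢(𝔼, ℂ)) : Integrable (𝓕 (Φ : 𝔼 → ℂ)) := by
  rw [← SchwartzMap.fourier_coe]
  exact (𝓕 Φ).integrable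

lemma integrable_symbol_mul_fourier (Φ : 𝓢(𝔼, ℂ)) (j : Fin d) (ξ : 𝔼) :
    Integrable fun η => (-Complex.I * (symbol j (η + ξ) : ℂ)) * 𝓕 (Φ : 𝔼 → ℂ) η := by
  refine (integrable_fourier Φ).bdd_mul (c := 1) ?_ ?_
  · have : Measurable fun η : 𝔼 => symbol j (η + ξ) :=
      (measurable_symbol j).comp (measurable_id.add_const ξ)
    exact (measurable_const.mul (Complex.measurable_ofReal.comp this)).aestronglyMeasurable
  · filter_upwards with η
    simpa using abs_symbol_le_one j (η + ξ)

lemma continuous_modRiesz (Φ : 𝓢(𝔼, ℂ)) (j : Fin d) (ξ : 𝔼) : Continuous (modRiesz Φ j ξ) := by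
  refine continuous_of_dominated (bound := fun η => ‖(-Complex.I * (symbol j (η + ξ) : ℂ)) *
    𝓕 (Φ : 𝔼 → ℂ) η‖) ?_ ?_ (integrable_symbol_mul_fourier Φ j ξ).norm ?_
  · intro y
    refine AEStronglyMeasurable.mul ?_ (integrable_symbol_mul_fourier Φ j ξ).1
    exact (continuous_fourierChar_inner' y).aestronglyMeasurable
  · intro y
    filter_upwards with η
    rw [norm_mul, Circle.norm_coe, one_mul]
  · filter_upwards with η
    refine Continuous.mul ?_ continuous_const
    exact continuous_fourierChar_inner η

lemma norm_modRiesz_le (Φ : 𝓢(𝔼, ℂ)) (j : Fin d) (ξ y : 𝔼) :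
    ‖modRiesz Φ j ξ y‖ ≤ ∫ η, ‖𝓕 (Φ : 𝔼 → ℂ) η‖ := by
  refine norm_integral_le_of_norm_le (integrable_fourier Φ).norm ?_
  filter_upwards with η
  rw [norm_mul, norm_mul, norm_mul, Circle.norm_coe, norm_neg, Complex.norm_I, one_mul, one_mul,
    Complex.norm_real]
  exact mul_le_of_le_one_left (norm_nonneg _) (abs_symbol_le_one j _)

/-- An odd multiplier sends an even amplitude to an odd function. At frequency zero nothing
converges to a multiple of `Φ`, and this parity makes the pairing with even weights vanish instead.
-/
lemma modRiesz_zero_neg (Φ : 𝓢(𝔼, ℂ)) (hΦ : ∀ x, Φ (-x) = Φ x) (j : Fin d) (y : 𝔼) :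
    modRiesz Φ j 0 (-y) = -modRiesz Φ j 0 y := by
  have hF : ∀ η, 𝓕 (Φ : 𝔼 → ℂ) (-η) = 𝓕 (Φ : 𝔼 → ℂ) η := by
    intro η
    rw [Real.fourier_eq, Real.fourier_eq, ← integral_neg_eq_self]
    simp [hΦ]
  rw [modRiesz, modRiesz, ← integral_neg_eq_self, ← integral_neg]
  refine integral_congr_ae ?_
  filter_upwards with η
  simp only [hF, add_zero, inner_neg_neg, symbol_neg]
  push_cast
  ring

lemma fourier_modulation (Φ : 𝓢(𝔼, ℂ)) (ξ η : 𝔼) :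
    𝓕 (fun z : 𝔼 => (𝐞 ⟪ξ, z⟫ : ℂ) * Φ z) η = 𝓕 (Φ : 𝔼 → ℂ) (η - ξ) := by
  rw [Real.fourier_eq, Real.fourier_eq]
  refine integral_congr_ae ?_
  filter_upwards with z
  rw [Circle.smul_def, Circle.smul_def, smul_eq_mul, smul_eq_mul, ← mul_assoc, ← Circle.coe_mul,
    ← AddChar.map_add_eq_mul, inner_sub_right, real_inner_comm z ξ]
  congr 4
  ring

lemma integrable_modulation (Φ : 𝓢(𝔼, ℂ)) (ξ : 𝔼) :
    Integrable (fun z : 𝔼 => (𝐞 ⟪ξ, z⟫ : ℂ) * Φ z) := by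
  refine Φ.integrable.bdd_mul (c := 1) ?_ ?_
  · exact (continuous_fourierChar_inner ξ).aestronglyMeasurable
  · filter_upwards with η
    rw [Circle.norm_coe]

lemma fourierInv_symbol_mul (Φ : 𝓢(𝔼, ℂ)) (j : Fin d) (ξ y : 𝔼) :
    ∫ η, (𝐞 ⟪η, y⟫ : ℂ) * ((-Complex.I * (symbol j η : ℂ)) * 𝓕 (Φ : 𝔼 → ℂ) (η - ξ)) =
      (𝐞 ⟪ξ, y⟫ : ℂ) * modRiesz Φ j ξ y := by
  rw [modRiesz, ← integral_const_mul,
    ← integral_add_right_eq_self (fun η => (𝐞 ⟪η, y⟫ : ℂ) * _) ξ]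
  refine integral_congr_ae ?_
  filter_upwards with η
  rw [add_sub_cancel_right, inner_add_left, AddChar.map_add_eq_mul, Circle.coe_mul]
  ring

lemma integrable_fourierInv_symbol_mul (Φ : 𝓢(𝔼, ℂ)) (j : Fin d) (ξ y : 𝔼) :
    Integrable fun η => (𝐞 ⟪η, y⟫ : ℂ) *
      ((-Complex.I * (symbol j η : ℂ)) * 𝓕 (Φ : 𝔼 → ℂ) (η - ξ)) := by
  refine Integrable.bdd_mul (c := 1) ?_ ?_ ?_
  · have := (integrable_symbol_mul_fourier Φ j ξ).comp_sub_right ξ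
    simpa using this
  · exact (continuous_fourierChar_inner' y).aestronglyMeasurable
  · filter_upwards with η
    rw [Circle.norm_coe]

/-- The Riesz transform of a trigonometric polynomial with a Schwartz amplitude. -/
lemma riesz_eq_re_sum {κ : Type*} (T : Finset κ) (Φ : 𝓢(𝔼, ℂ)) (ξ : κ → 𝔼) (c : κ → ℂ)
    (g : 𝓢(𝔼, ℝ)) (hg : ∀ z, (g z : ℂ) = ∑ k ∈ T, c k * ((𝐞 ⟪ξ k, z⟫ : ℂ) * Φ z))
    (j : Fin d) (y : 𝔼) :
    riesz j g y = (∑ k ∈ T, c k * ((𝐞 ⟪ξ k, y⟫ : ℂ) * modRiesz Φ j (ξ k) y)).re := by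
  have hF : ∀ η, 𝓕 (fun z : 𝔼 => (g z : ℂ)) η = ∑ k ∈ T, c k * 𝓕 (Φ : 𝔼 → ℂ) (η - ξ k) := by
    intro η
    simp_rw [hg, ← fourier_modulation, Real.fourier_eq, Finset.smul_sum]
    rw [integral_finsetSum]
    · refine Finset.sum_congr rfl fun k _ => ?_
      rw [← integral_const_mul]
      refine integral_congr_ae ?_
      filter_upwards with z
      simp only [Circle.smul_def, smul_eq_mul]
      ring
    · intro k _
      exact (Real.fourierIntegral_convergent_iff _).2 ((integrable_modulation Φ (ξ k)).const_mul _)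
  rw [riesz]
  congr 1
  rw [Real.fourierInv_eq]
  simp_rw [← fourierInv_symbol_mul, ← integral_const_mul]
  rw [← integral_finsetSum]
  · refine integral_congr_ae ?_
    filter_upwards with η
    rw [hF, Circle.smul_def, smul_eq_mul, Finset.mul_sum, Finset.mul_sum]
    refine Finset.sum_congr rfl fun k _ => ?_
    rw [symbol]
    ring
  · intro k _
    exact (integrable_fourierInv_symbol_mul Φ j (ξ k) y).const_mul _

/-- Fourier inversion writes `Φ y` as an integral against the same characters, so that only the
difference of the symbols remains. The bound does not depend on `y`, hence the approximation is
uniform. -/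
lemma norm_modRiesz_sub_le (Φ : 𝓢(𝔼, ℂ)) (j : Fin d) (ξ y : 𝔼) (σ : ℝ) :
    ‖modRiesz Φ j ξ y - -Complex.I * σ * Φ y‖ ≤
      ∫ η, |symbol j (η + ξ) - σ| * ‖𝓕 (Φ : 𝔼 → ℂ) η‖ := by
  have hinv : Φ y = ∫ η, (𝐞 ⟪η, y⟫ : ℂ) * 𝓕 (Φ : 𝔼 → ℂ) η := by
    have h := Continuous.fourierInv_fourier_eq Φ.continuous Φ.integrable (integrable_fourier Φ)
    conv_lhs => rw [← h]
    rw [Real.fourierInv_eq]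
    rfl
  have hi1 : Integrable fun η : 𝔼 => (𝐞 ⟪η, y⟫ : ℂ) *
      ((-Complex.I * (symbol j (η + ξ) : ℂ)) * 𝓕 (Φ : 𝔼 → ℂ) η) := by
    have := (integrable_fourierInv_symbol_mul Φ j ξ y).comp_add_right ξ
    refine Integrable.bdd_mul (c := 1) (integrable_symbol_mul_fourier Φ j ξ) ?_ ?_
    · exact (continuous_fourierChar_inner' y).aestronglyMeasurable
    · filter_upwards with η
      rw [Circle.norm_coe]
  have hi2 : Integrable fun η : 𝔼 => (𝐞 ⟪η, y⟫ : ℂ) * 𝓕 (Φ : 𝔼 → ℂ) η := by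
    refine Integrable.bdd_mul (c := 1) (integrable_fourier Φ) ?_ ?_
    · exact (continuous_fourierChar_inner' y).aestronglyMeasurable
    · filter_upwards with η
      rw [Circle.norm_coe]
  rw [hinv, modRiesz, ← integral_const_mul, ← integral_sub hi1 (hi2.const_mul _)]
  have hb : ∀ η, |symbol j (η + ξ) - σ| ≤ 1 + |σ| := fun η =>
    (abs_sub _ _).trans (by gcongr; exact abs_symbol_le_one j _)
  refine norm_integral_le_of_norm_le ?_ ?_
  · refine (integrable_fourier Φ).norm.bdd_mul (c := 1 + |σ|) ?_ ?_
    · have : Measurable fun η : 𝔼 => symbol j (η + ξ) :=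
        (measurable_symbol j).comp (measurable_id.add_const ξ)
      exact (this.sub_const σ).norm.aestronglyMeasurable
    · filter_upwards with η
      simpa using hb η
  · filter_upwards with η
    have : (𝐞 ⟪η, y⟫ : ℂ) * ((-Complex.I * (symbol j (η + ξ) : ℂ)) * 𝓕 (Φ : 𝔼 → ℂ) η) -
        -Complex.I * σ * ((𝐞 ⟪η, y⟫ : ℂ) * 𝓕 (Φ : 𝔼 → ℂ) η) =
        (𝐞 ⟪η, y⟫ : ℂ) * (-Complex.I * ((symbol j (η + ξ) - σ : ℝ) : ℂ) *
          𝓕 (Φ : 𝔼 → ℂ) η) := by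
      push_cast
      ring
    rw [this, norm_mul, norm_mul, norm_mul, Circle.norm_coe, norm_neg, Complex.norm_I, one_mul,
      one_mul, Complex.norm_real, Real.norm_eq_abs]

lemma tendsto_integral_symbol_sub (dir : Fin K → Fin d) (Φ : 𝓢(𝔼, ℂ)) (j : Fin d)
    {k : Fin K → ℤ} (hk : k ≠ 0) :
    Tendsto (fun L : ℝ => ∫ η, |symbol j (η + freq dir L k) - limitSymbol dir j k| *
      ‖𝓕 (Φ : 𝔼 → ℂ) η‖) atTop (𝓝 0) := by
  set σ := limitSymbol dir j k
  have h0 : (0 : ℝ) = ∫ η : 𝔼, (0 : ℝ) := by simp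
  rw [h0]
  refine tendsto_integral_filter_of_dominated_convergence
    (fun η => (1 + |σ|) * ‖𝓕 (Φ : 𝔼 → ℂ) η‖) ?_ ?_ ((integrable_fourier Φ).norm.const_mul _) ?_
  · filter_upwards with L
    have : Measurable fun η : 𝔼 => symbol j (η + freq dir L k) :=
      (measurable_symbol j).comp (measurable_id.add_const _)
    exact (this.sub_const σ).norm.aestronglyMeasurable.mul (integrable_fourier Φ).norm.1
  · filter_upwards with L
    filter_upwards with η
    rw [norm_mul, Real.norm_eq_abs, abs_abs, norm_norm]
    gcongr
    exact (abs_sub _ _).trans (by gcongr; exact abs_symbol_le_one j _)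
  · filter_upwards with η
    have h1 := ((tendsto_symbol_freq dir j hk η).sub_const σ).abs.mul_const ‖𝓕 (Φ : 𝔼 → ℂ) η‖
    rwa [sub_self, abs_zero, zero_mul] at h1

/-- The Riemann–Lebesgue lemma: the frequency escapes to infinity unless `k = 0`. -/
lemma tendsto_integral_modulation (dir : Fin K → Fin d) (f : 𝔼 → ℂ) (k : Fin K → ℤ) :
    Tendsto (fun L : ℝ => ∫ y, (𝐞 ⟪freq dir L k, y⟫ : ℂ) * f y) atTop
      (𝓝 (if k = 0 then ∫ y, f y else 0)) := by
  split_ifs with hk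
  · subst hk
    simp [freq_zero]
  · have h1 := (tendsto_integral_exp_inner_smul_cocompact f).comp
      (tendsto_freq_cocompact dir (neg_ne_zero.2 hk))
    refine h1.congr fun L => ?_
    refine integral_congr_ae ?_
    filter_upwards with y
    have : freq dir L (-k) = -freq dir L k := by simp [freq]
    rw [this, inner_neg_right, neg_neg, real_inner_comm, Circle.smul_def, smul_eq_mul]

/-- Testing the Riesz transform of a modulated amplitude against a modulated weight, in the limit of
well separated frequencies. -/
lemma tendsto_pairing (dir : Fin K → Fin d) (Φ : 𝓢(𝔼, ℂ)) (hΦ : ∀ x, Φ (-x) = Φ x)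
    (ρ : 𝔼 → ℂ) (hρ : Integrable ρ) (hρe : ∀ x, ρ (-x) = ρ x) (j : Fin d) (k k' : Fin K → ℤ) :
    Tendsto (fun L : ℝ => ∫ y, ((𝐞 ⟪freq dir L k, y⟫ : ℂ) * modRiesz Φ j (freq dir L k) y) *
      ((𝐞 ⟪freq dir L k', y⟫ : ℂ) * ρ y)) atTop
      (𝓝 (if k + k' = 0 then -Complex.I * limitSymbol dir j k * ∫ y, Φ y * ρ y else 0)) := by
  have hcomb : ∀ L : ℝ, ∀ y (b : ℂ), ((𝐞 ⟪freq dir L k, y⟫ : ℂ) * b) *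
      ((𝐞 ⟪freq dir L k', y⟫ : ℂ) * ρ y) = (𝐞 ⟪freq dir L (k + k'), y⟫ : ℂ) * (b * ρ y) := by
    intro L y b
    rw [freq_add, inner_add_left, AddChar.map_add_eq_mul, Circle.coe_mul]
    ring
  simp_rw [hcomb]
  by_cases hk : k = 0
  · subst hk
    simp only [zero_add, freq_zero, limitSymbol_zero, Complex.ofReal_zero, mul_zero, zero_mul,
      ite_self]
    have h1 := tendsto_integral_modulation dir (fun y => modRiesz Φ j 0 y * ρ y) k'
    have h2 : ∫ y, modRiesz Φ j 0 y * ρ y = 0 := by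
      have h3 : ∫ y, modRiesz Φ j 0 y * ρ y = -∫ y, modRiesz Φ j 0 y * ρ y := by
        conv_lhs => rw [← integral_neg_eq_self]
        rw [← integral_neg]
        refine integral_congr_ae ?_
        filter_upwards with y
        rw [modRiesz_zero_neg Φ hΦ, hρe, neg_mul]
      exact self_eq_neg.1 h3
    simpa [h2] using h1
  -- Away from `k = 0` the demodulated transform may be replaced by its uniform limit `-I σ Φ`; the
  -- remaining oscillation at frequency `k + k'` is then governed by Riemann–Lebesgue.
  · set σ := limitSymbol dir j k
    have hmain := tendsto_integral_modulation dir (fun y => -Complex.I * σ * Φ y * ρ y) (k + k')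
    have hlim : (if k + k' = 0 then -Complex.I * σ * ∫ y, Φ y * ρ y else 0) =
        if k + k' = 0 then ∫ y, -Complex.I * σ * Φ y * ρ y else 0 := by
      simp_rw [mul_assoc _ (Φ _) (ρ _), integral_const_mul]
    rw [hlim]
    have hchar : ∀ L : ℝ, AEStronglyMeasurable (fun y : 𝔼 => (𝐞 ⟪freq dir L (k + k'), y⟫ : ℂ))
        volume := fun L =>
      (continuous_fourierChar_inner _).aestronglyMeasurable
    obtain ⟨B, hB⟩ : ∃ B : ℝ, ∀ y, ‖Φ y‖ ≤ B := by
      obtain ⟨B, _, hB⟩ := Φ.decay 0 0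
      exact ⟨B, fun y => by simpa using hB y⟩
    refine tendsto_of_tendsto_of_dist hmain ?_
    have hε := (tendsto_integral_symbol_sub dir Φ j hk).mul_const (∫ y, ‖ρ y‖)
    rw [zero_mul] at hε
    refine squeeze_zero (fun _ => dist_nonneg) (fun L => ?_) hε
    have hi1 : Integrable fun y => (𝐞 ⟪freq dir L (k + k'), y⟫ : ℂ) *
        (modRiesz Φ j (freq dir L k) y * ρ y) := by
      refine Integrable.bdd_mul (c := 1) ?_ (hchar L) (.of_forall fun y => by rw [Circle.norm_coe])
      exact hρ.bdd_mul (continuous_modRiesz Φ j _).aestronglyMeasurable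
        (.of_forall fun y => norm_modRiesz_le Φ j _ y)
    have hi2 : Integrable fun y => (𝐞 ⟪freq dir L (k + k'), y⟫ : ℂ) *
        (-Complex.I * σ * Φ y * ρ y) := by
      refine Integrable.bdd_mul (c := 1) ?_ (hchar L) (.of_forall fun y => by rw [Circle.norm_coe])
      refine hρ.bdd_mul (c := |σ| * B) (continuous_const.mul Φ.continuous).aestronglyMeasurable
        (.of_forall fun y => ?_)
      simpa using mul_le_mul_of_nonneg_left (hB y) (abs_nonneg σ)
    rw [dist_comm, dist_eq_norm, ← integral_sub hi1 hi2, ← integral_const_mul]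
    refine norm_integral_le_of_norm_le (hρ.norm.const_mul _) (.of_forall fun y => ?_)
    rw [← mul_sub, ← sub_mul, norm_mul, norm_mul, Circle.norm_coe, one_mul]
    gcongr
    exact norm_modRiesz_sub_le Φ j _ y σ

end Modulation

end DyadicRiesz

/-! ### Trigonometric kernels and the algebra of their products -/

namespace DyadicRiesz

open Filter Topology
open scoped RealInnerProductSpace

lemma fourierChar_sum {κ : Type*} (s : Finset κ) (f : κ → ℝ) :
    (𝐞 (∑ i ∈ s, f i) : ℂ) = ∏ i ∈ s, (𝐞 (f i) : ℂ) := by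
  classical
  induction s using Finset.induction_on with
  | empty => simp
  | insert a s ha ih =>
    rw [Finset.sum_insert ha, Finset.prod_insert ha, AddChar.map_add_eq_mul, Circle.coe_mul, ih]

/-- A Markov kernel from the circle to a finite set, given by nonnegative trigonometric polynomials,
together with its correlations and the correlations of its conjugate functions. -/
structure TrigKernel (ι : Type) [Fintype ι] where
  coeff : ι → ℤ → ℂ
  supp : Finset ℤ
  neg_mem : ∀ k ∈ supp, -k ∈ supp
  zero_mem : 0 ∈ supp
  val : ι → ℝ → ℝ
  val_eq : ∀ i θ, (val i θ : ℂ) = ∑ k ∈ supp, coeff i k * (𝐞 (k * θ) : ℂ)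
  nonneg : ∀ i θ, 0 ≤ val i θ
  sum_eq_one : ∀ θ, ∑ i, val i θ = 1
  mass : ℝ
  coeff_zero : ∀ i, coeff i 0 = mass
  corr : ι → ι → ℝ
  corr_eq : ∀ i i', ∑ k ∈ supp, coeff i' k * coeff i (-k) = (corr i i' : ℂ)
  conjCorr : ι → ι → ℝ
  conjCorr_eq : ∀ i i', ∑ k ∈ supp,
    -Complex.I * ((SignType.sign k : SignType) : ℝ) * (coeff i' k * coeff i (-k)) =
      (conjCorr i i' : ℂ)

namespace TrigKernel

variable {ι : Type} [Fintype ι] (q : TrigKernel ι) {d K : ℕ}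

local notation "𝔼" => EuclideanSpace ℝ (Fin d)

lemma val_eq_re (i : ι) (θ : ℝ) :
    q.val i θ = (∑ k ∈ q.supp, q.coeff i k * (𝐞 (k * θ) : ℂ)).re := by
  rw [← q.val_eq, Complex.ofReal_re]

lemma contDiff_val (i : ι) : ContDiff ℝ ⊤ (q.val i) := by
  have h : q.val i = fun θ => Complex.reCLM (∑ k ∈ q.supp, q.coeff i k * (𝐞 (k * θ) : ℂ)) := by
    ext θ
    exact q.val_eq_re i θ
  rw [h]
  refine Complex.reCLM.contDiff.comp (ContDiff.sum fun k _ => contDiff_const.mul ?_)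
  simp_rw [Real.fourierChar_apply]
  refine Complex.contDiff_exp.comp (ContDiff.mul ?_ contDiff_const)
  exact Complex.ofRealCLM.contDiff.comp
    (contDiff_const.mul (contDiff_const.mul contDiff_id) : ContDiff ℝ ⊤ fun x : ℝ =>
      2 * Real.pi * (k * x))

/-- The product kernel at the angles `L^(m+1) x_{dir m}`. -/
noncomputable def weight (dir : Fin K → Fin d) (L : ℝ) (s : Fin K → ι) (x : 𝔼) : ℝ :=
  ∏ m, q.val (s m) (L ^ ((m : ℕ) + 1) * x (dir m))

lemma weight_nonneg (dir : Fin K → Fin d) (L : ℝ) (s : Fin K → ι) (x : 𝔼) :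
    0 ≤ q.weight dir L s x := Finset.prod_nonneg fun _ _ => q.nonneg _ _

lemma sum_weight [DecidableEq ι] (dir : Fin K → Fin d) (L : ℝ) (x : 𝔼) :
    ∑ s, q.weight dir L s x = 1 := by
  have h := Finset.prod_univ_sum (fun _ : Fin K => (Finset.univ : Finset ι))
    (fun m i => q.val i (L ^ ((m : ℕ) + 1) * x (dir m)))
  rw [Fintype.piFinset_univ] at h
  rw [show ∑ s, q.weight dir L s x = _ from h.symm]
  simp [q.sum_eq_one]

lemma contDiff_weight (dir : Fin K → Fin d) (L : ℝ) (s : Fin K → ι) :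
    ContDiff ℝ ⊤ (q.weight dir L s : 𝔼 → ℝ) := by
  unfold weight
  refine contDiff_prod fun m _ => (q.contDiff_val (s m)).comp ?_
  exact contDiff_const.mul (by fun_prop)

/-- The frequencies of the product kernel. -/
def freqs (K : ℕ) : Finset (Fin K → ℤ) := Fintype.piFinset fun _ => q.supp

/-- The coefficients of the product kernel. -/
noncomputable def weightCoeff (s : Fin K → ι) (k : Fin K → ℤ) : ℂ := ∏ m, q.coeff (s m) (k m)

lemma weight_eq (dir : Fin K → Fin d) (L : ℝ) (s : Fin K → ι) (x : 𝔼) :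
    (q.weight dir L s x : ℂ) =
      ∑ k ∈ q.freqs K, q.weightCoeff s k * (𝐞 ⟪freq dir L k, x⟫ : ℂ) := by
  rw [weight, Complex.ofReal_prod]
  simp_rw [q.val_eq]
  rw [Finset.prod_univ_sum]
  refine Finset.sum_congr rfl fun k _ => ?_
  rw [Finset.prod_mul_distrib, weightCoeff, inner_freq, fourierChar_sum]

lemma neg_mem_freqs {k : Fin K → ℤ} (hk : k ∈ q.freqs K) : -k ∈ q.freqs K := by
  rw [freqs, Fintype.mem_piFinset] at hk ⊢
  exact fun m => q.neg_mem _ (hk m)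

lemma zero_mem_freqs : (0 : Fin K → ℤ) ∈ q.freqs K := by
  rw [freqs, Fintype.mem_piFinset]
  exact fun m => q.zero_mem

lemma weightCoeff_zero (s : Fin K → ι) : q.weightCoeff s 0 = (q.mass : ℂ) ^ K := by
  simp [weightCoeff, q.coeff_zero]

/-- The factors of the limit of the Riesz transform in the finite model. -/
noncomputable def entry (m l : Fin K) (i i' : ι) : ℝ :=
  if l < m then q.corr i i' else if l = m then q.conjCorr i i' else q.mass ^ 2

/-- The limit of the `j`-th Riesz transform in the finite model. -/
noncomputable def limitKernel (dir : Fin K → Fin d) (j : Fin d) (s s' : Fin K → ι) : ℝ :=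
  ∑ m, if dir m = j then ∏ l, q.entry m l (s l) (s' l) else 0

/-- The frequencies form a product set, and the `m`-th summand of `limitSymbol` is a product over
coordinates: no condition below `m`, the sign at `m`, and vanishing of `k l` above. The sum
therefore factorizes into one-variable sums, which are respectively a correlation, a conjugate
correlation and the squared mass. -/
lemma sum_limitSymbol (dir : Fin K → Fin d) (j : Fin d) (s s' : Fin K → ι) :
    ∑ k ∈ q.freqs K, -Complex.I * limitSymbol dir j k * (q.weightCoeff s' k *
      q.weightCoeff s (-k)) = q.limitKernel dir j s s' := by
  classical
  have hm : ∀ m : Fin K, ∑ k ∈ q.freqs K, (∏ l : Fin K,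
      (if l < m then 1 else if l = m then
        -Complex.I * ((SignType.sign (k l) : SignType) : ℝ) else if k l = 0 then 1 else 0) *
        (q.coeff (s' l) (k l) * q.coeff (s l) (-k l))) =
      ((∏ l, q.entry m l (s l) (s' l) : ℝ) : ℂ) := by
    intro m
    rw [freqs, ← Finset.prod_univ_sum (fun _ : Fin K => q.supp) (fun l (k : ℤ) =>
      (if l < m then 1 else if l = m then
        -Complex.I * ((SignType.sign k : SignType) : ℝ) else if k = 0 then 1 else 0) *
        (q.coeff (s' l) k * q.coeff (s l) (-k))), Complex.ofReal_prod]
    refine Finset.prod_congr rfl fun l _ => ?_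
    unfold entry
    split_ifs with h1 h2
    · simp_rw [one_mul]
      exact q.corr_eq _ _
    · exact q.conjCorr_eq _ _
    · simp_rw [ite_mul, one_mul, zero_mul]
      rw [Finset.sum_ite_eq' q.supp 0, if_pos q.zero_mem, neg_zero, q.coeff_zero, q.coeff_zero]
      push_cast
      ring
  rw [limitKernel, Complex.ofReal_sum]
  have : ∀ m : Fin K, ((if dir m = j then ∏ l, q.entry m l (s l) (s' l) else 0 : ℝ) : ℂ) =
      ∑ k ∈ q.freqs K, if dir m = j then (∏ l : Fin K,
      (if l < m then 1 else if l = m then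
        -Complex.I * ((SignType.sign (k l) : SignType) : ℝ) else if k l = 0 then 1 else 0) *
        (q.coeff (s' l) (k l) * q.coeff (s l) (-k l))) else 0 := by
    intro m
    split_ifs with h
    · exact (hm m).symm
    · simp
  simp_rw [this]
  rw [Finset.sum_comm]
  refine Finset.sum_congr rfl fun k _ => ?_
  rw [limitSymbol, Complex.ofReal_sum, Finset.mul_sum, Finset.sum_mul]
  refine Finset.sum_congr rfl fun m _ => ?_
  by_cases hd : dir m = j
  swap
  · simp [hd]
  simp only [hd, true_and, if_true]
  rw [Finset.prod_mul_distrib, weightCoeff, weightCoeff, ← Finset.prod_mul_distrib]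
  congr 1
  rw [← Finset.mul_prod_erase Finset.univ _ (Finset.mem_univ m)]
  simp only [lt_irrefl, if_true, if_false]
  by_cases hz : ∀ l, m < l → k l = 0
  · rw [if_pos hz, Finset.prod_eq_one, mul_one]
    intro l hl
    rcases lt_or_gt_of_ne (Finset.ne_of_mem_erase hl) with h | h
    · simp [h]
    · simp [h.not_gt, h.ne', hz l h]
  · rw [if_neg hz]
    push Not at hz
    obtain ⟨l, hl, hl0⟩ := hz
    rw [Finset.prod_eq_zero (i := l)]
    · simp
    · simp [hl.ne']
    · simp [hl.not_gt, hl.ne', hl0]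

end TrigKernel

end DyadicRiesz

/-! ### The amplitude, the test functions and their limits -/

namespace DyadicRiesz

open Filter Topology
open scoped RealInnerProductSpace

section Bump

variable (d : ℕ)

local notation "𝔼" => EuclideanSpace ℝ (Fin d)

/-- A smooth even amplitude with compact support. -/
noncomputable def bump : ContDiffBump (0 : 𝔼) := ⟨1, 2, one_pos, one_lt_two⟩

/-- The amplitude as a complex Schwartz function. -/
noncomputable def bumpSchwartz : 𝓢(𝔼, ℂ) :=
  HasCompactSupport.toSchwartzMap (f := fun x => ((bump d x : ℝ) : ℂ))
    ((bump d).hasCompactSupport.comp_left (g := ((↑) : ℝ → ℂ)) Complex.ofReal_zero)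
    (Complex.ofRealCLM.contDiff.comp (bump d).contDiff)

lemma bumpSchwartz_apply (x : 𝔼) : bumpSchwartz d x = (bump d x : ℂ) := rfl

lemma continuous_bump_rpow {r : ℝ} (hr : 0 ≤ r) : Continuous fun x : 𝔼 => bump d x ^ r :=
  (bump d).continuous.rpow_const fun _ => Or.inr hr

lemma hasCompactSupport_bump_rpow {r : ℝ} (hr : 0 < r) :
    HasCompactSupport fun x : 𝔼 => bump d x ^ r :=
  (bump d).hasCompactSupport.comp_left (g := fun t : ℝ => t ^ r) (Real.zero_rpow hr.ne')

lemma integrable_bump_rpow {r : ℝ} (hr : 0 < r) : Integrable fun x : 𝔼 => bump d x ^ r :=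
  (continuous_bump_rpow d hr.le).integrable_of_hasCompactSupport (hasCompactSupport_bump_rpow d hr)

lemma integral_bump_rpow_pos {r : ℝ} (hr : 0 < r) : 0 < ∫ x : 𝔼, bump d x ^ r := by
  refine (continuous_bump_rpow d hr.le).integral_pos_of_hasCompactSupport_nonneg_nonzero
    (hasCompactSupport_bump_rpow d hr) (fun x => Real.rpow_nonneg (bump d).nonneg _) (x := 0) ?_
  have : bump d 0 = 1 := (bump d).one_of_mem_closedBall (by simp [(bump d).rIn_pos.le])
  simp [this]

/-- The amplitude is `bump` and the dual amplitude is `bump ^ (r - 1)`. Their pairing and both norm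
estimates then involve the single constant ∫ bump^r, which cancels. -/
lemma bump_mul_rpow {r : ℝ} (hr : 1 < r) (x : 𝔼) :
    bump d x * bump d x ^ (r - 1) = bump d x ^ r := by
  rcases (bump d).nonneg (x := x) |>.eq_or_lt with h | h
  · rw [← h, zero_mul, Real.zero_rpow (by linarith)]
  · rw [Real.rpow_sub_one h.ne', mul_div_cancel₀ _ h.ne']

end Bump

namespace TrigKernel

variable {ι : Type} [Fintype ι] (q : TrigKernel ι) {d K : ℕ} (dir : Fin K → Fin d)

local notation "𝔼" => EuclideanSpace ℝ (Fin d)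

/-- The amplitude times the product kernel. -/
noncomputable def testFunction (L : ℝ) (s : Fin K → ι) : 𝓢(𝔼, ℝ) :=
  HasCompactSupport.toSchwartzMap (f := fun x => bump d x * q.weight dir L s x)
    (bump d).hasCompactSupport.mul_right
    ((bump d).contDiff.mul ((q.contDiff_weight dir L s).of_le le_top))

lemma testFunction_apply (L : ℝ) (s : Fin K → ι) (x : 𝔼) :
    q.testFunction dir L s x = bump d x * q.weight dir L s x := rfl

lemma continuous_weight (L : ℝ) (s : Fin K → ι) : Continuous (q.weight dir L s) :=
  (q.contDiff_weight dir L s).continuous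

lemma riesz_testFunction (L : ℝ) (s : Fin K → ι) (j : Fin d) (y : 𝔼) :
    riesz j (q.testFunction dir L s) y = (∑ k ∈ q.freqs K, q.weightCoeff s k *
      ((𝐞 ⟪freq dir L k, y⟫ : ℂ) * modRiesz (bumpSchwartz d) j (freq dir L k) y)).re := by
  refine riesz_eq_re_sum _ _ _ _ _ (fun z => ?_) j y
  rw [testFunction_apply, Complex.ofReal_mul, q.weight_eq, Finset.mul_sum]
  refine Finset.sum_congr rfl fun k _ => ?_
  rw [bumpSchwartz_apply]
  ring

lemma continuous_riesz_testFunction (L : ℝ) (s : Fin K → ι) (j : Fin d) :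
    Continuous (riesz j (q.testFunction dir L s)) := by
  have h : riesz j (q.testFunction dir L s) = fun y => _ :=
    funext (q.riesz_testFunction dir L s j)
  rw [h]
  refine Complex.continuous_re.comp (continuous_finsetSum _ fun k _ => continuous_const.mul ?_)
  exact (continuous_fourierChar_inner _).mul (continuous_modRiesz _ _ _)

lemma integrable_bump_rpow_mul {r : ℝ} (hr : 0 < r) {f : 𝔼 → ℝ} (hf : Continuous f) :
    Integrable fun y => bump d y ^ r * f y :=
  ((continuous_bump_rpow d hr.le).mul hf).integrable_of_hasCompactSupport
    (hasCompactSupport_bump_rpow d hr).mul_right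

/-- The matrix of the Riesz transform, tested against the dual amplitude. -/
noncomputable def testMatrix (r L : ℝ) (j : Fin d) (s s' : Fin K → ι) : ℝ :=
  ∫ y, bump d y ^ (r - 1) * q.weight dir L s y * riesz j (q.testFunction dir L s') y

/-- Only the zero frequency survives, and its coefficient is the product of the masses. -/
lemma tendsto_integral_weight {r : ℝ} (hr : 0 < r) (s : Fin K → ι) :
    Tendsto (fun L : ℝ => ∫ y, bump d y ^ r * q.weight dir L s y) atTop
      (𝓝 ((∫ y : 𝔼, bump d y ^ r) * q.mass ^ K)) := by
  have hint : ∀ L k, Integrable fun y : 𝔼 => q.weightCoeff s k *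
      ((𝐞 ⟪freq dir L k, y⟫ : ℂ) * ((bump d y ^ r : ℝ) : ℂ)) := fun L k =>
    ((integrable_bump_rpow d hr).ofReal.bdd_mul (c := 1)
      (continuous_fourierChar_inner _).aestronglyMeasurable
      (.of_forall fun y => by rw [Circle.norm_coe])).const_mul _
  have heq : ∀ L : ℝ, ((∫ y, bump d y ^ r * q.weight dir L s y : ℝ) : ℂ) =
      ∑ k ∈ q.freqs K, q.weightCoeff s k *
        ∫ y, (𝐞 ⟪freq dir L k, y⟫ : ℂ) * ((bump d y ^ r : ℝ) : ℂ) := by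
    intro L
    simp_rw [← integral_const_mul]
    rw [← integral_finsetSum _ fun k _ => hint L k, ← integral_complex_ofReal]
    refine integral_congr_ae (.of_forall fun y => ?_)
    simp only [Complex.ofReal_mul, q.weight_eq, Finset.mul_sum]
    exact Finset.sum_congr rfl fun k _ => by ring
  have hlim := tendsto_finsetSum (q.freqs K) fun k _ =>
    (tendsto_integral_modulation dir (fun y => ((bump d y ^ r : ℝ) : ℂ)) k).const_mul
      (q.weightCoeff s k)
  simp_rw [← heq] at hlim
  simp only [mul_ite, mul_zero] at hlim
  rw [Finset.sum_ite_eq', if_pos q.zero_mem_freqs, q.weightCoeff_zero, integral_complex_ofReal,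
    mul_comm] at hlim
  have := (Complex.continuous_re.tendsto _).comp hlim
  convert! this using 2
  norm_cast

/-- After both product kernels are expanded into characters, only the pairs `k' = -k` survive in the
limit, and their contributions add up by `sum_limitSymbol`. -/
lemma tendsto_testMatrix {r : ℝ} (hr : 1 < r) (j : Fin d) (s s' : Fin K → ι) :
    Tendsto (fun L : ℝ => q.testMatrix dir r L j s s') atTop
      (𝓝 ((∫ y : 𝔼, bump d y ^ r) * q.limitKernel dir j s s')) := by
  set A := ∫ y : 𝔼, bump d y ^ r
  let Φ := bumpSchwartz d
  let ρ : 𝔼 → ℂ := fun y => ((bump d y ^ (r - 1) : ℝ) : ℂ)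
  have hρ : Integrable ρ := (integrable_bump_rpow d (sub_pos.2 hr)).ofReal
  have hΦρ : ∫ y, Φ y * ρ y = A := by
    rw [← integral_complex_ofReal]
    refine integral_congr_ae (.of_forall fun y => ?_)
    simp only [Φ, ρ, bumpSchwartz_apply, ← bump_mul_rpow d hr, Complex.ofReal_mul]
  have hpair := fun k k' : Fin K → ℤ => tendsto_pairing dir Φ
    (fun x => by simp only [Φ, bumpSchwartz_apply, (bump d).neg]) ρ hρ (fun x => by simp only [ρ, (bump d).neg]) j k k'
  rw [hΦρ] at hpair
  have hint : ∀ L k k', Integrable fun y : 𝔼 =>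
      ((𝐞 ⟪freq dir L k, y⟫ : ℂ) * modRiesz Φ j (freq dir L k) y) *
      ((𝐞 ⟪freq dir L k', y⟫ : ℂ) * ρ y) := by
    intro L k k'
    have h1 : Integrable fun y => (𝐞 ⟪freq dir L k', y⟫ : ℂ) * ρ y :=
      hρ.bdd_mul (c := 1) (continuous_fourierChar_inner _).aestronglyMeasurable
        (.of_forall fun y => by rw [Circle.norm_coe])
    refine h1.bdd_mul (c := ∫ η, ‖𝓕 (Φ : 𝔼 → ℂ) η‖)
      ((continuous_fourierChar_inner _).mul (continuous_modRiesz _ _ _)).aestronglyMeasurable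
      (.of_forall fun y => ?_)
    rw [norm_mul, Circle.norm_coe, one_mul]
    exact norm_modRiesz_le _ _ _ _
  have heq : ∀ L : ℝ, q.testMatrix dir r L j s s' = (∑ k ∈ q.freqs K, ∑ k' ∈ q.freqs K,
      q.weightCoeff s' k * q.weightCoeff s k' *
      ∫ y, ((𝐞 ⟪freq dir L k, y⟫ : ℂ) * modRiesz Φ j (freq dir L k) y) *
      ((𝐞 ⟪freq dir L k', y⟫ : ℂ) * ρ y)).re := by
    intro L
    simp_rw [← integral_const_mul]
    simp_rw [← integral_finsetSum _ fun k' _ => (hint L _ k').const_mul _]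
    rw [← integral_finsetSum _ fun k _ => integrable_finsetSum _ fun k' _ =>
      (hint L k k').const_mul _]
    rw [← RCLike.re_eq_complex_re, ← integral_re (integrable_finsetSum _ fun k _ =>
      integrable_finsetSum _ fun k' _ => (hint L k k').const_mul _), testMatrix]
    refine integral_congr_ae (.of_forall fun y => ?_)
    simp only [riesz_testFunction, RCLike.re_eq_complex_re]
    rw [← Complex.re_ofReal_mul]
    congr 1
    rw [Complex.ofReal_mul, q.weight_eq, Finset.mul_sum, Finset.mul_sum]
    refine Finset.sum_congr rfl fun k _ => ?_
    rw [Finset.sum_mul]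
    refine Finset.sum_congr rfl fun k' _ => ?_
    simp only [ρ, Φ]
    ring
  have hlim := tendsto_finsetSum (q.freqs K) fun k _ => tendsto_finsetSum (q.freqs K) fun k' _ =>
    (hpair k k').const_mul (q.weightCoeff s' k * q.weightCoeff s k')
  have hval : (∑ k ∈ q.freqs K, ∑ k' ∈ q.freqs K, q.weightCoeff s' k * q.weightCoeff s k' *
      if k + k' = 0 then -Complex.I * limitSymbol dir j k * A else 0) =
      ((A * q.limitKernel dir j s s' : ℝ) : ℂ) := by
    rw [Complex.ofReal_mul, ← q.sum_limitSymbol, Finset.mul_sum]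
    refine Finset.sum_congr rfl fun k hk => ?_
    simp_rw [add_comm k, ← eq_neg_iff_add_eq_zero, mul_ite, mul_zero]
    rw [Finset.sum_ite_eq', if_pos (q.neg_mem_freqs hk)]
    ring
  rw [hval] at hlim
  have := (Complex.continuous_re.tendsto _).comp hlim
  rw [Complex.ofReal_re] at this
  exact this.congr fun L => (heq L).symm

end TrigKernel

end DyadicRiesz

/-! ### Norm estimates: from the Riesz vector to the finite model -/

namespace DyadicRiesz

open Filter Topology
open scoped RealInnerProductSpace

namespace TrigKernel

variable {ι : Type} [Fintype ι] (q : TrigKernel ι) {d K : ℕ} (dir : Fin K → Fin d)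
  {X : Type*} [NormedAddCommGroup X] [NormedSpace ℝ X]

local notation "𝔼" => EuclideanSpace ℝ (Fin d)

/-- Jensen's inequality for `t ↦ t ^ r`: at each point the weights form a probability vector. -/
lemma enorm_sum_weight_smul_rpow_le [DecidableEq ι] {r : ℝ} (hr : 1 < r) (L : ℝ)
    (f : (Fin K → ι) → X) (y : 𝔼) :
    ‖∑ s, q.testFunction dir L s y • f s‖ₑ ^ r ≤
      ∑ s, ‖f s‖ₑ ^ r * ENNReal.ofReal (bump d y ^ r * q.weight dir L s y) := by
  have hr0 : 0 ≤ r := by linarith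
  have hb := (bump d).nonneg (x := y)
  have h1 : ‖∑ s, q.testFunction dir L s y • f s‖ ≤
      bump d y * ∑ s, q.weight dir L s y * ‖f s‖ := by
    refine (norm_sum_le _ _).trans_eq ?_
    rw [Finset.mul_sum]
    refine Finset.sum_congr rfl fun s _ => ?_
    rw [norm_smul, testFunction_apply, Real.norm_of_nonneg
      (mul_nonneg hb (q.weight_nonneg dir L s y)), mul_assoc]
  have h2 : ‖∑ s, q.testFunction dir L s y • f s‖ ^ r ≤
      ∑ s, ‖f s‖ ^ r * (bump d y ^ r * q.weight dir L s y) := by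
    calc ‖∑ s, q.testFunction dir L s y • f s‖ ^ r
        ≤ (bump d y * ∑ s, q.weight dir L s y * ‖f s‖) ^ r := by gcongr
      _ = bump d y ^ r * (∑ s, q.weight dir L s y * ‖f s‖) ^ r := by
        rw [Real.mul_rpow hb]
        exact Finset.sum_nonneg fun s _ => mul_nonneg (q.weight_nonneg dir L s y) (norm_nonneg _)
      _ ≤ bump d y ^ r * ∑ s, q.weight dir L s y * ‖f s‖ ^ r := by
        gcongr
        exact Real.rpow_arith_mean_le_arith_mean_rpow _ _ _
          (fun s _ => q.weight_nonneg dir L s y) (q.sum_weight dir L y)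
          (fun s _ => norm_nonneg _) hr.le
      _ = _ := by
        rw [Finset.mul_sum]
        exact Finset.sum_congr rfl fun s _ => by ring
  have hn : ∀ s, 0 ≤ bump d y ^ r * q.weight dir L s y := fun s =>
    mul_nonneg (Real.rpow_nonneg hb _) (q.weight_nonneg dir L s y)
  have h3 := ENNReal.ofReal_le_ofReal h2
  rw [ENNReal.ofReal_sum_of_nonneg
    (fun s _ => mul_nonneg (Real.rpow_nonneg (norm_nonneg _) _) (hn s)),
    ← ENNReal.ofReal_rpow_of_nonneg (norm_nonneg _) hr0, ofReal_norm] at h3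
  refine h3.trans_eq (Finset.sum_congr rfl fun s _ => ?_)
  rw [ENNReal.ofReal_mul (Real.rpow_nonneg (norm_nonneg _) _),
    ← ENNReal.ofReal_rpow_of_nonneg (norm_nonneg _) hr0, ofReal_norm]

lemma lintegral_testFunction_le [DecidableEq ι] {r : ℝ} (hr : 1 < r) (L : ℝ)
    (f : (Fin K → ι) → X) {β : ℝ}
    (hβ : ∀ s, ∫ y, bump d y ^ r * q.weight dir L s y ≤ β) :
    ∫⁻ y, ‖∑ s, q.testFunction dir L s y • f s‖ₑ ^ r ≤ ENNReal.ofReal β * ∑ s, ‖f s‖ₑ ^ r := by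
  have hr0 : 0 < r := by linarith
  refine (lintegral_mono (q.enorm_sum_weight_smul_rpow_le dir hr L f)).trans ?_
  have hm : ∀ s, Measurable fun y : 𝔼 => ENNReal.ofReal (bump d y ^ r * q.weight dir L s y) :=
    fun s => ENNReal.measurable_ofReal.comp
      ((continuous_bump_rpow d hr0.le).mul (q.continuous_weight dir L s)).measurable
  rw [lintegral_finsetSum _ fun s _ => (hm s).const_mul _, Finset.mul_sum]
  refine Finset.sum_le_sum fun s _ => ?_
  rw [lintegral_const_mul _ (hm s), mul_comm]
  gcongr
  rw [← ofReal_integral_eq_lintegral_ofReal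
    (integrable_bump_rpow_mul hr0 (q.continuous_weight dir L s))
    (.of_forall fun y => mul_nonneg (Real.rpow_nonneg (bump d).nonneg _)
      (q.weight_nonneg dir L s y))]
  exact ENNReal.ofReal_le_ofReal (hβ s)

/-- The Riesz vector of the `X`-valued test function. -/
noncomputable def testImage (L : ℝ) (f : (Fin K → ι) → X) (y : 𝔼) : PiLp 2 (fun _ : Fin d => X) :=
  WithLp.toLp 2 fun j => ∑ s, riesz j (q.testFunction dir L s) y • f s

lemma continuous_testImage (L : ℝ) (f : (Fin K → ι) → X) :
    Continuous (q.testImage dir L f) := by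
  refine (PiLp.continuous_toLp 2 _).comp (continuous_pi fun j => ?_)
  exact continuous_finsetSum _ fun s _ =>
    (q.continuous_riesz_testFunction dir L s j).smul continuous_const

lemma integral_testImage [CompleteSpace X] {r : ℝ} (hr : 1 < r) (L : ℝ) (f : (Fin K → ι) → X)
    (s : Fin K → ι) :
    ∫ y, (bump d y ^ (r - 1) * q.weight dir L s y) • q.testImage dir L f y =
      WithLp.toLp 2 fun j => ∑ s', q.testMatrix dir r L j s s' • f s' := by
  have hr' : 0 < r - 1 := sub_pos.2 hr
  have hint : Integrable fun y =>
      (bump d y ^ (r - 1) * q.weight dir L s y) • q.testImage dir L f y := by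
    refine Continuous.integrable_of_hasCompactSupport ?_ ?_
    · exact ((continuous_bump_rpow d hr'.le).mul (q.continuous_weight dir L s)).smul
        (q.continuous_testImage dir L f)
    · exact ((hasCompactSupport_bump_rpow d hr').mul_right).smul_right
  ext j
  have h := (PiLp.proj 2 (fun _ : Fin d => X) j : PiLp 2 (fun _ : Fin d => X) →L[ℝ] X).integral_comp_comm
    hint
  simp only [PiLp.proj_apply] at h
  rw [← h]
  simp only [PiLp.smul_apply, testImage, Finset.smul_sum, smul_smul]
  rw [integral_finsetSum]
  · refine Finset.sum_congr rfl fun s' _ => ?_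
    rw [integral_smul_const, testMatrix]
  · intro s' _
    refine Integrable.smul_const ?_ _
    refine Continuous.integrable_of_hasCompactSupport ?_ ?_
    · exact ((continuous_bump_rpow d hr'.le).mul (q.continuous_weight dir L s)).mul
        (q.continuous_riesz_testFunction dir L s' j)
    · exact ((hasCompactSupport_bump_rpow d hr').mul_right).mul_right

lemma enorm_integral_testImage_le [CompleteSpace X] {r : ℝ} (hr : 1 < r) (L : ℝ)
    (f : (Fin K → ι) → X) (s : Fin K → ι) {β : ℝ} (hβ : ∫ y, bump d y ^ r * q.weight dir L s y ≤ β) :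
    ‖∫ y, (bump d y ^ (r - 1) * q.weight dir L s y) • q.testImage dir L f y‖ₑ ^ r ≤
      ENNReal.ofReal β ^ (r - 1) *
        ∫⁻ y, ‖q.testImage dir L f y‖ₑ ^ r * ENNReal.ofReal (q.weight dir L s y) := by
  have hr0 : 0 < r := by linarith
  have hr' : 0 < r - 1 := sub_pos.2 hr
  have hpq : r.HolderConjugate (Real.conjExponent r) := Real.HolderConjugate.conjExponent hr
  set t := Real.conjExponent r
  have ht : 0 < t := hpq.symm.pos
  have hw := q.weight_nonneg dir L s
  have hwc := (q.continuous_weight dir L s)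
  -- The weight is split as w = w^(1/r) w^(1/t). The first factor stays with the image, so that
  -- summation over `s` loses nothing; the second joins the dual amplitude, whose `t`-th power is
  -- `bump ^ r`.
  have hsplit : ∀ y : 𝔼, ‖(bump d y ^ (r - 1) * q.weight dir L s y) • q.testImage dir L f y‖ₑ =
      (‖q.testImage dir L f y‖ₑ * ENNReal.ofReal (q.weight dir L s y ^ r⁻¹)) *
        ENNReal.ofReal (bump d y ^ (r - 1) * q.weight dir L s y ^ t⁻¹) := by
    intro y
    have hb : 0 ≤ bump d y ^ (r - 1) := Real.rpow_nonneg (bump d).nonneg _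
    rw [enorm_smul, Real.enorm_of_nonneg (mul_nonneg hb (hw y)), mul_assoc,
      ← ENNReal.ofReal_mul (Real.rpow_nonneg (hw y) _), mul_comm]
    congr 2
    rw [mul_left_comm, ← Real.rpow_add' (hw y), hpq.inv_add_inv_eq_one, Real.rpow_one]
    rw [hpq.inv_add_inv_eq_one]
    exact one_ne_zero
  calc ‖∫ y, (bump d y ^ (r - 1) * q.weight dir L s y) • q.testImage dir L f y‖ₑ ^ r
      ≤ (∫⁻ y, ‖(bump d y ^ (r - 1) * q.weight dir L s y) • q.testImage dir L f y‖ₑ) ^ r := by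
        gcongr
        exact enorm_integral_le_lintegral_enorm _
    _ ≤ ((∫⁻ y, (‖q.testImage dir L f y‖ₑ * ENNReal.ofReal (q.weight dir L s y ^ r⁻¹)) ^ r)
          ^ (1 / r) * (∫⁻ y, ENNReal.ofReal (bump d y ^ (r - 1) * q.weight dir L s y ^ t⁻¹) ^ t)
          ^ (1 / t)) ^ r := by
        gcongr
        simp_rw [hsplit]
        refine ENNReal.lintegral_mul_le_Lp_mul_Lq volume hpq ?_ ?_
        · refine AEMeasurable.mul (q.continuous_testImage dir L f).enorm.measurable.aemeasurable ?_
          exact (ENNReal.continuous_ofReal.comp (hwc.rpow_const fun _ =>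
            Or.inr (inv_pos.2 hr0).le)).measurable.aemeasurable
        · exact (ENNReal.continuous_ofReal.comp ((continuous_bump_rpow d hr'.le).mul
            (hwc.rpow_const fun _ => Or.inr (inv_pos.2 ht).le))).measurable.aemeasurable
    _ = (∫⁻ y, ENNReal.ofReal (bump d y ^ r * q.weight dir L s y)) ^ (r - 1) *
        ∫⁻ y, ‖q.testImage dir L f y‖ₑ ^ r * ENNReal.ofReal (q.weight dir L s y) := by
        rw [ENNReal.mul_rpow_of_nonneg _ _ hr0.le, ← ENNReal.rpow_mul, ← ENNReal.rpow_mul,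
          one_div_mul_cancel hr0.ne', ENNReal.rpow_one, mul_comm]
        congr 1
        · have he : 1 / t * r = r - 1 := by
            rw [one_div, mul_comm, ← div_eq_mul_inv, div_eq_iff ht.ne']
            exact hpq.sub_one_mul_conj.symm
          rw [he]
          congr 1
          refine lintegral_congr fun y => ?_
          have hb : 0 ≤ bump d y := (bump d).nonneg
          rw [ENNReal.ofReal_rpow_of_nonneg (mul_nonneg (Real.rpow_nonneg hb _)
            (Real.rpow_nonneg (hw y) _)) ht.le, Real.mul_rpow (Real.rpow_nonneg hb _)
            (Real.rpow_nonneg (hw y) _), ← Real.rpow_mul hb, ← Real.rpow_mul (hw y),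
            inv_mul_cancel₀ ht.ne', Real.rpow_one, hpq.sub_one_mul_conj]
        · refine lintegral_congr fun y => ?_
          rw [ENNReal.mul_rpow_of_nonneg _ _ hr0.le,
            ENNReal.ofReal_rpow_of_nonneg (Real.rpow_nonneg (hw y) _) hr0.le,
            ← Real.rpow_mul (hw y), inv_mul_cancel₀ hr0.ne', Real.rpow_one]
    _ ≤ _ := by
        gcongr
        rw [← ofReal_integral_eq_lintegral_ofReal (integrable_bump_rpow_mul hr0 hwc)
          (.of_forall fun y => mul_nonneg (Real.rpow_nonneg (bump d).nonneg _) (hw y))]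
        exact ENNReal.ofReal_le_ofReal hβ

/-- Hölder's inequality costs `β ^ (r - 1)` and Jensen's costs `β`; between them, the weights sum to
one and the bound `C` applies. -/
lemma sum_testMatrix_le [DecidableEq ι] [CompleteSpace X] {r : ℝ} (hr : 1 < r) (L : ℝ)
    (f : (Fin K → ι) → X) {β : ℝ} (hβ : ∀ s, ∫ y, bump d y ^ r * q.weight dir L s y ≤ β)
    {C : ℝ≥0∞} (hC : ∫⁻ y, ‖q.testImage dir L f y‖ₑ ^ r ≤
      C ^ r * ∫⁻ y, ‖∑ s, q.testFunction dir L s y • f s‖ₑ ^ r) :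
    ∑ s, ‖(WithLp.toLp 2 fun j => ∑ s', q.testMatrix dir r L j s s' • f s' :
      PiLp 2 (fun _ : Fin d => X))‖ₑ ^ r ≤ (C * ENNReal.ofReal β) ^ r * ∑ s, ‖f s‖ₑ ^ r := by
  have hr0 : 0 < r := by linarith
  simp_rw [← q.integral_testImage dir hr L f]
  have hm : Measurable fun y => ‖q.testImage dir L f y‖ₑ ^ r :=
    (q.continuous_testImage dir L f).enorm.measurable.pow_const r
  have hmw : ∀ s, Measurable fun y : 𝔼 => ENNReal.ofReal (q.weight dir L s y) := fun s =>
    ENNReal.measurable_ofReal.comp (q.continuous_weight dir L s).measurable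
  calc ∑ s, ‖∫ y, (bump d y ^ (r - 1) * q.weight dir L s y) • q.testImage dir L f y‖ₑ ^ r
      ≤ ∑ s, ENNReal.ofReal β ^ (r - 1) *
        ∫⁻ y, ‖q.testImage dir L f y‖ₑ ^ r * ENNReal.ofReal (q.weight dir L s y) :=
        Finset.sum_le_sum fun s _ => q.enorm_integral_testImage_le dir hr L f s (hβ s)
    _ = ENNReal.ofReal β ^ (r - 1) * ∫⁻ y, ‖q.testImage dir L f y‖ₑ ^ r := by
        rw [← Finset.mul_sum, ← lintegral_finsetSum (f := fun s y => ‖q.testImage dir L f y‖ₑ ^ r *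
          ENNReal.ofReal (q.weight dir L s y)) _ fun s _ => hm.mul (hmw s)]
        congr 1
        refine lintegral_congr fun y => ?_
        rw [← Finset.mul_sum, ← ENNReal.ofReal_sum_of_nonneg
          fun s _ => q.weight_nonneg dir L s y, q.sum_weight, ENNReal.ofReal_one, mul_one]
    _ ≤ ENNReal.ofReal β ^ (r - 1) *
        (C ^ r * (ENNReal.ofReal β * ∑ s, ‖f s‖ₑ ^ r)) := by
        gcongr
        refine hC.trans ?_
        gcongr
        exact q.lintegral_testFunction_le dir hr L f hβ
    _ = _ := by
        rw [ENNReal.mul_rpow_of_nonneg _ _ hr0.le]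
        have : ENNReal.ofReal β ^ r = ENNReal.ofReal β ^ (r - 1) * ENNReal.ofReal β := by
          conv_lhs => rw [show r = (r - 1) + 1 by ring]
          rw [ENNReal.rpow_add_of_nonneg _ _ (by linarith) zero_le_one, ENNReal.rpow_one]
        rw [this]
        ring

/-- The finite model of the Riesz vector is bounded by the Riesz vector. -/
theorem sum_limitKernel_le [DecidableEq ι] [CompleteSpace X] {r : ℝ} (hr : 1 < r)
    (f : (Fin K → ι) → X) {C : ℝ≥0} (hC : ∀ L : ℝ, ∫⁻ y, ‖q.testImage dir L f y‖ₑ ^ r ≤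
      C ^ r * ∫⁻ y, ‖∑ s, q.testFunction dir L s y • f s‖ₑ ^ r) :
    ∑ s, ‖(WithLp.toLp 2 fun j => ∑ s', q.limitKernel dir j s s' • f s' :
      PiLp 2 (fun _ : Fin d => X))‖ₑ ^ r ≤
      (C * ENNReal.ofReal (q.mass ^ K)) ^ r * ∑ s, ‖f s‖ₑ ^ r := by
  have hr0 : 0 < r := by linarith
  set A := ∫ y : 𝔼, bump d y ^ r
  have hA : 0 < A := integral_bump_rpow_pos d hr0
  let b : (Fin K → ι) → ℝ → ℝ := fun s L => ∫ y, bump d y ^ r * q.weight dir L s y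
  have hb : ∀ s, Tendsto (b s) atTop (𝓝 (A * q.mass ^ K)) := q.tendsto_integral_weight dir hr0
  -- A common upper bound for all the integrals `b s L` with the same limit as each of them.
  let β : ℝ → ℝ := fun L => A * q.mass ^ K + ∑ s, |b s L - A * q.mass ^ K|
  have hβ : Tendsto β atTop (𝓝 (A * q.mass ^ K)) := by
    have := (tendsto_finsetSum Finset.univ fun s _ =>
      ((hb s).sub_const (A * q.mass ^ K)).abs).const_add (A * q.mass ^ K)
    simpa [β] using this
  have hbβ : ∀ L s, b s L ≤ β L := by
    intro L s
    have h1 := Finset.single_le_sum (f := fun s => |b s L - A * q.mass ^ K|)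
      (fun s _ => abs_nonneg _) (Finset.mem_univ s)
    have h2 := le_abs_self (b s L - A * q.mass ^ K)
    simp only [β]
    linarith
  have hL := fun L => q.sum_testMatrix_le dir hr L f (hbβ L) (hC L)
  have hleft : Tendsto (fun L => ∑ s, ‖(WithLp.toLp 2 fun j =>
      ∑ s', q.testMatrix dir r L j s s' • f s' : PiLp 2 (fun _ : Fin d => X))‖ₑ ^ r) atTop
      (𝓝 (∑ s, ‖(WithLp.toLp 2 fun j => ∑ s', (A * q.limitKernel dir j s s') • f s' :
        PiLp 2 (fun _ : Fin d => X))‖ₑ ^ r)) := by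
    refine tendsto_finsetSum _ fun s _ => ?_
    refine (ENNReal.continuous_rpow_const.tendsto _).comp ((continuous_enorm.tendsto _).comp
      (((PiLp.continuous_toLp 2 _).tendsto _).comp (tendsto_pi_nhds.2 fun j => ?_)))
    exact tendsto_finsetSum _ fun s' _ => (q.tendsto_testMatrix dir hr j s s').smul_const _
  have hright : Tendsto (fun L => ((C : ℝ≥0∞) * ENNReal.ofReal (β L)) ^ r * ∑ s, ‖f s‖ₑ ^ r) atTop
      (𝓝 (((C : ℝ≥0∞) * ENNReal.ofReal (A * q.mass ^ K)) ^ r * ∑ s, ‖f s‖ₑ ^ r)) := by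
    refine ENNReal.Tendsto.mul_const ((ENNReal.continuous_rpow_const.tendsto _).comp
      (ENNReal.Tendsto.const_mul ((ENNReal.continuous_ofReal.tendsto _).comp hβ)
        (Or.inr ENNReal.coe_ne_top))) (Or.inr ?_)
    exact ENNReal.sum_ne_top.2 fun s _ => ENNReal.rpow_ne_top_of_nonneg hr0.le enorm_ne_top
  have hfin := le_of_tendsto_of_tendsto' hleft hright hL
  have hA' : ENNReal.ofReal A ^ r ≠ 0 := by
    simp [ENNReal.rpow_eq_zero_iff, hA, not_lt.2 hr0.le]
  have hA'' : ENNReal.ofReal A ^ r ≠ ⊤ := ENNReal.rpow_ne_top_of_nonneg hr0.le ENNReal.ofReal_ne_top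
  rw [← ENNReal.mul_le_mul_iff_right hA' hA'']
  convert! hfin using 1
  · rw [Finset.mul_sum]
    refine Finset.sum_congr rfl fun s _ => ?_
    have : (WithLp.toLp 2 fun j => ∑ s', (A * q.limitKernel dir j s s') • f s' :
        PiLp 2 (fun _ : Fin d => X)) =
        A • (WithLp.toLp 2 fun j => ∑ s', q.limitKernel dir j s s' • f s') := by
      ext j
      simp [Finset.smul_sum, mul_smul]
    rw [this, enorm_smul, Real.enorm_of_nonneg hA.le, ENNReal.mul_rpow_of_nonneg _ _ hr0.le]
  · rw [ENNReal.ofReal_mul hA.le, ← mul_assoc, ← ENNReal.mul_rpow_of_nonneg _ _ hr0.le]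
    congr 2
    ring

end TrigKernel

end DyadicRiesz

namespace DyadicRiesz

open Filter Topology
open LaurentPolynomial

/-! ### Laurent polynomials on the circle -/

section Laurent

/-- Evaluation of a Laurent polynomial on the unit circle. -/
noncomputable def evalCircle (θ : ℝ) : ℂ[T;T⁻¹] →+* ℂ :=
  eval₂ (RingHom.id ℂ) (Circle.toUnits (𝐞 θ))

lemma evalCircle_T (θ : ℝ) (n : ℤ) : evalCircle θ (T n) = (𝐞 (n * θ) : ℂ) := by
  rw [evalCircle, eval₂_T, ← zsmul_eq_mul, AddChar.map_zsmul_eq_zpow, ← map_zpow]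
  rfl

lemma evalCircle_C (θ : ℝ) (a : ℂ) : evalCircle θ (C a) = a := by simp [evalCircle]

lemma evalCircle_eq_sum (θ : ℝ) (a : ℂ[T;T⁻¹]) :
    evalCircle θ a = ∑ k ∈ a.coeff.support, a.coeff k * (𝐞 (k * θ) : ℂ) := by
  change _ = a.coeff.sum fun k c => c * (𝐞 (k * θ) : ℂ)
  induction a using LaurentPolynomial.induction_on' with
  | add p q hp hq =>
    rw [map_add, hp, hq, AddMonoidAlgebra.coeff_add, Finsupp.sum_add_index'] <;> simp [add_mul]
  | C_mul_T n a =>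
    rw [map_mul, evalCircle_T, evalCircle_C, ← single_eq_C_mul_T, AddMonoidAlgebra.coeff_single,
      Finsupp.sum_single_index]
    simp

lemma evalCircle_eq_sum_of_subset (θ : ℝ) (a : ℂ[T;T⁻¹]) {S : Finset ℤ}
    (hS : a.coeff.support ⊆ S) : evalCircle θ a = ∑ k ∈ S, a.coeff k * (𝐞 (k * θ) : ℂ) := by
  rw [evalCircle_eq_sum]
  refine Finset.sum_subset hS fun k _ hk => ?_
  rw [Finsupp.notMem_support_iff.1 hk, zero_mul]

/-- The variable as a unit. -/
noncomputable def unitT : (ℂ[T;T⁻¹])ˣ :=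
  ⟨T 1, T (-1), by rw [← T_add]; simp, by rw [← T_add]; simp⟩

lemma unitT_zpow (n : ℤ) : ((unitT ^ n : (ℂ[T;T⁻¹])ˣ) : ℂ[T;T⁻¹]) = T n := by
  induction n with
  | zero => simp
  | succ n ih => rw [zpow_add_one, Units.val_mul, ih, T_add]; rfl
  | pred n ih => rw [zpow_sub_one, Units.val_mul, ih, T_sub]; rfl

/-- The substitution `T ↦ z T`. -/
noncomputable def dilate (z : ℂˣ) : ℂ[T;T⁻¹] →+* ℂ[T;T⁻¹] :=
  eval₂ C (Units.map (C : ℂ →+* ℂ[T;T⁻¹]) z * unitT)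

lemma dilate_C_mul_T (z : ℂˣ) (a : ℂ) (n : ℤ) :
    dilate z (C a * T n) = C (a * (z ^ n : ℂˣ)) * T n := by
  rw [dilate, eval₂_C_mul_T, mul_zpow, Units.val_mul, unitT_zpow, ← mul_assoc, ← map_zpow,
    Units.coe_map, MonoidHom.coe_coe, ← map_mul]

lemma coeff_dilate (z : ℂˣ) (a : ℂ[T;T⁻¹]) (k : ℤ) :
    (dilate z a).coeff k = (z ^ k : ℂˣ) * a.coeff k := by
  induction a using LaurentPolynomial.induction_on' with
  | add p q hp hq =>
    simp only [map_add, AddMonoidAlgebra.coeff_add, Finsupp.add_apply, hp, hq, mul_add]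
  | C_mul_T n a =>
    rw [dilate_C_mul_T, ← single_eq_C_mul_T, ← single_eq_C_mul_T, AddMonoidAlgebra.coeff_single,
      AddMonoidAlgebra.coeff_single, Finsupp.single_apply, Finsupp.single_apply]
    split_ifs with h
    · rw [h, mul_comm]
    · simp

lemma dilate_dilate (z w : ℂˣ) (a : ℂ[T;T⁻¹]) : dilate z (dilate w a) = dilate (z * w) a := by
  ext k
  rw [coeff_dilate, coeff_dilate, coeff_dilate, mul_zpow, Units.val_mul, mul_assoc]

/-- A quarter turn. -/
noncomputable def quarter : ℂˣ := Units.mk0 (-Complex.I) (neg_ne_zero.2 Complex.I_ne_zero)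

lemma quarter_mul_self : quarter * quarter = -1 := by
  ext
  simp [quarter]

lemma fourierChar_neg_quarter (n : ℤ) : (𝐞 (n * (-(1 / 4)) : ℝ) : ℂ) = (quarter ^ n : ℂˣ) := by
  have h : (𝐞 (-(1 / 4) : ℝ) : ℂ) = -Complex.I := by
    rw [Real.fourierChar_apply, show 2 * Real.pi * (-(1 / 4)) = -(Real.pi / 2) by ring,
      Complex.ofReal_neg, Complex.ofReal_div, Complex.ofReal_ofNat, neg_mul, Complex.exp_neg,
      Complex.exp_pi_div_two_mul_I, Complex.inv_I]
  rw [← zsmul_eq_mul, AddChar.map_zsmul_eq_zpow, Units.val_zpow_eq_zpow_val, quarter,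
    Units.val_mk0, ← h]
  exact map_zpow Circle.coeHom _ _

/-- Since `𝐞 (-1/4) = -I`, the substitution `T ↦ -I T` is a rotation by a quarter turn, which
carries the cosine to the sine. -/
lemma evalCircle_dilate_quarter (θ : ℝ) (a : ℂ[T;T⁻¹]) :
    evalCircle θ (dilate quarter a) = evalCircle (θ - 1 / 4) a := by
  induction a using LaurentPolynomial.induction_on' with
  | add p q hp hq => simp only [map_add, hp, hq]
  | C_mul_T n a =>
    rw [dilate_C_mul_T, map_mul (evalCircle _), map_mul (evalCircle _), evalCircle_C, evalCircle_C,
      evalCircle_T, evalCircle_T, ← fourierChar_neg_quarter, mul_assoc, ← Circle.coe_mul, ← AddChar.map_add_eq_mul]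
    congr 4
    ring

lemma integral_fourierChar (k : ℤ) :
    ∫ θ in (0 : ℝ)..1, (𝐞 (k * θ) : ℂ) = if k = 0 then 1 else 0 := by
  split_ifs with hk
  · simp [hk]
  · have hk' : (2 * Real.pi * k * Complex.I : ℂ) ≠ 0 := by
      simp [hk, Real.pi_ne_zero]
    have : ∀ θ : ℝ, (𝐞 (k * θ) : ℂ) = Complex.exp ((2 * Real.pi * k * Complex.I) * θ) := by
      intro θ
      rw [Real.fourierChar_apply]
      congr 1
      push_cast
      ring
    simp_rw [this]
    rw [integral_exp_mul_complex hk']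
    have h1 : Complex.exp (2 * Real.pi * k * Complex.I) = 1 := by
      rw [show (2 * Real.pi * k * Complex.I : ℂ) = k * (2 * Real.pi * Complex.I) by ring]
      exact Complex.exp_int_mul_two_pi_mul_I k
    simp [h1]

lemma continuous_fourierChar_mul (k : ℤ) : Continuous fun θ : ℝ => (𝐞 (k * θ) : ℂ) := by
  have := Real.continuous_fourierChar
  fun_prop

/-- Orthogonality of characters. The pairing is bilinear rather than Hermitian, so `k` meets `-k`
and `S` has to be symmetric. -/
lemma integral_evalCircle_mul (a b : ℂ[T;T⁻¹]) {S : Finset ℤ} (hS : ∀ k ∈ S, -k ∈ S)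
    (ha : a.coeff.support ⊆ S) (hb : b.coeff.support ⊆ S) :
    ∫ θ in (0 : ℝ)..1, evalCircle θ a * evalCircle θ b =
      ∑ k ∈ S, a.coeff k * b.coeff (-k) := by
  simp_rw [evalCircle_eq_sum_of_subset _ a ha, evalCircle_eq_sum_of_subset _ b hb,
    Finset.sum_mul_sum]
  have hterm : ∀ (θ : ℝ) (k l : ℤ), a.coeff k * (𝐞 (k * θ) : ℂ) * (b.coeff l * (𝐞 (l * θ) : ℂ)) =
      a.coeff k * b.coeff l * (𝐞 ((k + l : ℤ) * θ) : ℂ) := by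
    intro θ k l
    rw [Int.cast_add, add_mul, AddChar.map_add_eq_mul, Circle.coe_mul]
    ring
  simp_rw [hterm]
  have hc : ∀ k l : ℤ, Continuous fun θ : ℝ =>
      a.coeff k * b.coeff l * (𝐞 ((k + l : ℤ) * θ) : ℂ) :=
    fun k l => continuous_const.mul (continuous_fourierChar_mul _)
  rw [intervalIntegral.integral_finsetSum fun k _ =>
    (continuous_finsetSum _ fun l _ => hc k l).intervalIntegrable _ _]
  refine Finset.sum_congr rfl fun k hk => ?_
  rw [intervalIntegral.integral_finsetSum fun l _ => (hc k l).intervalIntegrable _ _]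
  simp_rw [intervalIntegral.integral_const_mul, integral_fourierChar, mul_ite, mul_one, mul_zero,
    add_comm k, ← eq_neg_iff_add_eq_zero]
  rw [Finset.sum_ite_eq', if_pos (hS k hk)]

end Laurent

/-! ### A polynomial iteration that converges to the sign -/

section CubicIterate

/-- The iterates of `x ↦ (3 x - x³) / 2`, which converge to the sign on `[-1, 1]`. -/
noncomputable def cubicIter : ℕ → ℝ → ℝ
  | 0, x => x
  | n + 1, x => (3 * cubicIter n x - cubicIter n x ^ 3) / 2

/-- This rests on 2 ± (3y - y³) = (1 ± y)² (2 ∓ y). -/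
lemma abs_cubicIter_le {x : ℝ} (hx : |x| ≤ 1) (n : ℕ) : |cubicIter n x| ≤ 1 := by
  induction n with
  | zero => exact hx
  | succ n ih =>
    rw [cubicIter]
    set y := cubicIter n x
    obtain ⟨h1, h2⟩ := abs_le.1 ih
    rw [abs_le]
    constructor
    · nlinarith [mul_nonneg (sq_nonneg (1 + y)) (by linarith : 0 ≤ 2 - y)]
    · nlinarith [mul_nonneg (sq_nonneg (1 - y)) (by linarith : 0 ≤ 2 + y)]

lemma continuous_cubicIter (n : ℕ) : Continuous (cubicIter n) := by
  induction n with
  | zero => exact continuous_id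
  | succ n ih =>
    change Continuous fun x => (3 * cubicIter n x - cubicIter n x ^ 3) / 2
    fun_prop

/-- One step sends the defect 1 - y² to (1 - y²)² (4 - y²) / 4, so it at least squares it; the
geometric rate is a weaker consequence that suffices. -/
lemma one_sub_cubicIter_sq_le {x : ℝ} (hx : |x| ≤ 1) (n : ℕ) :
    1 - cubicIter n x ^ 2 ≤ (1 - x ^ 2) ^ (n + 1) := by
  have hx2 : 0 ≤ 1 - x ^ 2 := by
    have := (sq_le_one_iff_abs_le_one x).2 hx
    linarith
  have hx3 : 1 - x ^ 2 ≤ 1 := by linarith [sq_nonneg x]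
  induction n with
  | zero => simp [cubicIter]
  | succ n ih =>
    rw [cubicIter]
    set y := cubicIter n x
    have hy := (sq_le_one_iff_abs_le_one _).2 (abs_cubicIter_le hx n)
    have h1 : 1 - ((3 * y - y ^ 3) / 2) ^ 2 = (1 - y ^ 2) ^ 2 * (4 - y ^ 2) / 4 := by ring
    calc 1 - ((3 * y - y ^ 3) / 2) ^ 2 ≤ (1 - y ^ 2) ^ 2 := by
          rw [h1]
          nlinarith [sq_nonneg (1 - y ^ 2), sq_nonneg y]
      _ ≤ ((1 - x ^ 2) ^ (n + 1)) ^ 2 := by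
          have : 0 ≤ 1 - y ^ 2 := by linarith
          gcongr
      _ = (1 - x ^ 2) ^ (n + 1 + 1 + n) := by ring
      _ ≤ (1 - x ^ 2) ^ (n + 1 + 1) := pow_le_pow_of_le_one hx2 hx3 (by omega)

lemma tendsto_one_sub_cubicIter_sq {x : ℝ} (hx : |x| ≤ 1) (h0 : x ≠ 0) :
    Tendsto (fun n => 1 - cubicIter n x ^ 2) atTop (𝓝 0) := by
  have hx2 : 0 ≤ 1 - x ^ 2 := by
    have := (sq_le_one_iff_abs_le_one x).2 hx
    linarith
  have hlt : 1 - x ^ 2 < 1 := by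
    have : 0 < x ^ 2 := by positivity
    linarith
  refine squeeze_zero (fun n => ?_) (one_sub_cubicIter_sq_le hx)
    ((tendsto_pow_atTop_nhds_zero_of_lt_one hx2 hlt).comp (tendsto_add_atTop_nat 1))
  have := (sq_le_one_iff_abs_le_one _).2 (abs_cubicIter_le hx n)
  linarith

/-- A step adds x y (1 - y²) / 2 ≥ 0 to the product x y, so the first iterate is a lower bound for
all later ones. This makes the bound on the first Fourier coefficient uniform in `n`. -/
lemma le_mul_cubicIter {x : ℝ} (hx : |x| ≤ 1) (n : ℕ) :
    (3 * x ^ 2 - x ^ 4) / 2 ≤ x * cubicIter (n + 1) x := by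
  induction n with
  | zero =>
    simp only [cubicIter]
    linarith [show x * ((3 * x - x ^ 3) / 2) = (3 * x ^ 2 - x ^ 4) / 2 by ring]
  | succ n ih =>
    rw [cubicIter]
    set y := cubicIter (n + 1) x
    have hy := (sq_le_one_iff_abs_le_one _).2 (abs_cubicIter_le hx (n + 1))
    have hx2 := (sq_le_one_iff_abs_le_one x).2 hx
    have h1 : 0 ≤ x * y := by nlinarith [sq_nonneg x]
    have h2 : x * ((3 * y - y ^ 3) / 2) = x * y + x * y * (1 - y ^ 2) / 2 := by ring
    have h3 : 0 ≤ x * y * (1 - y ^ 2) := mul_nonneg h1 (by linarith)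
    linarith

end CubicIterate

end DyadicRiesz

namespace DyadicRiesz

open Filter Topology
open LaurentPolynomial

/-! ### Approximate signs of cosine and sine as trigonometric polynomials -/

section SignPolynomials

/-- The real Laurent polynomials of `cubicIter n (cos 2πθ)`. -/
noncomputable def signPolyReal : ℕ → ℝ[T;T⁻¹]
  | 0 => C (1 / 2) * (T 1 + T (-1))
  | n + 1 => C (1 / 2) * (C 3 * signPolyReal n - signPolyReal n ^ 3)

/-- The Laurent polynomials of `cubicIter n (cos 2πθ)`. -/
noncomputable def signPoly (n : ℕ) : ℂ[T;T⁻¹] :=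
  AddMonoidAlgebra.mapRingHom ℤ Complex.ofRealHom (signPolyReal n)

/-- The approximate sign of the cosine. -/
noncomputable def approxSign (n : ℕ) (θ : ℝ) : ℝ := cubicIter n (Real.cos (2 * Real.pi * θ))

lemma mapRingHom_C (r : ℝ) :
    AddMonoidAlgebra.mapRingHom ℤ Complex.ofRealHom (C r) = C (r : ℂ) := by
  rw [← single_eq_C, ← single_eq_C, AddMonoidAlgebra.mapRingHom_single]
  rfl

lemma mapRingHom_T (n : ℤ) :
    AddMonoidAlgebra.mapRingHom ℤ Complex.ofRealHom (T n : ℝ[T;T⁻¹]) = (T n : ℂ[T;T⁻¹]) := by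
  rw [T, AddMonoidAlgebra.mapRingHom_single, map_one]
  rfl

lemma signPoly_zero : signPoly 0 = C (1 / 2) * (T 1 + T (-1)) := by
  rw [signPoly, signPolyReal, map_mul, map_add, mapRingHom_C, mapRingHom_T, mapRingHom_T]
  norm_num

lemma signPoly_succ (n : ℕ) :
    signPoly (n + 1) = C (1 / 2) * (C 3 * signPoly n - signPoly n ^ 3) := by
  rw [signPoly, signPolyReal, map_mul, map_sub, map_mul, map_pow, mapRingHom_C, mapRingHom_C,
    signPoly]
  norm_num

lemma coeff_signPoly (n : ℕ) (k : ℤ) :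
    (signPoly n).coeff k = ((signPolyReal n).coeff k : ℂ) := by
  rw [signPoly, AddMonoidAlgebra.coeff_mapRingHom]
  rfl

lemma evalCircle_signPoly (n : ℕ) (θ : ℝ) : evalCircle θ (signPoly n) = approxSign n θ := by
  induction n with
  | zero =>
    rw [signPoly_zero, map_mul, map_add, evalCircle_C, evalCircle_T, evalCircle_T, approxSign,
      cubicIter, Complex.ofReal_cos, Complex.cos, Real.fourierChar_apply, Real.fourierChar_apply]
    push_cast
    rw [show (2 * (Real.pi : ℂ) * (-1 * θ) * Complex.I) = -(2 * Real.pi * θ) * Complex.I by ring,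
      one_mul]
    ring
  | succ n ih =>
    rw [signPoly_succ, map_mul, map_sub, map_mul, map_pow, evalCircle_C, evalCircle_C, ih,
      approxSign]
    simp only [approxSign, cubicIter]
    push_cast
    ring

lemma invert_signPolyReal (n : ℕ) : invert (signPolyReal n) = signPolyReal n := by
  induction n with
  | zero => simp [signPolyReal, add_comm]
  | succ n ih => simp [signPolyReal, ih]

lemma coeff_signPolyReal_neg (n : ℕ) (k : ℤ) :
    (signPolyReal n).coeff (-k) = (signPolyReal n).coeff k := by
  conv_rhs => rw [← invert_signPolyReal]
  rw [invert_apply]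

lemma dilate_C (z : ℂˣ) (a : ℂ) : dilate z (C a) = C a := by
  have := dilate_C_mul_T z a 0
  simpa using this

lemma dilate_T (z : ℂˣ) (n : ℤ) : dilate z (T n) = C ((z ^ n : ℂˣ) : ℂ) * T n := by
  have := dilate_C_mul_T z 1 n
  simpa using this

lemma dilate_neg_one_signPoly (n : ℕ) : dilate (-1) (signPoly n) = -signPoly n := by
  induction n with
  | zero =>
    rw [signPoly_zero, map_mul, map_add, dilate_C, dilate_T, dilate_T]
    simp
    ring
  | succ n ih =>
    rw [signPoly_succ, map_mul, map_sub, map_mul, map_pow, dilate_C, dilate_C, ih]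
    ring

/-- The Laurent polynomials of `cubicIter n (sin 2πθ)`. -/
noncomputable def signPoly' (n : ℕ) : ℂ[T;T⁻¹] := dilate quarter (signPoly n)

lemma evalCircle_signPoly' (n : ℕ) (θ : ℝ) :
    evalCircle θ (signPoly' n) = approxSign n (θ - 1 / 4) := by
  rw [signPoly', evalCircle_dilate_quarter, evalCircle_signPoly]

lemma dilate_quarter_signPoly' (n : ℕ) : dilate quarter (signPoly' n) = -signPoly n := by
  rw [signPoly', dilate_dilate, quarter_mul_self, dilate_neg_one_signPoly]

lemma dilate_neg_one_signPoly' (n : ℕ) : dilate (-1) (signPoly' n) = -signPoly' n := by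
  rw [signPoly', dilate_dilate, mul_comm, ← dilate_dilate, dilate_neg_one_signPoly, map_neg]

/-- A half turn multiplies the `k`-th coefficient by (-1)^k. The two approximate signs thus live on
odd frequencies, and their product on even ones. -/
lemma coeff_eq_zero_of_even {a : ℂ[T;T⁻¹]} (ha : dilate (-1) a = -a) {k : ℤ} (hk : Even k) :
    a.coeff k = 0 := by
  have h := coeff_dilate (-1) a k
  rw [ha, hk.neg_one_zpow] at h
  simp only [AddMonoidAlgebra.coeff_neg, Finsupp.neg_apply, Units.val_one, one_mul] at h
  exact self_eq_neg.1 h.symm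

lemma coeff_eq_zero_of_odd {a : ℂ[T;T⁻¹]} (ha : dilate (-1) a = a) {k : ℤ} (hk : Odd k) :
    a.coeff k = 0 := by
  have h := coeff_dilate (-1) a k
  rw [ha, hk.neg_one_zpow] at h
  simp only [Units.val_neg, Units.val_one, neg_mul, one_mul] at h
  exact self_eq_neg.1 h

/-- The product of the two approximate signs. -/
noncomputable def signPolyMul (n : ℕ) : ℂ[T;T⁻¹] := signPoly n * signPoly' n

lemma dilate_neg_one_signPolyMul (n : ℕ) : dilate (-1) (signPolyMul n) = signPolyMul n := by
  rw [signPolyMul, map_mul, dilate_neg_one_signPoly, dilate_neg_one_signPoly', neg_mul_neg]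

/-- A quarter turn maps the pair (U, V) of approximate signs to (V, -U). It reverses the sign of U V
but preserves the mean. -/
lemma coeff_signPolyMul_zero (n : ℕ) : (signPolyMul n).coeff 0 = 0 := by
  have h : dilate quarter (signPolyMul n) = -signPolyMul n := by
    rw [signPolyMul, map_mul, dilate_quarter_signPoly', ← signPoly']
    ring
  have h1 := coeff_dilate quarter (signPolyMul n) 0
  rw [h] at h1
  simp only [AddMonoidAlgebra.coeff_neg, Finsupp.neg_apply, zpow_zero, Units.val_one,
    one_mul] at h1
  exact self_eq_neg.1 h1.symm

/-- A symmetric finite set of frequencies which contains those of the approximate signs. -/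
noncomputable def signSupport (n : ℕ) : Finset ℤ :=
  let S := {0, 1} ∪ (signPoly n).coeff.support ∪ (signPoly' n).coeff.support ∪
    (signPolyMul n).coeff.support
  S ∪ S.map (Equiv.neg ℤ).toEmbedding

lemma neg_mem_signSupport (n : ℕ) : ∀ k ∈ signSupport n, -k ∈ signSupport n := by
  intro k hk
  simp only [signSupport, Finset.mem_union, Finset.mem_map_equiv] at hk ⊢
  simp only [Equiv.neg_symm, Equiv.neg_apply, neg_neg] at hk ⊢
  tauto

lemma zero_mem_signSupport (n : ℕ) : 0 ∈ signSupport n := by simp [signSupport]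

lemma one_mem_signSupport (n : ℕ) : 1 ∈ signSupport n := by simp [signSupport]

lemma support_signPoly_subset (n : ℕ) : (signPoly n).coeff.support ⊆ signSupport n := by
  intro k hk
  simp only [signSupport, Finset.mem_union]
  tauto

lemma support_signPoly'_subset (n : ℕ) : (signPoly' n).coeff.support ⊆ signSupport n := by
  intro k hk
  simp only [signSupport, Finset.mem_union]
  tauto

lemma support_signPolyMul_subset (n : ℕ) : (signPolyMul n).coeff.support ⊆ signSupport n := by
  intro k hk
  simp only [signSupport, Finset.mem_union]
  tauto

lemma abs_approxSign_le (n : ℕ) (θ : ℝ) : |approxSign n θ| ≤ 1 :=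
  abs_cubicIter_le (Real.abs_cos_le_one _) n

lemma continuous_approxSign (n : ℕ) : Continuous (approxSign n) :=
  (continuous_cubicIter n).comp (by fun_prop)

lemma approxSign_sq_le (n : ℕ) (θ : ℝ) : approxSign n θ ^ 2 ≤ 1 :=
  (sq_le_one_iff_abs_le_one _).2 (abs_approxSign_le n θ)

lemma sum_sq_coeff_signPoly_le (n : ℕ) :
    ∑ k ∈ signSupport n, (signPolyReal n).coeff k ^ 2 ≤ 1 := by
  have h := integral_evalCircle_mul (signPoly n) (signPoly n) (neg_mem_signSupport n)
    (support_signPoly_subset n) (support_signPoly_subset n)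
  have h1 : ∑ k ∈ signSupport n, (signPoly n).coeff k * (signPoly n).coeff (-k) =
      ((∑ k ∈ signSupport n, (signPolyReal n).coeff k ^ 2 : ℝ) : ℂ) := by
    push_cast
    refine Finset.sum_congr rfl fun k _ => ?_
    rw [coeff_signPoly, coeff_signPoly, coeff_signPolyReal_neg, sq]
  simp_rw [h1, evalCircle_signPoly, ← Complex.ofReal_mul] at h
  rw [intervalIntegral.integral_ofReal, Complex.ofReal_inj] at h
  rw [← h]
  have hc := continuous_approxSign n
  calc ∫ θ in (0 : ℝ)..1, approxSign n θ * approxSign n θ ≤ ∫ θ in (0 : ℝ)..1, (1 : ℝ) := by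
        refine intervalIntegral.integral_mono zero_le_one ((hc.mul hc).intervalIntegrable _ _)
          (by simp) fun θ => ?_
        have := approxSign_sq_le n θ
        simp only
        linarith [sq (approxSign n θ)]
    _ = 1 := by simp

lemma integral_cos_poly :
    ∫ θ in (0 : ℝ)..1, (3 * Real.cos (2 * Real.pi * θ) ^ 2 - Real.cos (2 * Real.pi * θ) ^ 4) / 2 =
      9 / 16 := by
  have h := intervalIntegral.integral_comp_mul_left (a := 0) (b := 1)
    (fun x => (3 * Real.cos x ^ 2 - Real.cos x ^ 4) / 2)
    (by positivity : (2 * Real.pi) ≠ 0)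
  rw [h, intervalIntegral.integral_div, intervalIntegral.integral_sub
    (Continuous.intervalIntegrable (by fun_prop) _ _) (Continuous.intervalIntegrable (by fun_prop) _ _),
    intervalIntegral.integral_const_mul, integral_cos_pow (n := 2), integral_cos_sq]
  simp
  field_simp
  norm_num

/-- By evenness this coefficient is the mean of the cosine times the approximate sign, which
`le_mul_cubicIter` bounds below pointwise. One iteration is needed: the cosine itself has
coefficient 1/2. -/
lemma le_coeff_signPolyReal_one (n : ℕ) : 9 / 16 ≤ (signPolyReal (n + 1)).coeff 1 := by
  set m := n + 1
  have h := integral_evalCircle_mul (T 1 + T (-1)) (signPoly m) (S := signSupport m)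
    (neg_mem_signSupport m) ?_ (support_signPoly_subset m)
  swap
  · intro k hk
    by_contra hkS
    have h1 : k ≠ 1 := fun h => hkS (h ▸ one_mem_signSupport m)
    have h2 : k ≠ -1 := fun h => hkS (h ▸ neg_mem_signSupport m 1 (one_mem_signSupport m))
    simp [h1.symm, h2.symm] at hk
  have hsum : ∑ k ∈ signSupport m, (T 1 + T (-1) : ℂ[T;T⁻¹]).coeff k * (signPoly m).coeff (-k) =
      ((2 * (signPolyReal m).coeff 1 : ℝ) : ℂ) := by
    simp only [AddMonoidAlgebra.coeff_add, Finsupp.add_apply, T_apply, add_mul, ite_mul, one_mul,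
      zero_mul, Finset.sum_add_distrib]
    rw [Finset.sum_ite_eq, Finset.sum_ite_eq, if_pos (one_mem_signSupport m),
      if_pos (neg_mem_signSupport m 1 (one_mem_signSupport m)), coeff_signPoly, coeff_signPoly,
      neg_neg, coeff_signPolyReal_neg]
    push_cast
    ring
  have hev : ∀ θ, evalCircle θ (T 1 + T (-1)) * evalCircle θ (signPoly m) =
      ((2 * (Real.cos (2 * Real.pi * θ) * approxSign m θ) : ℝ) : ℂ) := by
    intro θ
    have h0 := evalCircle_signPoly 0 θ
    rw [signPoly_zero, map_mul, evalCircle_C, approxSign, cubicIter] at h0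
    rw [evalCircle_signPoly]
    rw [Complex.ofReal_mul, Complex.ofReal_mul, ← h0]
    push_cast
    ring
  simp_rw [hsum, hev] at h
  rw [intervalIntegral.integral_ofReal, Complex.ofReal_inj, intervalIntegral.integral_const_mul,
    mul_right_inj' two_ne_zero] at h
  rw [← h, ← integral_cos_poly]
  have hc := continuous_approxSign m
  refine intervalIntegral.integral_mono zero_le_one
    (Continuous.intervalIntegrable (by fun_prop) _ _)
    (Continuous.intervalIntegrable (by fun_prop) _ _) fun θ => ?_
  exact le_mul_cubicIter (Real.abs_cos_le_one _) n

lemma tendsto_integral_one_sub_approxSign_sq (c : ℝ) :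
    Tendsto (fun n => ∫ θ in (0 : ℝ)..1, (1 - approxSign n (θ - c) ^ 2)) atTop (𝓝 0) := by
  suffices h : Tendsto (fun n => ∫ θ in (0 : ℝ)..1, (1 - approxSign n (θ - c) ^ 2)) atTop
      (𝓝 (∫ θ in (0 : ℝ)..1, (0 : ℝ))) by
    rwa [intervalIntegral.integral_zero] at h
  refine intervalIntegral.tendsto_integral_filter_of_dominated_convergence
    (F := fun n θ => 1 - approxSign n (θ - c) ^ 2) (l := atTop) (fun _ => (1 : ℝ))
    ?_ ?_ ?_ ?_
  · filter_upwards with n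
    have hc := continuous_approxSign n
    exact Continuous.aestronglyMeasurable (by fun_prop)
  · filter_upwards with n
    filter_upwards with θ _
    have := approxSign_sq_le n (θ - c)
    rw [Real.norm_of_nonneg (by linarith)]
    linarith [sq_nonneg (approxSign n (θ - c))]
  · simp
  -- The iterates fail to converge to ±1 only at zeros of the cosine, which form a null set.
  · have hcount : {θ : ℝ | Real.cos (2 * Real.pi * (θ - c)) = 0}.Countable := by
      refine (Set.countable_range fun k : ℤ => (2 * k + 1) / 4 + c).mono fun θ hθ => ?_
      obtain ⟨k, hk⟩ := Real.cos_eq_zero_iff.1 hθ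
      refine ⟨k, ?_⟩
      have := Real.pi_pos
      field_simp at hk
      simp only
      linarith
    filter_upwards [hcount.ae_notMem volume] with θ hθ _
    exact tendsto_one_sub_cubicIter_sq (Real.abs_cos_le_one _) hθ

end SignPolynomials

end DyadicRiesz

namespace DyadicRiesz

open Filter Topology
open LaurentPolynomial

/-! ### The conjugate function and the constant κ -/

section ConjugatePairing

/-- The pairing of the conjugate function of `a` with `b`. -/
noncomputable def conjPairing (S : Finset ℤ) (a b : ℤ → ℂ) : ℂ :=
  ∑ k ∈ S, -Complex.I * ((SignType.sign k : SignType) : ℝ) * (a k * b (-k))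

lemma conjPairing_comm {S : Finset ℤ} (hS : ∀ k ∈ S, -k ∈ S) (a b : ℤ → ℂ) :
    conjPairing S b a = -conjPairing S a b := by
  rw [conjPairing, conjPairing, ← Finset.sum_neg_distrib]
  refine Finset.sum_nbij' (fun k => -k) (fun k => -k) hS hS (by simp) (by simp) fun k _ => ?_
  rw [Left.sign_neg, neg_neg]
  push_cast
  ring

lemma conjPairing_self {S : Finset ℤ} (hS : ∀ k ∈ S, -k ∈ S) (a : ℤ → ℂ) :
    conjPairing S a a = 0 := self_eq_neg.1 (conjPairing_comm hS a a)

/-- The pairing of the conjugate of the approximate sign of the cosine with the approximate sign of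
the sine. -/
noncomputable def conjConst (n : ℕ) : ℝ :=
  ∑ k ∈ signSupport n, (-Complex.I * ((SignType.sign k : SignType) : ℝ) * Complex.I ^ k).re *
    (signPolyReal n).coeff k ^ 2

lemma I_zpow_mul_sign_im {k : ℤ} (hk : Odd k) :
    (-Complex.I * ((SignType.sign k : SignType) : ℝ) * Complex.I ^ k).im = 0 := by
  obtain ⟨m, rfl⟩ := hk
  rw [zpow_add₀ Complex.I_ne_zero, zpow_mul, zpow_one, zpow_two, Complex.I_mul_I]
  have h : -Complex.I * ((SignType.sign (2 * m + 1) : SignType) : ℝ) * ((-1) ^ m * Complex.I) =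
      (((SignType.sign (2 * m + 1) : SignType) : ℝ) * (-1) ^ m : ℝ) := by
    generalize ((SignType.sign (2 * m + 1) : SignType) : ℝ) = ε
    push_cast
    linear_combination (-(ε : ℂ) * (-1) ^ m) * Complex.I_mul_I
  rw [h, Complex.ofReal_im]

/-- The quarter turn makes the `-k`-th coefficient of the second polynomial `I ^ k` times the `k`-th
coefficient of the first. Only odd `k` contribute, and there `-I sign(k) I ^ k` is real. -/
lemma conjPairing_signPoly (n : ℕ) :
    conjPairing (signSupport n) (fun k => (signPoly n).coeff k) (fun k => (signPoly' n).coeff k) =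
      conjConst n := by
  rw [conjPairing, conjConst, Complex.ofReal_sum]
  refine Finset.sum_congr rfl fun k _ => ?_
  rcases Int.even_or_odd k with hk | hk
  · have h0 := coeff_eq_zero_of_even (dilate_neg_one_signPoly n) hk
    rw [h0]
    rw [coeff_signPoly, Complex.ofReal_eq_zero] at h0
    simp [h0]
  · have h1 : (signPoly' n).coeff (-k) = Complex.I ^ k * (signPolyReal n).coeff k := by
      rw [signPoly', coeff_dilate, coeff_signPoly, coeff_signPolyReal_neg,
        Units.val_zpow_eq_zpow_val, quarter, Units.val_mk0, ← Complex.inv_I, inv_zpow', neg_neg]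
    have h2 : ((-Complex.I * ((SignType.sign k : SignType) : ℝ) * Complex.I ^ k).re : ℂ) =
        -Complex.I * ((SignType.sign k : SignType) : ℝ) * Complex.I ^ k := by
      apply Complex.ext
      · simp
      · rw [I_zpow_mul_sign_im hk, Complex.ofReal_im]
    rw [h1, coeff_signPoly, Complex.ofReal_mul, h2]
    push_cast
    ring

lemma neg_one_le_re (k : ℤ) :
    -1 ≤ (-Complex.I * ((SignType.sign k : SignType) : ℝ) * Complex.I ^ k).re := by
  refine (abs_le.1 ((Complex.abs_re_le_norm _).trans ?_)).1
  rw [norm_mul, norm_mul, norm_zpow, Complex.norm_I, one_zpow, norm_neg, Complex.norm_I, one_mul,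
    mul_one, Complex.norm_real]
  rcases lt_trichotomy k 0 with h | h | h
  · simp [sign_neg h]
  · simp [h]
  · simp [sign_pos h]

/-- The factors in `conjConst` are at least -1, and equal to 1 at `k = ±1`. Adding the sum of
squares, which is at most 1, leaves nonnegative terms, so the constant is at least 4 (9/16)² - 1 =
17/64. -/
lemma le_conjConst (n : ℕ) : 17 / 64 ≤ conjConst (n + 1) := by
  set m := n + 1
  have h1 : (9 / 16 : ℝ) ≤ (signPolyReal m).coeff 1 := le_coeff_signPolyReal_one n
  have h2 := sum_sq_coeff_signPoly_le m
  have hsub : ({1, -1} : Finset ℤ) ⊆ signSupport m := by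
    intro k hk
    simp only [Finset.mem_insert, Finset.mem_singleton] at hk
    rcases hk with rfl | rfl
    · exact one_mem_signSupport m
    · exact neg_mem_signSupport m 1 (one_mem_signSupport m)
  have h3 := Finset.sum_le_sum_of_subset_of_nonneg hsub (f := fun k : ℤ =>
    ((-Complex.I * ((SignType.sign k : SignType) : ℝ) * Complex.I ^ k).re + 1) *
      (signPolyReal m).coeff k ^ 2) fun k _ _ =>
      mul_nonneg (by linarith [neg_one_le_re k]) (sq_nonneg _)
  rw [Finset.sum_pair (by decide), coeff_signPolyReal_neg] at h3
  simp only [add_mul, one_mul, Finset.sum_add_distrib] at h3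
  rw [← conjConst] at h3
  simp at h3
  nlinarith

end ConjugatePairing

/-! ### The kernel of approximate quadrant indicators -/

section Kernel

/-- The sign of the second binary digit of a base `4` digit. -/
def lowSign (i : Fin 4) : ℝ := if (i : ℕ) % 2 = 1 then 1 else -1

/-- The sign of the first binary digit of a base `4` digit. -/
def highSign (i : Fin 4) : ℝ := if (i : ℕ) / 2 = 1 then 1 else -1

/-- The product of the signs of the two binary digits of a base `4` digit. -/
noncomputable def mulSign (i : Fin 4) : ℝ := highSign i * lowSign i

lemma lowSign_sq (i : Fin 4) : lowSign i = 1 ∨ lowSign i = -1 := by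
  unfold lowSign
  split_ifs <;> simp

lemma mulSign_sq (i : Fin 4) : mulSign i = 1 ∨ mulSign i = -1 := by
  unfold mulSign highSign lowSign
  split_ifs <;> simp

lemma eq_of_signs {i i' : Fin 4} (h : mulSign i = mulSign i') (h' : lowSign i = lowSign i') :
    i = i' := by
  revert h h'
  fin_cases i <;> fin_cases i' <;> norm_num [mulSign, highSign, lowSign]

/-- The Laurent polynomials of the approximate quadrant indicators. -/
noncomputable def quadrantPoly (n : ℕ) (i : Fin 4) : ℂ[T;T⁻¹] :=
  C (1 / 4) * (1 + C (mulSign i : ℂ) * signPoly n + C (lowSign i : ℂ) * signPoly' n +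
    C (mulSign i * lowSign i : ℂ) * signPolyMul n)

lemma C_mul_coeff (a : ℂ) (p : ℂ[T;T⁻¹]) (k : ℤ) : (C a * p).coeff k = a * p.coeff k := by
  rw [← smul_eq_C_mul]
  simp

lemma coeff_quadrantPoly (n : ℕ) (i : Fin 4) (k : ℤ) :
    (quadrantPoly n i).coeff k = 1 / 4 * ((if k = 0 then 1 else 0) +
      mulSign i * (signPoly n).coeff k + lowSign i * (signPoly' n).coeff k +
      mulSign i * lowSign i * (signPolyMul n).coeff k) := by
  have h1 : (1 : ℂ[T;T⁻¹]).coeff k = if k = 0 then 1 else 0 := by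
    rw [← map_one C, C_apply]
  rw [quadrantPoly, C_mul_coeff]
  simp only [AddMonoidAlgebra.coeff_add, Finsupp.add_apply, C_mul_coeff, h1]

lemma support_quadrantPoly_subset (n : ℕ) (i : Fin 4) :
    (quadrantPoly n i).coeff.support ⊆ signSupport n := by
  intro k hk
  by_contra h
  have h0 : k ≠ 0 := fun h0 => h (h0 ▸ zero_mem_signSupport n)
  rw [Finsupp.mem_support_iff, coeff_quadrantPoly,
    Finsupp.notMem_support_iff.1 (fun hh => h (support_signPoly_subset n hh)),
    Finsupp.notMem_support_iff.1 (fun hh => h (support_signPoly'_subset n hh)),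
    Finsupp.notMem_support_iff.1 (fun hh => h (support_signPolyMul_subset n hh))] at hk
  simp [h0] at hk

/-- The approximate quadrant indicators. -/
noncomputable def quadrant (n : ℕ) (i : Fin 4) (θ : ℝ) : ℝ :=
  (1 + mulSign i * approxSign n θ) * (1 + lowSign i * approxSign n (θ - 1 / 4)) / 4

lemma evalCircle_quadrantPoly (n : ℕ) (i : Fin 4) (θ : ℝ) :
    evalCircle θ (quadrantPoly n i) = quadrant n i θ := by
  rw [quadrantPoly, signPolyMul]
  simp only [map_mul, map_add, map_one, evalCircle_C, evalCircle_signPoly, evalCircle_signPoly',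
    quadrant]
  push_cast
  ring

lemma one_add_sign_mul_nonneg {ε : ℝ} (hε : ε = 1 ∨ ε = -1) (n : ℕ) (θ : ℝ) :
    0 ≤ 1 + ε * approxSign n θ := by
  obtain ⟨h1, h2⟩ := abs_le.1 (abs_approxSign_le n θ)
  rcases hε with rfl | rfl <;> linarith

lemma one_add_sign_mul_le {ε : ℝ} (hε : ε = 1 ∨ ε = -1) (n : ℕ) (θ : ℝ) :
    1 + ε * approxSign n θ ≤ 2 := by
  obtain ⟨h1, h2⟩ := abs_le.1 (abs_approxSign_le n θ)
  rcases hε with rfl | rfl <;> linarith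

lemma quadrant_nonneg (n : ℕ) (i : Fin 4) (θ : ℝ) : 0 ≤ quadrant n i θ :=
  div_nonneg (mul_nonneg (one_add_sign_mul_nonneg (mulSign_sq i) n θ)
    (one_add_sign_mul_nonneg (lowSign_sq i) n _)) zero_le_four

lemma sum_quadrant (n : ℕ) (θ : ℝ) : ∑ i, quadrant n i θ = 1 := by
  simp [Fin.sum_univ_four, quadrant, mulSign, highSign, lowSign]
  ring

lemma continuous_quadrant (n : ℕ) (i : Fin 4) : Continuous (quadrant n i) := by
  have := continuous_approxSign n
  unfold quadrant
  fun_prop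

lemma coeff_quadrantPoly_zero (n : ℕ) (i : Fin 4) :
    (quadrantPoly n i).coeff 0 = ((1 / 4 : ℝ) : ℂ) := by
  rw [coeff_quadrantPoly, coeff_signPolyMul_zero,
    coeff_eq_zero_of_even (dilate_neg_one_signPoly n) Even.zero,
    coeff_eq_zero_of_even (dilate_neg_one_signPoly' n) Even.zero]
  simp

/-- The constants are killed by the sign of 0, the self-pairings vanish by antisymmetry, and the
product term, being of even frequency, does not meet the odd approximate signs. Only the pairing of
the two signs with each other remains. -/
lemma conjPairing_quadrantPoly (n : ℕ) (i i' : Fin 4) :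
    conjPairing (signSupport n) (fun k => (quadrantPoly n i').coeff k)
      (fun k => (quadrantPoly n i).coeff k) =
      ((conjConst n / 16 * (mulSign i' * lowSign i - lowSign i' * mulSign i) : ℝ) : ℂ) := by
  set S := signSupport n
  set U : ℤ → ℂ := fun k => (signPoly n).coeff k
  set V : ℤ → ℂ := fun k => (signPoly' n).coeff k
  set W : ℤ → ℂ := fun k => (signPolyMul n).coeff k
  have hS := neg_mem_signSupport n
  have hUV : conjPairing S U V = conjConst n := conjPairing_signPoly n
  have hVU : conjPairing S V U = -conjConst n := by rw [conjPairing_comm hS, hUV]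
  have hexp : conjPairing S (fun k => (quadrantPoly n i').coeff k)
      (fun k => (quadrantPoly n i).coeff k) = 1 / 16 * (mulSign i' * mulSign i * conjPairing S U U +
      mulSign i' * lowSign i * conjPairing S U V + lowSign i' * mulSign i * conjPairing S V U +
      lowSign i' * lowSign i * conjPairing S V V +
      (mulSign i' * lowSign i') * (mulSign i * lowSign i) * conjPairing S W W) := by
    simp only [conjPairing, Finset.mul_sum, ← Finset.sum_add_distrib]
    refine Finset.sum_congr rfl fun k _ => ?_
    rw [coeff_quadrantPoly, coeff_quadrantPoly]
    by_cases h0 : k = 0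
    · simp [h0]
    rw [if_neg h0, if_neg (neg_ne_zero.2 h0)]
    change _ * (1 / 4 * (0 + _ * U k + _ * V k + _ * W k) *
      (1 / 4 * (0 + _ * U (-k) + _ * V (-k) + _ * W (-k)))) = _
    rcases Int.even_or_odd k with hk | hk
    · have h1 : U k = 0 := coeff_eq_zero_of_even (dilate_neg_one_signPoly n) hk
      have h2 : V k = 0 := coeff_eq_zero_of_even (dilate_neg_one_signPoly' n) hk
      have h3 : U (-k) = 0 := coeff_eq_zero_of_even (dilate_neg_one_signPoly n) hk.neg
      have h4 : V (-k) = 0 := coeff_eq_zero_of_even (dilate_neg_one_signPoly' n) hk.neg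
      rw [h1, h2, h3, h4]
      ring
    · have h1 : W k = 0 := coeff_eq_zero_of_odd (dilate_neg_one_signPolyMul n) hk
      have h2 : W (-k) = 0 := coeff_eq_zero_of_odd (dilate_neg_one_signPolyMul n) hk.neg
      rw [h1, h2]
      ring
  rw [hexp, hUV, hVU, conjPairing_self hS, conjPairing_self hS, conjPairing_self hS]
  push_cast
  ring

/-- The kernel of approximate quadrant indicators. -/
noncomputable def quadrantKernel (n : ℕ) : TrigKernel (Fin 4) where
  coeff i k := (quadrantPoly n i).coeff k
  supp := signSupport n
  neg_mem := neg_mem_signSupport n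
  zero_mem := zero_mem_signSupport n
  val := quadrant n
  val_eq i θ := by
    rw [← evalCircle_quadrantPoly, evalCircle_eq_sum_of_subset _ _ (support_quadrantPoly_subset n i)]
  nonneg := quadrant_nonneg n
  sum_eq_one := sum_quadrant n
  mass := 1 / 4
  coeff_zero := coeff_quadrantPoly_zero n
  corr i i' := ∫ θ in (0 : ℝ)..1, quadrant n i' θ * quadrant n i θ
  corr_eq i i' := by
    rw [← integral_evalCircle_mul _ _ (neg_mem_signSupport n) (support_quadrantPoly_subset n i')
      (support_quadrantPoly_subset n i)]
    simp_rw [evalCircle_quadrantPoly, ← Complex.ofReal_mul]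
    rw [intervalIntegral.integral_ofReal]
  conjCorr i i' := conjConst n / 16 * (mulSign i' * lowSign i - lowSign i' * mulSign i)
  conjCorr_eq i i' := conjPairing_quadrantPoly n i i'

lemma integral_quadrant (n : ℕ) (i : Fin 4) : ∫ θ in (0 : ℝ)..1, quadrant n i θ = 1 / 4 := by
  have h := integral_evalCircle_mul (quadrantPoly n i) 1 (neg_mem_signSupport n)
    (support_quadrantPoly_subset n i) (by
      intro k hk
      rw [← map_one C, Finsupp.mem_support_iff, C_apply] at hk
      simp only [ne_eq, ite_eq_right_iff, one_ne_zero, imp_false, not_not] at hk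
      exact hk ▸ zero_mem_signSupport n)
  simp_rw [map_one, mul_one, evalCircle_quadrantPoly] at h
  have h2 : ∑ k ∈ signSupport n, (quadrantPoly n i).coeff k * (1 : ℂ[T;T⁻¹]).coeff (-k) =
      ((1 / 4 : ℝ) : ℂ) := by
    rw [← map_one C]
    simp only [C_apply, neg_eq_zero, mul_ite, mul_one, mul_zero]
    rw [Finset.sum_ite_eq', if_pos (zero_mem_signSupport n), coeff_quadrantPoly_zero]
  rw [h2, intervalIntegral.integral_ofReal, Complex.ofReal_inj] at h
  exact h

lemma sum_corr (n : ℕ) (i : Fin 4) : ∑ i', (quadrantKernel n).corr i i' = 1 / 4 := by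
  change ∑ i', ∫ θ in (0 : ℝ)..1, quadrant n i' θ * quadrant n i θ = 1 / 4
  rw [← intervalIntegral.integral_finsetSum (f := fun i' θ => quadrant n i' θ * quadrant n i θ)
    fun i' _ => ((continuous_quadrant n i').mul (continuous_quadrant n i)).intervalIntegrable _ _]
  simp_rw [← Finset.sum_mul, sum_quadrant, one_mul]
  exact integral_quadrant n i

/-- Distinct digits differ in one of the two signs. The corresponding factors multiply to (1 + x)(1
- x) = 1 - x² with x an approximate sign, and the mean of this tends to zero. -/
lemma tendsto_corr_of_ne {i i' : Fin 4} (h : i ≠ i') :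
    Tendsto (fun n => (quadrantKernel n).corr i i') atTop (𝓝 0) := by
  have hlim : Tendsto (fun n => (∫ θ in (0 : ℝ)..1, (1 - approxSign n (θ - 0) ^ 2)) +
      ∫ θ in (0 : ℝ)..1, (1 - approxSign n (θ - 1 / 4) ^ 2)) atTop (𝓝 0) := by
    simpa using (tendsto_integral_one_sub_approxSign_sq 0).add
      (tendsto_integral_one_sub_approxSign_sq (1 / 4))
  refine squeeze_zero (fun n => ?_) (fun n => ?_) hlim
  · exact intervalIntegral.integral_nonneg zero_le_one fun θ _ =>
      mul_nonneg (quadrant_nonneg n _ _) (quadrant_nonneg n _ _)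
  · have hc := continuous_approxSign n
    have hq := continuous_quadrant n
    rw [← intervalIntegral.integral_add (Continuous.intervalIntegrable (by fun_prop) _ _)
      (Continuous.intervalIntegrable (by fun_prop) _ _)]
    refine intervalIntegral.integral_mono zero_le_one
      (((hq i').mul (hq i)).intervalIntegrable _ _)
      (Continuous.intervalIntegrable (by fun_prop) _ _) fun θ => ?_
    have hsq := approxSign_sq_le n
    have key : ∀ {a b ε ε' : ℝ}, 0 ≤ a → a ≤ 2 → 0 ≤ b → b ≤ 2 → (ε = 1 ∨ ε = -1) →
        (ε' = 1 ∨ ε' = -1) → ε ≠ ε' → ∀ x : ℝ, x ^ 2 ≤ 1 →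
        (1 + ε' * x) * a / 4 * ((1 + ε * x) * b / 4) ≤ 1 - x ^ 2 := by
      intro a b ε ε' ha ha' hb hb' hε hε' hne x hx
      have h1 : (1 + ε' * x) * (1 + ε * x) = 1 - x ^ 2 := by
        rcases hε with rfl | rfl <;> rcases hε' with rfl | rfl
        · exact absurd rfl hne
        · ring
        · ring
        · exact absurd rfl hne
      have h2 : a * b ≤ 2 * 2 := mul_le_mul ha' hb' hb zero_le_two
      have h3 : (1 + ε' * x) * a / 4 * ((1 + ε * x) * b / 4) = (1 - x ^ 2) * (a * b) / 16 := by
        rw [← h1]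
        ring
      rw [h3]
      nlinarith
    simp only [quadrant, sub_zero]
    by_cases hm : mulSign i = mulSign i'
    · have hl : lowSign i ≠ lowSign i' := fun hl => h (eq_of_signs hm hl)
      have := key (one_add_sign_mul_nonneg (mulSign_sq i') n θ)
        (one_add_sign_mul_le (mulSign_sq i') n θ) (one_add_sign_mul_nonneg (mulSign_sq i) n θ)
        (one_add_sign_mul_le (mulSign_sq i) n θ) (lowSign_sq i) (lowSign_sq i') hl
        (approxSign n (θ - 1 / 4)) (hsq _)
      have h4 := hsq θ
      rw [mul_comm (1 + mulSign i' * _), mul_comm (1 + mulSign i * _)]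
      linarith
    · have := key (one_add_sign_mul_nonneg (lowSign_sq i') n (θ - 1 / 4))
        (one_add_sign_mul_le (lowSign_sq i') n _) (one_add_sign_mul_nonneg (lowSign_sq i) n (θ - 1 / 4))
        (one_add_sign_mul_le (lowSign_sq i) n _) (mulSign_sq i) (mulSign_sq i') hm
        (approxSign n θ) (hsq _)
      have h4 := hsq (θ - 1 / 4)
      linarith

/-- The rows sum to 1/4, so the off-diagonal limits determine the diagonal one. -/
lemma tendsto_corr (i i' : Fin 4) :
    Tendsto (fun n => (quadrantKernel n).corr i i') atTop (𝓝 (if i = i' then 1 / 4 else 0)) := by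
  split_ifs with h
  · subst h
    have h1 : ∀ n, (quadrantKernel n).corr i i =
        1 / 4 - ∑ i' ∈ Finset.univ.erase i, (quadrantKernel n).corr i i' := by
      intro n
      rw [← sum_corr n i, ← Finset.add_sum_erase Finset.univ _ (Finset.mem_univ i)]
      ring
    simp_rw [h1]
    have := (tendsto_finsetSum (Finset.univ.erase i) fun i' hi' =>
      tendsto_corr_of_ne (Finset.ne_of_mem_erase hi').symm).const_sub (1 / 4 : ℝ)
    simpa using this
  · exact tendsto_corr_of_ne h

end Kernel

end DyadicRiesz

namespace DyadicRiesz

open Filter Topology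

/-! ### The base 4 model -/

section Model

variable {d K : ℕ}

/-- The factors of the kernel of the dyadic Riesz transform in the base `4` model. -/
noncomputable def modelEntry (m l : Fin K) (i i' : Fin 4) : ℝ :=
  if l < m then (if i = i' then 1 else 0)
  else if l = m then 1 / 4 * (mulSign i' * lowSign i - lowSign i' * mulSign i) else 1 / 4

/-- The kernel of the dyadic Riesz transform in the base `4` model. -/
noncomputable def modelKernel (dir : Fin K → Fin d) (j : Fin d) (s s' : Fin K → Fin 4) : ℝ :=
  ∑ m, if dir m = j then ∏ l, modelEntry m l (s l) (s' l) else 0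

/-- The approximations of `modelEntry` obtained from the approximate quadrant indicators. -/
noncomputable def approxEntry (n : ℕ) (m l : Fin K) (i i' : Fin 4) : ℝ :=
  if l < m then 4 * (quadrantKernel n).corr i i'
  else if l = m then 1 / 4 * (mulSign i' * lowSign i - lowSign i' * mulSign i) else 1 / 4

/-- Each of the `K` factors yields 1/4, and the conjugate correlation occurs exactly once in each
product, so κ comes out to the first power. -/
lemma limitKernel_quadrantKernel (n : ℕ) (dir : Fin K → Fin d) (j : Fin d)
    (s s' : Fin K → Fin 4) :
    (quadrantKernel n).limitKernel dir j s s' = ((1 / 4) ^ K * conjConst n) *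
      ∑ m, if dir m = j then ∏ l, approxEntry n m l (s l) (s' l) else 0 := by
  rw [TrigKernel.limitKernel, Finset.mul_sum]
  refine Finset.sum_congr rfl fun m _ => ?_
  rw [mul_ite, mul_zero]
  congr 1
  have h : ∀ l : Fin K, (quadrantKernel n).entry m l (s l) (s' l) =
      (1 / 4) * (if l = m then conjConst n else 1) * approxEntry n m l (s l) (s' l) := by
    intro l
    unfold TrigKernel.entry approxEntry
    rcases lt_trichotomy l m with h | h | h
    · simp [h, h.ne]
    · simp only [h, lt_irrefl, if_true, if_false]
      change conjConst n / 16 * _ = _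
      ring
    · simp only [h.not_gt, h.ne', if_false]
      change (1 / 4 : ℝ) ^ 2 = _
      ring
  simp_rw [h]
  rw [Finset.prod_mul_distrib, Finset.prod_mul_distrib, Finset.prod_const, Finset.card_univ,
    Fintype.card_fin, Finset.prod_ite_eq' Finset.univ m, if_pos (Finset.mem_univ m)]

lemma tendsto_approxEntry (m l : Fin K) (i i' : Fin 4) :
    Tendsto (fun n => approxEntry n m l i i') atTop (𝓝 (modelEntry m l i i')) := by
  unfold approxEntry modelEntry
  by_cases h : l < m
  · simp only [h, if_true]
    have := (tendsto_corr i i').const_mul 4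
    convert! this using 2
    split_ifs <;> norm_num
  · simp only [h, if_false]
    exact tendsto_const_nhds

variable {X : Type*} [NormedAddCommGroup X] [NormedSpace ℝ X]

/-- The dyadic Riesz vector in the base `4` model is bounded by the Riesz vector. -/
theorem sum_modelKernel_le [CompleteSpace X] (dir : Fin K → Fin d) {r : ℝ} (hr : 1 < r)
    (f : (Fin K → Fin 4) → X) {C : ℝ≥0}
    (hC : ∀ (n : ℕ) (L : ℝ), ∫⁻ y, ‖(quadrantKernel n).testImage dir L f y‖ₑ ^ r ≤
      C ^ r * ∫⁻ y, ‖∑ s, (quadrantKernel n).testFunction dir L s y • f s‖ₑ ^ r) :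
    ∑ s, ‖(WithLp.toLp 2 fun j => ∑ s', modelKernel dir j s s' • f s' :
      PiLp 2 (fun _ : Fin d => X))‖ₑ ^ r ≤
      (ENNReal.ofReal (64 / 17) * C) ^ r * ∑ s, ‖f s‖ₑ ^ r := by
  have hr0 : 0 < r := by linarith
  let G : ℕ → (Fin K → Fin 4) → PiLp 2 (fun _ : Fin d => X) := fun n s =>
    WithLp.toLp 2 fun j => ∑ s',
      (∑ m, if dir m = j then ∏ l, approxEntry n m l (s l) (s' l) else 0) • f s'
  have hG : Tendsto (fun n => ∑ s, ‖G n s‖ₑ ^ r) atTop (𝓝 (∑ s, ‖(WithLp.toLp 2 fun j =>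
      ∑ s', modelKernel dir j s s' • f s' : PiLp 2 (fun _ : Fin d => X))‖ₑ ^ r)) := by
    refine tendsto_finsetSum _ fun s _ => ?_
    refine (ENNReal.continuous_rpow_const.tendsto _).comp ((continuous_enorm.tendsto _).comp
      (((PiLp.continuous_toLp 2 _).tendsto _).comp (tendsto_pi_nhds.2 fun j => ?_)))
    refine tendsto_finsetSum _ fun s' _ => Tendsto.smul_const ?_ _
    refine tendsto_finsetSum _ fun m _ => ?_
    by_cases h : dir m = j
    · simp only [h, if_true]
      exact tendsto_finsetProd _ fun l _ => tendsto_approxEntry m l _ _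
    · simp only [h, if_false]
      exact tendsto_const_nhds
  -- The index is shifted because `le_conjConst` starts after one iteration.
  refine le_of_tendsto (hG.comp (tendsto_add_atTop_nat 1)) (.of_forall fun n => ?_)
  simp only [Function.comp_apply]
  have h := (quadrantKernel (n + 1)).sum_limitKernel_le dir hr f (hC (n + 1))
  set κ := conjConst (n + 1)
  have hκ : 17 / 64 ≤ κ := le_conjConst n
  have hκ0 : 0 < κ := by linarith
  have hvec : ∀ s, (WithLp.toLp 2 fun j => ∑ s', (quadrantKernel (n + 1)).limitKernel dir j s s' •
      f s' : PiLp 2 (fun _ : Fin d => X)) = ((1 / 4) ^ K * κ) • G (n + 1) s := by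
    intro s
    ext j
    simp only [limitKernel_quadrantKernel, G, PiLp.smul_apply, Finset.smul_sum, smul_smul, κ]
  have hpos : 0 < (1 / 4 : ℝ) ^ K * κ := by positivity
  simp_rw [hvec, enorm_smul, Real.enorm_of_nonneg hpos.le,
    ENNReal.mul_rpow_of_nonneg _ _ hr0.le] at h
  rw [← Finset.mul_sum] at h
  change _ ≤ (C ^ r * ENNReal.ofReal ((1 / 4) ^ K) ^ r) * _ at h
  rw [ENNReal.ofReal_mul (by positivity), ENNReal.mul_rpow_of_nonneg _ _ hr0.le,
    mul_comm (_ ^ r) (ENNReal.ofReal ((1 / 4) ^ K) ^ r), mul_assoc, mul_assoc] at h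
  -- The mass factor stands on both sides of `h` and is cancelled, which makes the constant
  -- independent of the number of digits.
  have h4 : ENNReal.ofReal ((1 / 4 : ℝ) ^ K) ^ r ≠ 0 := by
    simp [ENNReal.rpow_eq_zero_iff, not_lt.2 hr0.le]
  have h4' : ENNReal.ofReal ((1 / 4 : ℝ) ^ K) ^ r ≠ ⊤ :=
    ENNReal.rpow_ne_top_of_nonneg hr0.le ENNReal.ofReal_ne_top
  rw [ENNReal.mul_le_mul_iff_right h4 h4'] at h
  have hone : ENNReal.ofReal (64 / 17) ^ r * ENNReal.ofReal κ ^ r ≥ 1 := by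
    rw [← ENNReal.mul_rpow_of_nonneg _ _ hr0.le, ← ENNReal.ofReal_mul (by norm_num)]
    refine ENNReal.one_le_rpow ?_ hr0
    rw [ENNReal.one_le_ofReal]
    linarith
  calc ∑ s, ‖G (n + 1) s‖ₑ ^ r
      ≤ (ENNReal.ofReal (64 / 17) ^ r * ENNReal.ofReal κ ^ r) * ∑ s, ‖G (n + 1) s‖ₑ ^ r :=
        le_mul_of_one_le_left' hone
    _ ≤ ENNReal.ofReal (64 / 17) ^ r * (C ^ r * ∑ s, ‖f s‖ₑ ^ r) := by
        rw [mul_assoc]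
        gcongr
    _ = _ := by rw [ENNReal.mul_rpow_of_nonneg _ _ hr0.le, mul_assoc]

lemma sum_eq_zero_of_sum_update {Y : Type*} [AddCommMonoid Y] (l : Fin K)
    (h : (Fin K → Fin 4) → Y) (hh : ∀ s, ∑ i, h (Function.update s l i) = 0) : ∑ s, h s = 0 := by
  rw [← (Equiv.funSplitAt l (Fin 4)).symm.sum_comp h, Fintype.sum_prod_type_right]
  refine Finset.sum_eq_zero fun g _ => ?_
  rw [← hh ((Equiv.funSplitAt l (Fin 4)).symm (0, g))]
  refine Finset.sum_congr rfl fun i _ => congrArg h ?_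
  ext x
  by_cases hx : x = l
  · subst hx
    simp [Equiv.funSplitAt]
  · simp [Equiv.funSplitAt, hx]

lemma sum_lowSign : ∑ i, lowSign i = 0 := by simp [Fin.sum_univ_four, lowSign]

lemma sum_mulSign : ∑ i, mulSign i = 0 := by
  simp [Fin.sum_univ_four, mulSign, lowSign, highSign]

lemma sum_modelEntry_diag (m : Fin K) (i : Fin 4) : ∑ i', modelEntry m m i i' = 0 := by
  simp only [modelEntry, lt_irrefl, if_true, if_false]
  rw [← Finset.mul_sum, Finset.sum_sub_distrib, ← Finset.sum_mul, ← Finset.sum_mul, sum_mulSign,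
    sum_lowSign]
  simp

lemma prod_modelEntry_update (m l : Fin K) (s s' : Fin K → Fin 4) (i : Fin 4) :
    ∏ x, modelEntry m x (s x) (Function.update s' l i x) =
      modelEntry m l (s l) i * ∏ x ∈ Finset.univ.erase l, modelEntry m x (s x) (s' x) := by
  rw [← Finset.mul_prod_erase _ _ (Finset.mem_univ l), Function.update_self]
  congr 1
  refine Finset.prod_congr rfl fun x hx => ?_
  rw [Function.update_of_ne (Finset.ne_of_mem_erase hx)]

/-- The model kernel acts on functions that do not depend on the distinguished digit. -/
lemma sum_modelEntry_smul_eq_zero (m : Fin K) (s : Fin K → Fin 4) (g : (Fin K → Fin 4) → X)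
    (hg : ∀ s' i, g (Function.update s' m i) = g s') :
    ∑ s', (∏ x, modelEntry m x (s x) (s' x)) • g s' = 0 := by
  refine sum_eq_zero_of_sum_update m _ fun s' => ?_
  simp_rw [prod_modelEntry_update, hg]
  rw [← Finset.sum_smul, ← Finset.sum_mul, sum_modelEntry_diag, zero_mul, zero_smul]

/-- Digits after the `m`-th are averaged uniformly, which kills later increments. -/
lemma sum_modelEntry_smul_of_gt {m l : Fin K} (hl : m < l) (s : Fin K → Fin 4)
    (g : (Fin K → Fin 4) → X) (hg : ∀ s', ∑ i, g (Function.update s' l i) = 0) :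
    ∑ s', (∏ x, modelEntry m x (s x) (s' x)) • g s' = 0 := by
  refine sum_eq_zero_of_sum_update l _ fun s' => ?_
  simp_rw [prod_modelEntry_update]
  have : ∀ i, modelEntry m l (s l) i = 1 / 4 := fun i => by
    simp [modelEntry, hl.not_gt, hl.ne']
  simp_rw [this]
  rw [← Finset.smul_sum, hg, smul_zero]

lemma sum_modelEntry_smul_digit (m : Fin K) (s : Fin K → Fin 4) (e : Fin 4 → X) :
    ∑ s' : Fin K → Fin 4, (∏ x, modelEntry m x (s x) (s' x)) • e (s' m) =
      ∑ i, modelEntry m m (s m) i • e i := by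
  -- The dependence on the digit `s' m` is moved into the product as an indicator, so that the sum
  -- over strings factorizes; each coordinate other than `m` then sums to one.
  have h1 : ∀ s' : Fin K → Fin 4, (∏ x, modelEntry m x (s x) (s' x)) • e (s' m) =
      ∑ i, (∏ x, modelEntry m x (s x) (s' x) * (if x = m then if s' x = i then 1 else 0 else 1)) •
        e i := by
    intro s'
    simp_rw [Finset.prod_mul_distrib]
    rw [Finset.sum_eq_single (s' m)]
    · rw [Finset.prod_ite_eq' Finset.univ m]
      simp
    · intro i _ hi
      rw [Finset.prod_ite_eq' Finset.univ m]
      simp [hi.symm]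
    · simp
  simp_rw [h1]
  rw [Finset.sum_comm]
  refine Finset.sum_congr rfl fun i _ => ?_
  rw [← Finset.sum_smul]
  congr 1
  have h2 := Finset.prod_univ_sum (fun _ : Fin K => (Finset.univ : Finset (Fin 4)))
    (fun x i' => modelEntry m x (s x) i' * (if x = m then if i' = i then 1 else 0 else 1))
  rw [Fintype.piFinset_univ] at h2
  rw [← h2, ← Finset.mul_prod_erase _ _ (Finset.mem_univ m), Finset.prod_eq_one, mul_one]
  · simp
  · intro x hx
    rcases lt_or_gt_of_ne (Finset.ne_of_mem_erase hx) with h | h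
    · simp [modelEntry, h, h.ne]
    · simp [modelEntry, h.not_gt, h.ne']

/-- The model kernel acts on a sum of digit increments by acting on the distinguished digit. -/
lemma sum_modelEntry_smul (a : X) (E : Fin K → Fin 4 → ℕ → X) (P : Fin K → (Fin K → Fin 4) → ℕ)
    (hP : ∀ l s s', (∀ x < l, s x = s' x) → P l s = P l s') (hE : ∀ l x, ∑ i, E l i x = 0)
    (m : Fin K) (s : Fin K → Fin 4) :
    ∑ s', (∏ x, modelEntry m x (s x) (s' x)) • (a + ∑ l, E l (s' l) (P l s')) =
      ∑ i, modelEntry m m (s m) i • E m i (P m s) := by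
  have hPu : ∀ l l' s i, l ≤ l' → P l (Function.update s l' i) = P l s := fun l l' s i hl =>
    hP l _ _ fun x hx => Function.update_of_ne (hx.trans_le hl).ne _ _
  simp_rw [smul_add, Finset.smul_sum, Finset.sum_add_distrib]
  rw [sum_modelEntry_smul_eq_zero m s (fun _ => a) (fun _ _ => rfl), zero_add, Finset.sum_comm,
    Finset.sum_eq_single m]
  · rw [← sum_modelEntry_smul_digit m s fun i => E m i (P m s)]
    refine Finset.sum_congr rfl fun s' _ => ?_
    by_cases h : ∀ x < m, s x = s' x
    · rw [hP m s s' h]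
    -- If the earlier digits differ, a diagonal factor vanishes, so the prefix may always be taken
    -- from `s`.
    · push Not at h
      obtain ⟨x, hx, hne⟩ := h
      rw [Finset.prod_eq_zero (Finset.mem_univ x), zero_smul, zero_smul]
      simp [modelEntry, hx, hne]
  · intro l _ hl
    rcases lt_or_gt_of_ne hl with h | h
    · refine sum_modelEntry_smul_eq_zero m s (fun s' => E l (s' l) (P l s')) fun s' i => ?_
      rw [Function.update_of_ne hl, hPu l m s' i h.le]
    · refine sum_modelEntry_smul_of_gt h s (fun s' => E l (s' l) (P l s')) fun s' => ?_
      simp_rw [Function.update_self, hPu l l s' _ le_rfl]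
      exact hE l _
  · simp

end Model

end DyadicRiesz

namespace DyadicRiesz

open Filter Topology

/-! ### Pointwise form of Haar sums and dyadic Riesz transforms -/

section Levels

/-- The index of the dyadic interval of length `2⁻ⁿ` that contains `t`. -/
noncomputable def dyadicIndex (n : ℕ) (t : ℝ) : ℕ := ⌊2 ^ n * t⌋₊

/-- The sign of the `(n + 1)`-st binary digit of `t`. -/
noncomputable def rademacher (n : ℕ) (t : ℝ) : ℝ := if Odd (dyadicIndex (n + 1) t) then 1 else -1

lemma mem_dyadicInterval_iff {n k : ℕ} {t : ℝ} (ht : 0 ≤ t) :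
    t ∈ dyadicInterval n k ↔ dyadicIndex n t = k := by
  have h2 : (0 : ℝ) < 2 ^ n := by positivity
  rw [dyadicInterval, dyadicIndex, Set.mem_Ico, Nat.floor_eq_iff (by positivity),
    div_le_iff₀ h2, lt_div_iff₀ h2, mul_comm t]

lemma dyadicIndex_add (n m : ℕ) (t : ℝ) : dyadicIndex n t = dyadicIndex (n + m) t / 2 ^ m := by
  have h : (2 : ℝ) ^ n * t = 2 ^ (n + m) * t / ((2 ^ m : ℕ) : ℝ) := by
    push_cast
    rw [pow_add]
    field_simp
  rw [dyadicIndex, h, Nat.floor_div_natCast, dyadicIndex]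

lemma dyadicIndex_lt {n : ℕ} {t : ℝ} (ht : t ∈ Set.Ico (0 : ℝ) 1) : dyadicIndex n t < 2 ^ n := by
  rw [dyadicIndex, Nat.floor_lt (by have := ht.1; positivity)]
  push_cast
  exact mul_lt_of_lt_one_right (by positivity) ht.2

lemma indicator_dyadicInterval {n k : ℕ} {t : ℝ} (ht : 0 ≤ t) :
    (dyadicInterval n k).indicator (1 : ℝ → ℝ) t = if dyadicIndex n t = k then 1 else 0 := by
  by_cases h : dyadicIndex n t = k
  · rw [Set.indicator_of_mem ((mem_dyadicInterval_iff ht).2 h), if_pos h, Pi.one_apply]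
  · rw [Set.indicator_of_notMem (fun hh => h ((mem_dyadicInterval_iff ht).1 hh)), if_neg h]

lemma haar_eq {n k : ℕ} {t : ℝ} (ht : 0 ≤ t) :
    haar n k t = if dyadicIndex n t = k then √(2 ^ n) * rademacher n t else 0 := by
  have h1 := dyadicIndex_add n 1 t
  rw [pow_one] at h1
  simp only [haar, indicator_dyadicInterval ht, rademacher, Nat.odd_iff]
  set k' := dyadicIndex (n + 1) t
  split_ifs <;> first | omega | simp

variable {X : Type*} [NormedAddCommGroup X] [NormedSpace ℝ X]

/-- The part of level `n` of a Haar sum. -/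
noncomputable def haarLevel (n : ℕ) (c : ℕ → X) (t : ℝ) : X :=
  (√(2 ^ n) * rademacher n t) • c (dyadicIndex n t)

/-- The dyadic Riesz transform of the part of level `n` of a Haar sum. -/
noncomputable def rieszLevel (n : ℕ) (c : ℕ → X) (t : ℝ) : X :=
  (√(2 ^ n) * rademacher n t) •
    if Even (dyadicIndex n t) then c (dyadicIndex n t + 1) else -c (dyadicIndex n t - 1)

lemma sum_haar_smul (n : ℕ) (c : ℕ → X) {t : ℝ} (ht : t ∈ Set.Ico (0 : ℝ) 1) :
    ∑ k ∈ Finset.range (2 ^ n), haar n k t • c k = haarLevel n c t := by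
  simp_rw [haar_eq ht.1, ite_smul, zero_smul]
  rw [Finset.sum_ite_eq, if_pos (Finset.mem_range.2 (dyadicIndex_lt ht)), haarLevel]

/-- At `t` only the sibling of the interval containing `t` contributes; the root has no sibling. -/
lemma sum_shiftedHaar_smul {n : ℕ} (hn : n ≠ 0) (c : ℕ → X) {t : ℝ}
    (ht : t ∈ Set.Ico (0 : ℝ) 1) :
    ∑ k ∈ Finset.range (2 ^ n), shiftedHaar n k t • c k = rieszLevel n c t := by
  have hlt := dyadicIndex_lt (n := n) ht
  obtain ⟨m, rfl⟩ := Nat.exists_eq_succ_of_ne_zero hn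
  rw [Nat.succ_eq_add_one, pow_succ] at *
  set k₀ := dyadicIndex (m + 1) t
  have hval : ∀ k, shiftedHaar (m + 1) k t =
      if k = (if Even k₀ then k₀ + 1 else k₀ - 1) then
        (if Even k₀ then 1 else -1) * (√(2 ^ (m + 1)) * rademacher (m + 1) t) else 0 := by
    intro k
    unfold shiftedHaar
    by_cases hk : Even k
    · rw [if_pos hk, Pi.neg_apply, haar_eq ht.1]
      change -(if k₀ = _ then _ else _) = _
      rw [Nat.even_iff] at hk
      simp only [Nat.even_iff]
      split_ifs <;> first | omega | simp
    · rw [if_neg hk, haar_eq ht.1]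
      change (if k₀ = _ then _ else _) = _
      rw [Nat.even_iff] at hk
      simp only [Nat.even_iff]
      split_ifs <;> first | omega | simp
  simp_rw [hval, ite_smul, zero_smul]
  rw [Finset.sum_ite_eq', if_pos]
  · rw [rieszLevel]
    change _ = _ • (if Even k₀ then c (k₀ + 1) else -c (k₀ - 1))
    by_cases h : Even k₀
    · simp [h]
    · simp [h]
  · rw [Finset.mem_range]
    simp only [Nat.even_iff]
    split_ifs <;> omega

lemma haarSum_eq (N : ℕ) (a : X) (c : ℕ → ℕ → X) {t : ℝ} (ht : t ∈ Set.Ico (0 : ℝ) 1) :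
    haarSum N a c t = a + ∑ n ∈ Finset.range N, haarLevel n (c n) t := by
  simp_rw [haarSum, sum_haar_smul _ _ ht, Set.indicator_of_mem ht]

lemma dyadicRiesz_eq {d : ℕ} (j : Fin d) (N : ℕ) (c : ℕ → ℕ → X) {t : ℝ}
    (ht : t ∈ Set.Ico (0 : ℝ) 1) :
    dyadicRiesz j N c t =
      ∑ n ∈ (Finset.range N).filter (fun n => n ≠ 0 ∧ n % d = j), rieszLevel n (c n) t := by
  rw [dyadicRiesz]
  refine Finset.sum_congr rfl fun n hn => ?_
  exact sum_shiftedHaar_smul (Finset.mem_filter.1 hn).2.1 _ ht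

end Levels

/-! ### Base 4 digits and their distribution -/

section Digits

variable {K : ℕ}

/-- The base `4` digits of `t`. -/
noncomputable def digits (K : ℕ) (t : ℝ) (m : Fin K) : Fin 4 :=
  ⟨dyadicIndex (2 * m + 2) t % 4, Nat.mod_lt _ (by norm_num)⟩

/-- The integer with the first `m` digits of `s`. -/
def digitPrefix (s : Fin K → Fin 4) : ℕ → ℕ
  | 0 => 0
  | m + 1 => 4 * digitPrefix s m + if h : m < K then (s ⟨m, h⟩ : ℕ) else 0

lemma digitPrefix_congr {s s' : Fin K → Fin 4} (m : ℕ) (h : ∀ x : Fin K, (x : ℕ) < m → s x = s' x) :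
    digitPrefix s m = digitPrefix s' m := by
  induction m with
  | zero => rfl
  | succ m ih =>
    rw [digitPrefix, digitPrefix, ih fun x hx => h x (by omega)]
    split_ifs with hm
    · rw [h ⟨m, hm⟩ (by simp)]
    · rfl

lemma eq_of_digitPrefix_eq {s s' : Fin K → Fin 4} (m : ℕ) (h : digitPrefix s m = digitPrefix s' m) :
    ∀ x : Fin K, (x : ℕ) < m → s x = s' x := by
  induction m with
  | zero => intro x hx; omega
  | succ m ih =>
    rw [digitPrefix, digitPrefix] at h
    intro x hx
    by_cases hm : m < K
    · rw [dif_pos hm, dif_pos hm] at h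
      have h1 := (s ⟨m, hm⟩).isLt
      have h2 := (s' ⟨m, hm⟩).isLt
      rcases Nat.lt_succ_iff_lt_or_eq.1 hx with hx | hx
      · exact ih (by omega) x hx
      · have : x = ⟨m, hm⟩ := Fin.ext hx
        rw [this]
        exact Fin.ext (by omega)
    · exact ih (by rw [dif_neg hm, dif_neg hm] at h; omega) x (by omega)

lemma digitPrefix_digits {t : ℝ} (ht : t ∈ Set.Ico (0 : ℝ) 1) {m : ℕ} (hm : m ≤ K) :
    digitPrefix (digits K t) m = dyadicIndex (2 * m) t := by
  induction m with
  | zero =>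
    have := dyadicIndex_lt (n := 0) ht
    simp only [pow_zero, Nat.lt_one_iff] at this
    rw [digitPrefix, mul_zero, this]
  | succ m ih =>
    rw [digitPrefix, ih (by omega), dif_pos (by omega), dyadicIndex_add (2 * m) 2 t, digits]
    change 4 * (dyadicIndex (2 * m + 2) t / 4) + dyadicIndex (2 * m + 2) t % 4 = _
    rw [Nat.div_add_mod]
    rfl

lemma digitPrefix_lt (s : Fin K → Fin 4) (m : ℕ) : digitPrefix s m < 4 ^ m := by
  induction m with
  | zero => simp [digitPrefix]
  | succ m ih =>
    rw [digitPrefix, pow_succ]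
    split_ifs with h
    · have := (s ⟨m, h⟩).isLt
      omega
    · omega

lemma digits_eq_iff {t : ℝ} (ht : t ∈ Set.Ico (0 : ℝ) 1) (s : Fin K → Fin 4) :
    digits K t = s ↔ t ∈ dyadicInterval (2 * K) (digitPrefix s K) := by
  rw [mem_dyadicInterval_iff ht.1, ← digitPrefix_digits ht le_rfl]
  constructor
  · rintro rfl
    rfl
  · intro h
    ext1 x
    exact eq_of_digitPrefix_eq K h x x.isLt

lemma dyadicInterval_subset {n k : ℕ} (hk : k < 2 ^ n) : dyadicInterval n k ⊆ Set.Ico 0 1 := by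
  intro t ht
  refine ⟨le_trans (by positivity) ht.1, ht.2.trans_le ?_⟩
  rw [div_le_one (by positivity)]
  exact_mod_cast hk

lemma volume_dyadicInterval (n k : ℕ) :
    volume (dyadicInterval n k) = ENNReal.ofReal ((1 / 2) ^ n) := by
  rw [dyadicInterval, Real.volume_Ico]
  congr 1
  rw [one_div, inv_pow]
  ring

lemma measurable_digits : Measurable (digits K) := by
  refine measurable_pi_lambda _ fun m => ?_
  have h1 : Measurable fun t : ℝ => dyadicIndex (2 * m + 2) t := by
    unfold dyadicIndex
    exact Nat.measurable_floor.comp (by fun_prop)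
  exact (measurable_of_countable fun k : ℕ =>
    (⟨k % 4, Nat.mod_lt _ (by norm_num)⟩ : Fin 4)).comp h1

/-- The base `4` digits are uniformly distributed. -/
lemma lintegral_digits (g : (Fin K → Fin 4) → ℝ≥0∞) :
    ∫⁻ t in Set.Ico (0 : ℝ) 1, g (digits K t) = ENNReal.ofReal ((1 / 4) ^ K) * ∑ s, g s := by
  have hm : ∀ s : Fin K → Fin 4, (volume.restrict (Set.Ico (0 : ℝ) 1)).map (digits K) {s} =
      ENNReal.ofReal ((1 / 4) ^ K) := by
    intro s
    rw [Measure.map_apply measurable_digits (measurableSet_singleton s),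
      Measure.restrict_apply (measurable_digits (measurableSet_singleton s))]
    have h : digits K ⁻¹' {s} ∩ Set.Ico 0 1 = dyadicInterval (2 * K) (digitPrefix s K) := by
      ext t
      constructor
      · rintro ⟨h, ht⟩
        exact (digits_eq_iff ht s).1 h
      · intro h
        have ht := dyadicInterval_subset
          (by rw [pow_mul]; exact digitPrefix_lt s K) h
        exact ⟨(digits_eq_iff ht s).2 h, ht⟩
    rw [h, volume_dyadicInterval, pow_mul]
    norm_num
  rw [← lintegral_map (measurable_of_finite g) measurable_digits, lintegral_fintype]
  simp_rw [hm]
  rw [← Finset.sum_mul, mul_comm]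

end Digits

/-! ### The odd levels -/

section OddLevels

variable {d K : ℕ} {X : Type*} [NormedAddCommGroup X] [NormedSpace ℝ X]

/-- The digit increment that consists of the levels `2 m` and `2 m + 1` of a Haar sum. -/
noncomputable def digitIncrement (c : ℕ → ℕ → X) (m : Fin K) (i : Fin 4) (x : ℕ) : X :=
  (√(2 ^ (2 * (m : ℕ))) * highSign i) • c (2 * m) x +
    (√(2 ^ (2 * (m : ℕ) + 1)) * lowSign i) • c (2 * m + 1) (2 * x + i / 2)

lemma sum_digitIncrement (c : ℕ → ℕ → X) (m : Fin K) (x : ℕ) :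
    ∑ i, digitIncrement c m i x = 0 := by
  simp [Fin.sum_univ_four, digitIncrement, highSign, lowSign]
  abel

lemma dyadicIndex_two_mul_add_one (m : Fin K) (t : ℝ) :
    dyadicIndex (2 * m + 1) t = 2 * dyadicIndex (2 * m) t + (digits K t m : ℕ) / 2 := by
  have h1 := dyadicIndex_add (2 * m) 2 t
  have h2 := dyadicIndex_add (2 * m + 1) 1 t
  change _ = _ + (dyadicIndex (2 * m + 2) t % 4) / 2
  rw [show 2 * (m : ℕ) + 1 + 1 = 2 * m + 2 by ring] at h2
  omega

lemma rademacher_even (m : Fin K) (t : ℝ) : rademacher (2 * m) t = highSign (digits K t m) := by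
  rw [rademacher, highSign, dyadicIndex_two_mul_add_one]
  have := (digits K t m).isLt
  simp only [Nat.odd_iff]
  congr 1
  apply propext
  omega

lemma rademacher_odd (m : Fin K) (t : ℝ) : rademacher (2 * m + 1) t = lowSign (digits K t m) := by
  rw [rademacher, lowSign]
  change (if Odd (dyadicIndex (2 * m + 2) t) then _ else _) =
    if dyadicIndex (2 * m + 2) t % 4 % 2 = 1 then _ else _
  simp only [Nat.odd_iff]
  congr 1
  apply propext
  omega

lemma haarLevel_add_haarLevel (c : ℕ → ℕ → X) (m : Fin K) {t : ℝ} (ht : t ∈ Set.Ico (0 : ℝ) 1) :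
    haarLevel (2 * m) (c (2 * m)) t + haarLevel (2 * m + 1) (c (2 * m + 1)) t =
      digitIncrement c m (digits K t m) (digitPrefix (digits K t) m) := by
  rw [haarLevel, haarLevel, rademacher_even, rademacher_odd, dyadicIndex_two_mul_add_one,
    digitPrefix_digits ht m.isLt.le, digitIncrement]

lemma sum_range_two_mul {Y : Type*} [AddCommMonoid Y] (h : ℕ → Y) (K : ℕ) :
    ∑ n ∈ Finset.range (2 * K), h n = ∑ m : Fin K, (h (2 * m) + h (2 * m + 1)) := by
  rw [Fin.sum_univ_eq_sum_range fun m => h (2 * m) + h (2 * m + 1)]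
  induction K with
  | zero => simp
  | succ K ih =>
    rw [mul_add, mul_one, Finset.sum_range_succ, Finset.sum_range_succ, ih, Finset.sum_range_succ,
      add_assoc]

/-- For I of level 2m, the functions h_{I₊} ± h_{I₋} are multiples of `lowSign` and `mulSign`, and
the sibling swap is `mulSign ↦ lowSign ↦ -mulSign`, as encoded in the diagonal entry. The part of
level 2m is a multiple of `highSign`, which is orthogonal to both. -/
lemma rieszLevel_odd (c : ℕ → ℕ → X) (m : Fin K) {t : ℝ} (ht : t ∈ Set.Ico (0 : ℝ) 1) :
    rieszLevel (2 * m + 1) (c (2 * m + 1)) t = ∑ i, modelEntry m m (digits K t m) i •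
      digitIncrement c m i (digitPrefix (digits K t) m) := by
  rw [rieszLevel, rademacher_odd, dyadicIndex_two_mul_add_one, digitPrefix_digits ht m.isLt.le]
  generalize digits K t m = σ
  generalize dyadicIndex (2 * m) t = x
  simp only [modelEntry, lt_irrefl, if_true, if_false, digitIncrement]
  fin_cases σ <;>
  · simp [Fin.sum_univ_four, mulSign, highSign, lowSign]
    module

/-- The odd levels of the dyadic Riesz vector are bounded by the Riesz vector. -/
theorem lintegral_odd_levels_le [CompleteSpace X] (dir : Fin K → Fin d) {r : ℝ} (hr : 1 < r)
    {C : ℝ≥0} (hC : ∀ (f : (Fin K → Fin 4) → X) (n : ℕ) (L : ℝ),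
      ∫⁻ y, ‖(quadrantKernel n).testImage dir L f y‖ₑ ^ r ≤
        C ^ r * ∫⁻ y, ‖∑ s, (quadrantKernel n).testFunction dir L s y • f s‖ₑ ^ r)
    (a : X) (c : ℕ → ℕ → X) :
    ∫⁻ t in Set.Ico (0 : ℝ) 1, ‖(WithLp.toLp 2 fun j => ∑ m : Fin K, if dir m = j then
      rieszLevel (2 * m + 1) (c (2 * m + 1)) t else 0 : PiLp 2 (fun _ : Fin d => X))‖ₑ ^ r ≤
      (ENNReal.ofReal (64 / 17) * C) ^ r * ∫⁻ t in Set.Ico (0 : ℝ) 1,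
        ‖a + ∑ n ∈ Finset.range (2 * K), haarLevel n (c n) t‖ₑ ^ r := by
  let f : (Fin K → Fin 4) → X := fun s => a + ∑ m, digitIncrement c m (s m) (digitPrefix s m)
  have hin : ∀ t ∈ Set.Ico (0 : ℝ) 1,
      a + ∑ n ∈ Finset.range (2 * K), haarLevel n (c n) t = f (digits K t) := by
    intro t ht
    simp only [f]
    rw [sum_range_two_mul]
    simp_rw [haarLevel_add_haarLevel c _ ht]
  have hout : ∀ t ∈ Set.Ico (0 : ℝ) 1, (WithLp.toLp 2 fun j => ∑ m : Fin K, if dir m = j then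
      rieszLevel (2 * m + 1) (c (2 * m + 1)) t else 0 : PiLp 2 (fun _ : Fin d => X)) =
      WithLp.toLp 2 fun j => ∑ s', modelKernel dir j (digits K t) s' • f s' := by
    intro t ht
    congr 1
    ext1 j
    simp_rw [modelKernel, Finset.sum_smul]
    rw [Finset.sum_comm]
    refine Finset.sum_congr rfl fun m _ => ?_
    split_ifs with h
    · rw [rieszLevel_odd c m ht]
      exact (sum_modelEntry_smul a (digitIncrement c) (fun m s => digitPrefix s m)
        (fun l s s' hs => digitPrefix_congr _ fun x hx => hs x hx) (sum_digitIncrement c) m _).symm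
    · simp
  have hin' := setLIntegral_congr_fun (μ := volume) measurableSet_Ico
    fun t ht => congrArg (fun x : X => ‖x‖ₑ ^ r) (hin t ht)
  have hout' := setLIntegral_congr_fun (μ := volume) measurableSet_Ico
    fun t ht => congrArg (fun x : PiLp 2 (fun _ : Fin d => X) => ‖x‖ₑ ^ r) (hout t ht)
  rw [hin', hout', lintegral_digits fun s => ‖(WithLp.toLp 2 fun j => ∑ s', modelKernel dir j s s' • f s' :
      PiLp 2 (fun _ : Fin d => X))‖ₑ ^ r, lintegral_digits fun s => ‖f s‖ₑ ^ r, mul_left_comm]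
  gcongr
  exact sum_modelKernel_le dir hr f (hC f)

end OddLevels

end DyadicRiesz

namespace DyadicRiesz

open Filter Topology

/-! ### The even levels, by restriction to the two halves -/

section EvenLevels

variable {d K : ℕ} {X : Type*} [NormedAddCommGroup X] [NormedSpace ℝ X]

lemma setLIntegral_half (e : ℝ) (g : ℝ → ℝ≥0∞) :
    ∫⁻ t in Set.Ico (e / 2) ((e + 1) / 2), g t =
      ENNReal.ofReal (1 / 2) * ∫⁻ t in Set.Ico (0 : ℝ) 1, g ((t + e) / 2) := by
  have himg : (fun t : ℝ => (t + e) / 2) '' Set.Ico 0 1 = Set.Ico (e / 2) ((e + 1) / 2) := by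
    ext t
    simp only [Set.mem_image, Set.mem_Ico]
    constructor
    · rintro ⟨x, ⟨h1, h2⟩, rfl⟩
      constructor <;> linarith
    · rintro ⟨h1, h2⟩
      exact ⟨2 * t - e, ⟨by linarith, by linarith⟩, by ring⟩
  rw [← himg, lintegral_image_eq_lintegral_abs_deriv_mul (f := fun t : ℝ => (t + e) / 2)
    (f' := fun _ => 1 / 2) measurableSet_Ico
    (fun x _ => (((hasDerivAt_id x).add_const e).div_const 2).hasDerivWithinAt)
    (fun x _ y _ h => by simpa using h)]
  rw [lintegral_const_mul' _ _ ENNReal.ofReal_ne_top, abs_of_pos (by norm_num : (0 : ℝ) < 1 / 2)]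

lemma setLIntegral_Ico_eq_halves (g : ℝ → ℝ≥0∞) :
    ∫⁻ t in Set.Ico (0 : ℝ) 1, g t = ENNReal.ofReal (1 / 2) *
      ∑ e : Fin 2, ∫⁻ t in Set.Ico (0 : ℝ) 1, g ((t + (e : ℕ)) / 2) := by
  rw [Fin.sum_univ_two, mul_add, ← setLIntegral_half, ← setLIntegral_half]
  have h : Set.Ico (0 : ℝ) 1 = Set.Ico (0 : ℝ) (1 / 2) ∪ Set.Ico (1 / 2) 1 :=
    (Set.Ico_union_Ico_eq_Ico (by norm_num) (by norm_num)).symm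
  conv_lhs => rw [h]
  rw [lintegral_union measurableSet_Ico (Set.Ico_disjoint_Ico_same)]
  norm_num

lemma dyadicIndex_half (n e : ℕ) {t : ℝ} (ht : 0 ≤ t) :
    dyadicIndex (n + 1) ((t + e) / 2) = dyadicIndex n t + 2 ^ n * e := by
  have h : (2 : ℝ) ^ (n + 1) * ((t + e) / 2) = 2 ^ n * t + ((2 ^ n * e : ℕ) : ℝ) := by
    push_cast
    rw [pow_succ]
    ring
  rw [dyadicIndex, h, Nat.floor_add_natCast (by positivity), dyadicIndex]

lemma rademacher_half (n e : ℕ) {t : ℝ} (ht : 0 ≤ t) :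
    rademacher (n + 1) ((t + e) / 2) = rademacher n t := by
  rw [rademacher, dyadicIndex_half _ _ ht, rademacher]
  have : (2 : ℕ) ^ (n + 1) * e = 2 * (2 ^ n * e) := by ring
  simp only [Nat.odd_iff, this, Nat.add_mul_mod_self_left]

lemma rademacher_zero_half (e : Fin 2) {t : ℝ} (ht : t ∈ Set.Ico (0 : ℝ) 1) :
    rademacher 0 ((t + (e : ℕ)) / 2) = if (e : ℕ) = 1 then 1 else -1 := by
  have h0 := dyadicIndex_lt (n := 0) ht
  simp only [pow_zero, Nat.lt_one_iff] at h0
  rw [rademacher, dyadicIndex_half _ _ ht.1, h0]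
  have h : Odd (0 + 2 ^ 0 * (e : ℕ)) ↔ (e : ℕ) = 1 := by
    rw [Nat.odd_iff]
    omega
  simp only [h]

lemma haarLevel_half (n e : ℕ) (c : ℕ → X) {t : ℝ} (ht : 0 ≤ t) :
    haarLevel (n + 1) c ((t + e) / 2) = haarLevel n (fun k => √2 • c (k + 2 ^ n * e)) t := by
  rw [haarLevel, haarLevel, rademacher_half _ _ ht, dyadicIndex_half _ _ ht, smul_smul, pow_succ,
    Real.sqrt_mul (by positivity)]
  congr 1
  ring

/-- Rescaling a half to the full interval lowers the level by one; √2 corrects the Haar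
normalisation and `2 ^ n * e` is the index offset of the half. For `n = 0` the sibling would lie in
the other half. -/
lemma rieszLevel_half {n : ℕ} (hn : n ≠ 0) (e : ℕ) (c : ℕ → X) {t : ℝ} (ht : 0 ≤ t) :
    rieszLevel (n + 1) c ((t + e) / 2) = rieszLevel n (fun k => √2 • c (k + 2 ^ n * e)) t := by
  obtain ⟨m, rfl⟩ := Nat.exists_eq_succ_of_ne_zero hn
  rw [rieszLevel, rieszLevel, rademacher_half _ _ ht, dyadicIndex_half _ _ ht, Nat.succ_eq_add_one]
  have h2 : (2 : ℕ) ^ (m + 1) * e = 2 * (2 ^ m * e) := by ring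
  set x := dyadicIndex (m + 1) t
  have heven : Even (x + 2 ^ (m + 1) * e) ↔ Even x := by
    rw [h2, Nat.even_iff, Nat.even_iff, Nat.add_mul_mod_self_left]
  rw [pow_succ (2 : ℝ), Real.sqrt_mul (by positivity)]
  simp only [heven]
  split_ifs with h
  · rw [smul_smul, add_right_comm]
    congr 1
    ring
  · have hx : x + 2 ^ (m + 1) * e - 1 = x - 1 + 2 ^ (m + 1) * e := by
      rw [Nat.even_iff] at h
      omega
    rw [hx, ← smul_neg, smul_smul]
    congr 1
    ring

/-- The even levels of the dyadic Riesz vector are bounded by the Riesz vector. -/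
theorem lintegral_even_levels_le [CompleteSpace X] (dir : Fin K → Fin d) {r : ℝ} (hr : 1 < r)
    {C : ℝ≥0} (hC : ∀ (f : (Fin K → Fin 4) → X) (n : ℕ) (L : ℝ),
      ∫⁻ y, ‖(quadrantKernel n).testImage dir L f y‖ₑ ^ r ≤
        C ^ r * ∫⁻ y, ‖∑ s, (quadrantKernel n).testFunction dir L s y • f s‖ₑ ^ r)
    (a : X) (c : ℕ → ℕ → X) :
    ∫⁻ t in Set.Ico (0 : ℝ) 1, ‖(WithLp.toLp 2 fun j => ∑ m : Fin K, if dir m = j then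
      rieszLevel (2 * m + 2) (c (2 * m + 2)) t else 0 : PiLp 2 (fun _ : Fin d => X))‖ₑ ^ r ≤
      (ENNReal.ofReal (64 / 17) * C) ^ r * ∫⁻ t in Set.Ico (0 : ℝ) 1,
        ‖a + ∑ n ∈ Finset.range (2 * K + 1), haarLevel n (c n) t‖ₑ ^ r := by
  rw [setLIntegral_Ico_eq_halves, setLIntegral_Ico_eq_halves (fun t => ‖a + _‖ₑ ^ r), mul_left_comm]
  refine mul_le_mul_right ?_ _
  rw [Finset.mul_sum]
  refine Finset.sum_le_sum fun e _ => ?_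
  -- On each half h_{I₀} is constant and is absorbed into the mean.
  let a' : X := a + (if (e : ℕ) = 1 then 1 else -1 : ℝ) • c 0 0
  let c' : ℕ → ℕ → X := fun n k => √2 • c (n + 1) (k + 2 ^ n * e)
  have hin : ∀ t ∈ Set.Ico (0 : ℝ) 1, a + ∑ n ∈ Finset.range (2 * K + 1),
      haarLevel n (c n) ((t + (e : ℕ)) / 2) =
      a' + ∑ n ∈ Finset.range (2 * K), haarLevel n (c' n) t := by
    intro t ht
    have ht2 : (t + (e : ℕ)) / 2 ∈ Set.Ico (0 : ℝ) 1 := by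
      have h1 : ((e : ℕ) : ℝ) ≤ 1 := by exact_mod_cast Nat.lt_succ_iff.1 e.isLt
      have h2 : (0 : ℝ) ≤ (e : ℕ) := Nat.cast_nonneg _
      exact ⟨by linarith [ht.1], by linarith [ht.2]⟩
    have h0 := dyadicIndex_lt (n := 0) ht2
    simp only [pow_zero, Nat.lt_one_iff] at h0
    rw [Finset.sum_range_succ', haarLevel, h0, rademacher_zero_half e ht, pow_zero, Real.sqrt_one,
      one_mul, add_comm (∑ n ∈ _, _), ← add_assoc]
    congr 1
    exact Finset.sum_congr rfl fun n _ => haarLevel_half n e _ ht.1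
  have hout : ∀ t ∈ Set.Ico (0 : ℝ) 1, (WithLp.toLp 2 fun j => ∑ m : Fin K, if dir m = j then
      rieszLevel (2 * m + 2) (c (2 * m + 2)) ((t + (e : ℕ)) / 2) else 0 :
        PiLp 2 (fun _ : Fin d => X)) = WithLp.toLp 2 fun j => ∑ m : Fin K, if dir m = j then
      rieszLevel (2 * m + 1) (c' (2 * m + 1)) t else 0 := by
    intro t ht
    congr 1
    ext1 j
    refine Finset.sum_congr rfl fun m _ => ?_
    rw [rieszLevel_half (by omega) e _ ht.1]
  have hin' := setLIntegral_congr_fun (μ := volume) measurableSet_Ico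
    fun t ht => congrArg (fun x : X => ‖x‖ₑ ^ r) (hin t ht)
  have hout' := setLIntegral_congr_fun (μ := volume) measurableSet_Ico
    fun t ht => congrArg (fun x : PiLp 2 (fun _ : Fin d => X) => ‖x‖ₑ ^ r) (hout t ht)
  rw [hin', hout']
  exact lintegral_odd_levels_le dir hr hC a' c'

end EvenLevels

/-! ### Combination of the odd and even levels -/

section Main

variable {d : ℕ} {X : Type*} [NormedAddCommGroup X] [NormedSpace ℝ X]

lemma measurable_dyadicIndex (n : ℕ) : Measurable (dyadicIndex n) := by
  unfold dyadicIndex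
  exact Nat.measurable_floor.comp (by fun_prop)

/-- Factoring through the countable discrete space `ℕ` gives strong measurability for arbitrary `X`.
-/
lemma rieszLevel_eq_comp (n : ℕ) (c : ℕ → X) :
    ∃ F : ℕ → X, ∀ t, rieszLevel n c t = F (dyadicIndex (n + 1) t) := by
  refine ⟨fun k => (√(2 ^ n) * if Odd k then 1 else -1) •
    if Even (k / 2 ^ 1) then c (k / 2 ^ 1 + 1) else -c (k / 2 ^ 1 - 1), fun t => ?_⟩
  rw [rieszLevel, dyadicIndex_add n 1 t, rademacher]

lemma aestronglyMeasurable_toLp_rieszLevel {K : ℕ} (dir : Fin K → Fin d) (ν : Fin K → ℕ)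
    (c : ℕ → ℕ → X) (μ : Measure ℝ) :
    AEStronglyMeasurable (fun t => (WithLp.toLp 2 fun j => ∑ m : Fin K, if dir m = j then
      rieszLevel (ν m) (c (ν m)) t else 0 : PiLp 2 (fun _ : Fin d => X))) μ := by
  choose F hF using fun m => rieszLevel_eq_comp (ν m) (c (ν m))
  simp_rw [hF]
  let G : (Fin K → ℕ) → PiLp 2 (fun _ : Fin d => X) := fun k =>
    WithLp.toLp 2 fun j => ∑ m : Fin K, if dir m = j then F m (k m) else 0
  exact ((StronglyMeasurable.of_discrete (f := G)).comp_measurable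
    (measurable_pi_lambda (fun t m => dyadicIndex (ν m + 1) t)
      fun m => measurable_dyadicIndex _)).aestronglyMeasurable

lemma eLpNorm_le_mul_iff {Ω Y Z : Type*} [MeasurableSpace Ω] {μ : Measure Ω}
    [NormedAddCommGroup Y] [NormedAddCommGroup Z] {p : ℝ≥0∞} (h0 : p ≠ 0) (htop : p ≠ ⊤)
    (C : ℝ≥0∞) (f : Ω → Y) (g : Ω → Z) :
    eLpNorm f p μ ≤ C * eLpNorm g p μ ↔
      ∫⁻ x, ‖f x‖ₑ ^ p.toReal ∂μ ≤ C ^ p.toReal * ∫⁻ x, ‖g x‖ₑ ^ p.toReal ∂μ := by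
  have hp : 0 < p.toReal := ENNReal.toReal_pos h0 htop
  rw [← ENNReal.rpow_le_rpow_iff hp, ENNReal.mul_rpow_of_nonneg _ _ hp.le,
    eLpNorm_eq_lintegral_rpow_enorm_toReal h0 htop, eLpNorm_eq_lintegral_rpow_enorm_toReal h0 htop,
    ← ENNReal.rpow_mul, ← ENNReal.rpow_mul, one_div_mul_cancel hp.ne', ENNReal.rpow_one,
    ENNReal.rpow_one]

lemma sum_filter_dyadicRiesz {Y : Type*} [AddCommMonoid Y] (h : ℕ → Y) (hd : 0 < d) (j : Fin d)
    (K : ℕ) :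
    ∑ n ∈ (Finset.range (2 * K + 1)).filter (fun n => n ≠ 0 ∧ n % d = j), h n =
      (∑ m : Fin K, if (⟨(2 * m + 1) % d, Nat.mod_lt _ hd⟩ : Fin d) = j then h (2 * m + 1) else 0) +
      ∑ m : Fin K, if (⟨(2 * m + 2) % d, Nat.mod_lt _ hd⟩ : Fin d) = j then h (2 * m + 2) else 0 := by
  rw [Finset.sum_filter, Finset.sum_range_succ', sum_range_two_mul, Finset.sum_add_distrib]
  simp [Fin.ext_iff]

/-- A bound for the Riesz vector gives a bound for the dyadic Riesz vector. -/
theorem eLpNorm_dyadicRiesz_le [CompleteSpace X] (hd : 0 < d) {p : ℝ≥0∞} (hp : 1 < p) (hp' : p < ⊤)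
    {C : ℝ≥0} (hC : ∀ (M : ℕ) (f : Fin M → 𝓢(EuclideanSpace ℝ (Fin d), ℝ)) (x : Fin M → X),
      eLpNorm (fun y => (WithLp.toLp 2 (fun j : Fin d => ∑ i, riesz j (f i) y • x i) :
        PiLp 2 (fun _ : Fin d => X))) p volume
      ≤ C * eLpNorm (fun y => ∑ i, f i y • x i) p volume) (N : ℕ) (a : X) (c : ℕ → ℕ → X) :
    eLpNorm (fun t => (WithLp.toLp 2 (fun j : Fin d => dyadicRiesz j N c t) :
        PiLp 2 (fun _ : Fin d => X))) p (volume.restrict (Set.Ico (0 : ℝ) 1))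
      ≤ (128 / 17 * C : ℝ≥0) * eLpNorm (haarSum N a c) p (volume.restrict (Set.Ico (0 : ℝ) 1)) := by
  have hp0 : p ≠ 0 := (zero_lt_one.trans hp).ne'
  have hr : 1 < p.toReal := by
    rw [← ENNReal.toReal_one]
    exact (ENNReal.toReal_lt_toReal ENNReal.one_ne_top hp'.ne).2 hp
  have hC' : ∀ (dir : Fin N → Fin d) (f : (Fin N → Fin 4) → X) (n : ℕ) (L : ℝ),
      ∫⁻ y, ‖(quadrantKernel n).testImage dir L f y‖ₑ ^ p.toReal ≤
        C ^ p.toReal *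
          ∫⁻ y, ‖∑ s, (quadrantKernel n).testFunction dir L s y • f s‖ₑ ^ p.toReal := by
    intro dir f n L
    rw [← eLpNorm_le_mul_iff hp0 hp'.ne]
    let e := Fintype.equivFin (Fin N → Fin 4)
    have h := hC _ (fun i => (quadrantKernel n).testFunction dir L (e.symm i))
      (fun i => f (e.symm i))
    have h1 : ∀ y, ∑ i, (quadrantKernel n).testFunction dir L (e.symm i) y • f (e.symm i) =
        ∑ s, (quadrantKernel n).testFunction dir L s y • f s := fun y =>
      e.symm.sum_comp fun s => (quadrantKernel n).testFunction dir L s y • f s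
    have h2 : ∀ (j : Fin d) y, ∑ i, riesz j ((quadrantKernel n).testFunction dir L (e.symm i)) y •
        f (e.symm i) = ∑ s, riesz j ((quadrantKernel n).testFunction dir L s) y • f s := fun j y =>
      e.symm.sum_comp fun s => riesz j ((quadrantKernel n).testFunction dir L s) y • f s
    simp_rw [h1, h2] at h
    exact h
  -- Padding by zero lets `N` base 4 digits serve both cases: the odd levels use the sum up to `2 *
  -- N`, the even levels the sum up to `2 * N + 1`.
  let c' : ℕ → ℕ → X := fun n => if n < N then c n else 0
  have hc' : ∀ n, N ≤ n → c' n = 0 := fun n hn => if_neg (not_lt.2 hn)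
  have hzero : ∀ n t, rieszLevel n (0 : ℕ → X) t = 0 ∧ haarLevel n (0 : ℕ → X) t = 0 := by
    intro n t
    simp [rieszLevel, haarLevel]
  have hhaar : ∀ M, N ≤ M → ∀ t ∈ Set.Ico (0 : ℝ) 1,
      haarSum N a c t = a + ∑ n ∈ Finset.range M, haarLevel n (c' n) t := by
    intro M hM t ht
    rw [haarSum_eq N a c ht]
    congr 1
    rw [← Finset.sum_subset (Finset.range_mono hM)]
    · refine Finset.sum_congr rfl fun n hn => ?_
      simp only [c', if_pos (Finset.mem_range.1 hn)]
    · intro n _ hn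
      rw [hc' n (by simpa using hn), (hzero n t).2]
  let dir₁ : Fin N → Fin d := fun m => ⟨(2 * m + 1) % d, Nat.mod_lt _ hd⟩
  let dir₂ : Fin N → Fin d := fun m => ⟨(2 * m + 2) % d, Nat.mod_lt _ hd⟩
  let g₁ : ℝ → PiLp 2 (fun _ : Fin d => X) := fun t => WithLp.toLp 2 fun j =>
    ∑ m : Fin N, if dir₁ m = j then rieszLevel (2 * m + 1) (c' (2 * m + 1)) t else 0
  let g₂ : ℝ → PiLp 2 (fun _ : Fin d => X) := fun t => WithLp.toLp 2 fun j =>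
    ∑ m : Fin N, if dir₂ m = j then rieszLevel (2 * m + 2) (c' (2 * m + 2)) t else 0
  have hriesz : ∀ t ∈ Set.Ico (0 : ℝ) 1,
      (WithLp.toLp 2 (fun j : Fin d => dyadicRiesz j N c t) : PiLp 2 (fun _ : Fin d => X)) =
      (g₁ + g₂) t := by
    intro t ht
    ext j
    rw [Pi.add_apply, PiLp.add_apply]
    simp only [g₁, g₂, dir₁, dir₂]
    rw [← sum_filter_dyadicRiesz (fun n => rieszLevel n (c' n) t) hd j N, dyadicRiesz_eq j N c ht,
      ← Finset.sum_subset (Finset.filter_subset_filter _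
        (Finset.range_mono (by omega : N ≤ 2 * N + 1)))]
    · refine Finset.sum_congr rfl fun n hn => ?_
      simp only [c', if_pos (Finset.mem_range.1 (Finset.mem_filter.1 hn).1)]
    · intro n hn hn'
      have : N ≤ n := by
        by_contra h
        exact hn' (Finset.mem_filter.2 ⟨Finset.mem_range.2 (not_le.1 h), (Finset.mem_filter.1 hn).2⟩)
      rw [hc' n this, (hzero n t).1]
  set μ := volume.restrict (Set.Ico (0 : ℝ) 1)
  have hae : ∀ᵐ t ∂μ, t ∈ Set.Ico (0 : ℝ) 1 := ae_restrict_mem measurableSet_Ico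
  have h₁ : eLpNorm g₁ p μ ≤ (ENNReal.ofReal (64 / 17) * C) * eLpNorm (haarSum N a c) p μ := by
    rw [eLpNorm_congr_ae (hae.mono fun t ht => hhaar (2 * N) (by omega) t ht),
      eLpNorm_le_mul_iff hp0 hp'.ne]
    exact lintegral_odd_levels_le dir₁ hr (hC' dir₁) a c'
  have h₂ : eLpNorm g₂ p μ ≤ (ENNReal.ofReal (64 / 17) * C) * eLpNorm (haarSum N a c) p μ := by
    rw [eLpNorm_congr_ae (hae.mono fun t ht => hhaar (2 * N + 1) (by omega) t ht),
      eLpNorm_le_mul_iff hp0 hp'.ne]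
    exact lintegral_even_levels_le dir₂ hr (hC' dir₂) a c'
  have hconst : ((128 / 17 * C : ℝ≥0) : ℝ≥0∞) =
      ENNReal.ofReal (64 / 17) * C + ENNReal.ofReal (64 / 17) * C := by
    have : ENNReal.ofReal (64 / 17) = ((64 / 17 : ℝ≥0) : ℝ≥0∞) := by
      rw [← ENNReal.ofReal_coe_nnreal]
      norm_num
    rw [this, ← ENNReal.coe_mul, ← ENNReal.coe_add, ENNReal.coe_inj, ← add_mul]
    norm_num
  calc eLpNorm (fun t => (WithLp.toLp 2 (fun j : Fin d => dyadicRiesz j N c t) :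
        PiLp 2 (fun _ : Fin d => X))) p μ = eLpNorm (g₁ + g₂) p μ :=
        eLpNorm_congr_ae (hae.mono hriesz)
    _ ≤ eLpNorm g₁ p μ + eLpNorm g₂ p μ := eLpNorm_add_le
        (aestronglyMeasurable_toLp_rieszLevel dir₁ _ c' μ)
        (aestronglyMeasurable_toLp_rieszLevel dir₂ _ c' μ) hp.le
    _ ≤ _ := by
        rw [hconst, add_mul]
        exact add_le_add h₁ h₂

end Main

end DyadicRiesz

theorem theorem1 :
    ∃ c₀ : ℝ≥0, ∀ (d : ℕ), 1 ≤ d → ∀ (p : ℝ≥0∞), 1 < p → p < ⊤ →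
      ∀ (X : Type*) [NormedAddCommGroup X] [NormedSpace ℝ X] [CompleteSpace X],
        DyadicRiesz.IsUMD X →
          DyadicRiesz.dyadicRieszNorm d p X ≤ c₀ * DyadicRiesz.rieszNorm d p X := by
  refine ⟨128 / 17, fun d hd p hp hp' X _ _ _ _ => ?_⟩
  have h0 : ((128 / 17 : ℝ≥0) : ℝ≥0∞) ≠ 0 := by
    rw [ENNReal.coe_ne_zero]
    norm_num
  rw [DyadicRiesz.rieszNorm, ENNReal.mul_iInf_of_ne h0 ENNReal.coe_ne_top]
  refine le_iInf fun C => ?_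
  rw [ENNReal.mul_iInf_of_ne h0 ENNReal.coe_ne_top]
  refine le_iInf fun hC => ?_
  rw [← ENNReal.coe_mul]
  exact iInf₂_le _ (DyadicRiesz.eLpNorm_dyadicRiesz_le hd hp hp' hC)
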